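/- Let $(\mathsf X,\mathcal X)$ be a measurable space, $n\ge 0$ an integer, $M_0$ a probability measure on $\mathsf X$, $M_1,\dots,M_n$ Markov kernels on $\mathsf X$, and $G_0,\dots,G_n:\mathsf X\to\mathbb R$ measurable, strictly positive and bounded above. Put $\gamma_0=M_0$, $\gamma_p(S)=\int\gamma_{p-1}(dx)G_{p-1}(x)M_p(x,S)$ for $1\le p\le n$, and $\eta_p=\gamma_p/\gamma_p(\mathsf X)$; write $\mu(\varphi)=\int\varphi\,d\mu$. Let $c_0,\dots,c_n>0$ and, for $N\in\mathbb N$, let $N_p=\lceil c_pN\rceil$. For each $N$ such that $\min_{0\le p\le n} N_p\ge 2$ consider a particle filter with $N_p$ particles at time $p$: the particles $\zeta_0^1,\dots,\zeta_0^{N_0}$ are i.i.d. from $M_0$, and for $p=1,\dots,n$, conditionally on everything generated up to time $p-1$, the pairs $(A_{p-1}^i,\zeta_p^i)$, $1\le i\le N_p$, are i.i.d., where $A_{p-1}^i\in\{1,\dots,N_{p-1}\}$ equals $j$ with probability $G_{p-1}(\zeta_{p-1}^j)/\sum_l G_{p-1}(\zeta_{p-1}^l)$ and, given $A_{p-1}^i=j$,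 $\zeta_p^i\sim M_p(\zeta_{p-1}^{j},\cdot)$. The Eve indices are $E_0^i=i$ and $E_p^i=E_{p-1}^{A_{p-1}^i}$. For a function $\varphi:\mathsf X\to\mathbb R$ put $\eta_p^N(\varphi)=N_p^{-1}\sum_{i=1}^{N_p}\varphi(\zeta_p^i)$, $\gamma_n^N(\varphi)=\bigl\{\prod_{p=0}^{n-1}\eta_p^N(G_p)\bigr\}\eta_n^N(\varphi)$ and $$V_n^N(\varphi)=\eta_n^N(\varphi)^2-\Bigl(\prod_{p=0}^{n-1}\frac{N_p}{N_p-1}\Bigr)\frac1{N_n(N_n-1)}\sum_{i,j:\,E_n^i\ne E_n^j}\varphi(\zeta_n^i)\varphi(\zeta_n^j).$$ Then there is a map $\sigma_n^2$ from the bounded measurable functions on $\mathsf X$ to $[0,\infty)$, depending only on $n$, $(M_p)$, $(G_p)$ and $(c_p)$, which gives the asymptotic variances of the particle approximations, i.e. for every bounded measurable $\varphi:\mathsf X\to\mathbb R$, as $N\to\infty$, $$N\,\mathrm{var}\{\gamma_n^N(\varphi)/\gamma_n(1)\}\to\sigma_n^2(\varphi),\qquad N\,E\bigl[\{\eta_n^N(\varphi)-\eta_n(\varphi)\}^2\bigr]\to\sigma_n^2(\varphi-\eta_n(\varphi)),$$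 and for every bounded measurable $\varphi$ the following hold: 1. $E\{\gamma_n^N(1)^2V_n^N(\varphi)\}=\mathrm{var}\{\gamma_n^N(\varphi)\}$ for every $N$ with $\min_p N_p\ge2$; 2. $N\,V_n^N(\varphi)\to\sigma_n^2(\varphi)$ in probability as $N\to\infty$; 3. $N\,V_n^N(\varphi-\eta_n^N(\varphi))\to\sigma_n^2(\varphi-\eta_n(\varphi))$ in probability as $N\to\infty$. -/

import Mathlib

open MeasureTheory ProbabilityTheory Filter Topology

namespace ParticleFilter

noncomputable section

/-- Bounded measurable real functions. -/
def IsBddMeas {X : Type*} [MeasurableSpace X] (φ : X → ℝ) : Prop :=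
  Measurable φ ∧ ∃ C : ℝ, ∀ x, |φ x| ≤ C

/-- The unnormalized Feynman-Kac measures: `γ₀ = M₀` and
`γ_{p+1}(S) = ∫ γ_p(dx) G_p(x) M_{p+1}(x, S)`. The kernel `M 0` is not used. -/
def gammaMeas {X : Type*} [MeasurableSpace X] (M₀ : Measure X) (M : ℕ → Kernel X X)
    (G : ℕ → X → ℝ) : ℕ → Measure X
  | 0 => M₀
  | p + 1 =>
      ((gammaMeas M₀ M G p).withDensity (fun x => ENNReal.ofReal (G p x))).bind (M (p + 1))

/-- The normalized Feynman-Kac measures `η_p = γ_p / γ_p(X)`. -/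
def etaMeas {X : Type*} [MeasurableSpace X] (M₀ : Measure X) (M : ℕ → Kernel X X)
    (G : ℕ → X → ℝ) (p : ℕ) : Measure X :=
  (gammaMeas M₀ M G p Set.univ)⁻¹ • gammaMeas M₀ M G p

/-- The number of particles `N_p = ⌈c_p N⌉` at time `p`. -/
def numParticles (c : ℕ → ℝ) (N p : ℕ) : ℕ := ⌈c p * (N : ℝ)⌉₊

/-- The law of one pair (ancestor index, new particle), given the current particles
`x 0, …, x (k - 1)`: the index `j` is drawn from the categorical distribution with weights
proportional to `g (x j)`, and then the new particle is drawn from `K (x j)`. -/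
def offspringLaw {X : Type*} [MeasurableSpace X] (g : X → ℝ) (K : Kernel X X) {k : ℕ}
    (x : Fin k → X) : Measure (Fin k × X) :=
  ∑ j : Fin k, ENNReal.ofReal (g (x j) / ∑ l : Fin k, g (x l)) •
    (Measure.dirac j).prod (K (x j))

/-- The σ-algebra generated by the particles up to time `p` and the ancestor indices
`A_q`, `q < p`. -/
@[reducible] def history {X Ω : Type*} [MeasurableSpace X] {k : ℕ → ℕ}
    (ζ : (p : ℕ) → Fin (k p) → Ω → X) (A : (p : ℕ) → Fin (k (p + 1)) → Ω → Fin (k p))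
    (p : ℕ) : MeasurableSpace Ω :=
  (⨆ (q : ℕ) (_ : q ≤ p) (i : Fin (k q)), MeasurableSpace.comap (ζ q i) inferInstance) ⊔
    ⨆ (q : ℕ) (_ : q < p) (i : Fin (k (q + 1))), MeasurableSpace.comap (A q i) inferInstance

/-- `(ζ, A)` is, up to time `n`, a realization of the particle filter with `k p` particles at
time `p`: the initial particles are i.i.d. from `M₀`, and for each `p < n`, conditionally on the
history up to time `p`, the pairs `(A_p^i, ζ_{p+1}^i)` are i.i.d. from the offspring law of the
particles at time `p`. Nothing is required of `ζ p` for `p > n` or of `A p` for `p ≥ n`. -/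
structure IsParticleFilter {X Ω : Type*} [MeasurableSpace X] [MeasurableSpace Ω]
    (P : Measure Ω) (M₀ : Measure X) (M : ℕ → Kernel X X) (G : ℕ → X → ℝ) (n : ℕ) (k : ℕ → ℕ)
    (ζ : (p : ℕ) → Fin (k p) → Ω → X) (A : (p : ℕ) → Fin (k (p + 1)) → Ω → Fin (k p)) :
    Prop where
  measurable_particle : ∀ p ≤ n, ∀ i, Measurable (ζ p i)
  measurable_ancestor : ∀ p < n, ∀ i, Measurable (A p i)
  initial_law : P.map (fun ω i => ζ 0 i ω) = Measure.pi (fun _ : Fin (k 0) => M₀)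
  transition_law : ∀ p < n, ∀ B : Set Ω, MeasurableSet[history ζ A p] B →
    ∀ S : Set (Fin (k (p + 1)) → Fin (k p) × X), MeasurableSet S →
      P (B ∩ {ω | (fun i => (A p i ω, ζ (p + 1) i ω)) ∈ S}) =
        ∫⁻ ω in B, Measure.pi
          (fun _ : Fin (k (p + 1)) => offspringLaw (G p) (M (p + 1)) (fun j => ζ p j ω)) S ∂P

/-- The Eve indices: `E_0^i = i` and `E_{p+1}^i = E_p^{A_p^i}`. -/
def eve {Ω : Type*} {k : ℕ → ℕ} (A : (p : ℕ) → Fin (k (p + 1)) → Ω → Fin (k p)) :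
    (p : ℕ) → Fin (k p) → Ω → Fin (k 0)
  | 0, i, _ => i
  | p + 1, i, ω => eve A p (A p i ω) ω

/-- `η_p^N(φ)`, the empirical mean of `φ` over the particles at time `p`. -/
def etaN {X Ω : Type*} {k : ℕ → ℕ} (ζ : (p : ℕ) → Fin (k p) → Ω → X) (p : ℕ) (φ : X → ℝ)
    (ω : Ω) : ℝ :=
  (∑ i : Fin (k p), φ (ζ p i ω)) / (k p : ℝ)

/-- `γ_n^N(φ) = (∏_{p < n} η_p^N(G_p)) η_n^N(φ)`. -/
def gammaN {X Ω : Type*} {k : ℕ → ℕ} (G : ℕ → X → ℝ) (ζ : (p : ℕ) → Fin (k p) → Ω → X)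
    (n : ℕ) (φ : X → ℝ) (ω : Ω) : ℝ :=
  (∏ p ∈ Finset.range n, etaN ζ p (G p) ω) * etaN ζ n φ ω

/-- The variance estimator `V_n^N(φ)`. -/
def varEst {X Ω : Type*} {k : ℕ → ℕ} (ζ : (p : ℕ) → Fin (k p) → Ω → X)
    (A : (p : ℕ) → Fin (k (p + 1)) → Ω → Fin (k p)) (n : ℕ) (φ : X → ℝ) (ω : Ω) : ℝ :=
  etaN ζ n φ ω ^ 2 -
    (∏ p ∈ Finset.range n, (k p : ℝ) / ((k p : ℝ) - 1)) *
      (1 / ((k n : ℝ) * ((k n : ℝ) - 1))) *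
      ∑ i : Fin (k n), ∑ j : Fin (k n),
        if eve A n i ω ≠ eve A n j ω then φ (ζ n i ω) * φ (ζ n j ω) else 0

/-- Convergence in probability to a constant; the variables `Y N` may live on different
probability spaces. -/
def TendstoInProb {Ω : ℕ → Type*} [∀ N, MeasurableSpace (Ω N)] (P : (N : ℕ) → Measure (Ω N))
    (Y : (N : ℕ) → Ω N → ℝ) (a : ℝ) : Prop :=
  ∀ ε : ℝ, 0 < ε → Tendsto (fun N => P N {ω | ε ≤ |Y N ω - a|}) atTop (𝓝 0)

end

end ParticleFilter

open ParticleFilter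

/-! Write $Q_pf=G_p\,M_{p+1}f$ (`fkOp`), and split $\gamma_p^N(f)$ according to the Eve index of the
particles. Everything rests on two quadratic statistics: $\gamma_p^N(f)^2$ and the sum $T_p(f)$ over
Eve indices of the squared contributions (`State.tagSq`). Their difference is the sum over pairs
with distinct Eve indices. Given generation $p$, both have conditional mean
$\frac1{N_{p+1}}\gamma_p^N(G_p)\gamma_p^N(Q_pf^2)+(1-\frac1{N_{p+1}})(\cdot)$, where $(\cdot)$ is
the same statistic at time $p$ for $Q_pf$ (`State.integral_mean_next_sq`,
`State.integral_tagSq_next`). The diagonal term cancels in the difference, so with $b_p=\prod_{q\le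
p}N_q/(N_q-1)$ one gets $b_p\,E\{\gamma_p^N(f)^2-T_p(f)\}=\gamma_p(f)^2$ by induction. Since
$\gamma_n^N(1)^2V_n^N(\varphi)=b_nT_n(\varphi)-(b_n-1)\gamma_n^N(\varphi)^2$
(`gammaN_one_sq_mul_varEst`), this is lack of bias (`integral_varEst`).

For consistency, $N\,T_p(f)$ is shown to converge in $L^1$ to a constant, by induction on $p$
(`tendstoInMean_tagSq`). The conditional mean converges by the recursion above. The conditional
variance is controlled by the Efron-Stein inequality (`variance_pi_le`, `variance_sum_tag_sq_le`):
deleting one particle changes only the square of its own family, so the variance is at most of order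
$N^{-1}$ times the sum of cubed family weights, whose mean is of order $N^{-2}$
(`exists_tagCube_le`). Together with $N(b_n-1)\to\sum_q1/c_q$ this gives the $L^1$ limit of
$N\gamma_n^N(1)^2V_n^N(\varphi)$.

The asymptotic variance then comes at no further cost: taking expectations in that $L^1$ limit and
using lack of bias yields the limit of $N\,\mathrm{var}\{\gamma_n^N(\varphi)\}$, with no central
limit theorem. Division by $\gamma_n^N(1)^2$ gives consistency of $V_n^N(\varphi)$. The centred
version follows because $V_n^N$ and $\sigma_n^2$ are quadratic forms: their values at $\varphi-a$
are the same combination, polynomial in $a$, of their values at the fixed functions $\varphi$, $1$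
and $\varphi+1$. The mean squared error of $\eta_n^N$ reduces to the variance of $\gamma_n^N$,
because fourth moments of order $N^{-2}$ make the change of normalization negligible
(`tendsto_normalization_error`). -/

namespace ParticleFilter

noncomputable section

/-! ### Bounded measurable functions -/

namespace IsBddMeas

variable {S : Type*} [MeasurableSpace S] {f g : S → ℝ}

lemma const (a : ℝ) : IsBddMeas (fun _ : S => a) :=
  ⟨measurable_const, |a|, fun _ => le_rfl⟩

lemma add (hf : IsBddMeas f) (hg : IsBddMeas g) : IsBddMeas (fun x => f x + g x) := by
  obtain ⟨hf, C, hC⟩ := hf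
  obtain ⟨hg, D, hD⟩ := hg
  exact ⟨hf.add hg, C + D, fun x => (abs_add_le _ _).trans (add_le_add (hC x) (hD x))⟩

lemma mul (hf : IsBddMeas f) (hg : IsBddMeas g) : IsBddMeas (fun x => f x * g x) := by
  obtain ⟨hf, C, hC⟩ := hf
  obtain ⟨hg, D, hD⟩ := hg
  refine ⟨hf.mul hg, C * D, fun x => ?_⟩
  rw [abs_mul]
  exact mul_le_mul (hC x) (hD x) (abs_nonneg _) ((abs_nonneg _).trans (hC x))

lemma const_mul (a : ℝ) (hf : IsBddMeas f) : IsBddMeas (fun x => a * f x) := (const a).mul hf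

lemma mul_const (hf : IsBddMeas f) (a : ℝ) : IsBddMeas (fun x => f x * a) := hf.mul (const a)

lemma div_const (hf : IsBddMeas f) (a : ℝ) : IsBddMeas (fun x => f x / a) := by
  simpa only [div_eq_mul_inv] using hf.mul_const a⁻¹

lemma sub (hf : IsBddMeas f) (hg : IsBddMeas g) : IsBddMeas (fun x => f x - g x) := by
  simpa only [sub_eq_add_neg, neg_one_mul] using hf.add (hg.const_mul (-1))

lemma pow (hf : IsBddMeas f) (n : ℕ) : IsBddMeas (fun x => f x ^ n) := by
  induction n with
  | zero => simpa using const (S := S) 1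
  | succ n ih => simpa only [pow_succ] using ih.mul hf

lemma abs (hf : IsBddMeas f) : IsBddMeas (fun x => |f x|) := by
  obtain ⟨hf, C, hC⟩ := hf
  exact ⟨measurable_norm.comp hf, C, fun x => by simpa using hC x⟩

lemma sum {ι : Type*} {s : Finset ι} {F : ι → S → ℝ} (h : ∀ i ∈ s, IsBddMeas (F i)) :
    IsBddMeas (fun x => ∑ i ∈ s, F i x) := by
  classical
  induction s using Finset.induction_on with
  | empty => simpa using const (S := S) 0
  | insert a s ha ih =>
    simp only [Finset.sum_insert ha]
    exact (h a (by simp)).add (ih fun i hi => h i (by simp [hi]))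

lemma prod {ι : Type*} {s : Finset ι} {F : ι → S → ℝ} (h : ∀ i ∈ s, IsBddMeas (F i)) :
    IsBddMeas (fun x => ∏ i ∈ s, F i x) := by
  classical
  induction s using Finset.induction_on with
  | empty => simpa using const (S := S) 1
  | insert a s ha ih =>
    simp only [Finset.prod_insert ha]
    exact (h a (by simp)).mul (ih fun i hi => h i (by simp [hi]))

lemma comp {T : Type*} [MeasurableSpace T] (hf : IsBddMeas f) {u : T → S} (hu : Measurable u) :
    IsBddMeas (fun x => f (u x)) := by
  obtain ⟨hf, C, hC⟩ := hf
  exact ⟨hf.comp hu, C, fun x => hC _⟩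

lemma ite {p : S → Prop} [DecidablePred p] (hp : MeasurableSet {x | p x}) (hf : IsBddMeas f)
    (hg : IsBddMeas g) : IsBddMeas (fun x => if p x then f x else g x) := by
  obtain ⟨hf, C, hC⟩ := hf
  obtain ⟨hg, D, hD⟩ := hg
  refine ⟨Measurable.ite hp hf hg, max C D, fun x => ?_⟩
  dsimp only
  split_ifs
  · exact (hC x).trans (le_max_left _ _)
  · exact (hD x).trans (le_max_right _ _)

lemma memLp (hf : IsBddMeas f) (μ : Measure S) [IsFiniteMeasure μ] (p : ENNReal) :
    MemLp f p μ := by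
  obtain ⟨hf, C, hC⟩ := hf
  exact MemLp.of_bound hf.aestronglyMeasurable C (Eventually.of_forall hC)

lemma integrable (hf : IsBddMeas f) (μ : Measure S) [IsFiniteMeasure μ] : Integrable f μ :=
  memLp_one_iff_integrable.1 (hf.memLp μ 1)

lemma exists_nonneg (hf : IsBddMeas f) : ∃ C : ℝ, 0 ≤ C ∧ ∀ x, |f x| ≤ C := by
  obtain ⟨_, C, hC⟩ := hf
  exact ⟨max C 0, le_max_right _ _, fun x => (hC x).trans (le_max_left _ _)⟩

lemma abs_integral_le {μ : Measure S} [IsProbabilityMeasure μ] {C : ℝ} (hC : ∀ x, |f x| ≤ C) :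
    |∫ x, f x ∂μ| ≤ C := by
  simpa using norm_integral_le_of_norm_le_const (μ := μ) (f := f) (Eventually.of_forall hC)

lemma integral_prod_right {T : Type*} [MeasurableSpace T] {F : S × T → ℝ} (hF : IsBddMeas F)
    (ν : Measure T) [IsProbabilityMeasure ν] : IsBddMeas (fun x => ∫ y, F (x, y) ∂ν) := by
  obtain ⟨hF, C, hC⟩ := hF
  exact ⟨hF.stronglyMeasurable.integral_prod_right'.measurable, C,
    fun x => abs_integral_le fun y => hC _⟩

lemma integral_prod_left {T : Type*} [MeasurableSpace T] {F : S × T → ℝ} (hF : IsBddMeas F)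
    (μ : Measure S) [IsProbabilityMeasure μ] : IsBddMeas (fun y => ∫ x, F (x, y) ∂μ) := by
  obtain ⟨hF, C, hC⟩ := hF
  exact ⟨hF.stronglyMeasurable.integral_prod_left'.measurable, C,
    fun x => abs_integral_le fun y => hC _⟩

end IsBddMeas

lemma integral_sub_const_sq {S : Type*} [MeasurableSpace S] {μ : Measure S}
    [IsProbabilityMeasure μ] {f : S → ℝ} (hf : IsBddMeas f) (a : ℝ) :
    ∫ x, (f x - a) ^ 2 ∂μ = ∫ x, f x ^ 2 ∂μ - 2 * a * ∫ x, f x ∂μ + a ^ 2 := by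
  have h : ∀ x, (f x - a) ^ 2 = f x ^ 2 - 2 * a * f x + a ^ 2 := fun x => by ring
  simp_rw [h]
  rw [integral_add (((hf.pow 2).sub (hf.const_mul _)).integrable μ) (integrable_const _),
    integral_sub ((hf.pow 2).integrable μ) ((hf.const_mul _).integrable μ), integral_const_mul]
  simp

lemma sq_integral_le {S : Type*} [MeasurableSpace S] {μ : Measure S}
    [IsProbabilityMeasure μ] {f : S → ℝ} (hf : IsBddMeas f) :
    (∫ x, f x ∂μ) ^ 2 ≤ ∫ x, f x ^ 2 ∂μ := by
  have h := integral_sub_const_sq (μ := μ) hf (∫ x, f x ∂μ)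
  have h0 : 0 ≤ ∫ x, (f x - ∫ x, f x ∂μ) ^ 2 ∂μ := integral_nonneg fun _ => sq_nonneg _
  nlinarith

/-! ### The Efron-Stein inequality -/

/-- Subadditivity of the variance over a product of two probability spaces. -/
lemma variance_prod_le {S T : Type*} [MeasurableSpace S] [MeasurableSpace T] (μ : Measure S)
    (ν : Measure T) [IsProbabilityMeasure μ] [IsProbabilityMeasure ν] {F : S × T → ℝ}
    (hF : IsBddMeas F) :
    ∫ z, F z ^ 2 ∂(μ.prod ν) - (∫ z, F z ∂(μ.prod ν)) ^ 2 ≤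
      (∫ y, (∫ x, F (x, y) ^ 2 ∂μ - (∫ x, F (x, y) ∂μ) ^ 2) ∂ν) +
      ∫ x, (∫ y, F (x, y) ^ 2 ∂ν - (∫ y, F (x, y) ∂ν) ^ 2) ∂μ := by
  have ha := hF.integral_prod_right ν
  have hb := hF.integral_prod_left μ
  have hF2 := hF.pow 2
  have hx : ∀ x, IsBddMeas (fun y => F (x, y)) := fun x => hF.comp measurable_prodMk_left
  have hy : ∀ y, IsBddMeas (fun x => F (x, y)) := fun y => hF.comp measurable_prodMk_right
  have hFb : IsBddMeas (fun z : S × T => F z - ∫ x, F (x, z.2) ∂μ) :=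
    hF.sub (hb.comp measurable_snd)
  -- The total variance is the mean of the conditional variance given `x`, computed exactly in `h2`,
  -- plus the variance of the conditional mean. The latter is treated here: centre `F` in `x` for
  -- each `y`, then use Jensen in `y`.
  have key : ∫ x, (∫ y, F (x, y) ∂ν) ^ 2 ∂μ - (∫ z, F z ∂(μ.prod ν)) ^ 2 ≤
      ∫ y, (∫ x, F (x, y) ^ 2 ∂μ - (∫ x, F (x, y) ∂μ) ^ 2) ∂ν := by
    calc _ = ∫ x, ((∫ y, F (x, y) ∂ν) - ∫ z, F z ∂(μ.prod ν)) ^ 2 ∂μ := by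
          rw [integral_sub_const_sq ha, integral_prod _ (hF.integrable _)]; ring
      _ = ∫ x, (∫ y, (F (x, y) - ∫ x', F (x', y) ∂μ) ∂ν) ^ 2 ∂μ := by
          congr 1; ext x
          rw [integral_sub ((hx x).integrable ν) (hb.integrable ν),
            integral_prod_symm _ (hF.integrable _)]
      _ ≤ ∫ x, ∫ y, (F (x, y) - ∫ x', F (x', y) ∂μ) ^ 2 ∂ν ∂μ := by
          refine integral_mono (((hFb.integral_prod_right ν).pow 2).integrable μ)
            (((hFb.pow 2).integral_prod_right ν).integrable μ) fun x => ?_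
          exact sq_integral_le ((hx x).sub hb)
      _ = ∫ y, ∫ x, (F (x, y) - ∫ x', F (x', y) ∂μ) ^ 2 ∂μ ∂ν :=
          integral_integral_swap ((hFb.pow 2).integrable (μ.prod ν))
      _ = _ := by
          congr 1; ext y
          rw [integral_sub_const_sq (hy y)]; ring
  have h2 : ∫ x, (∫ y, F (x, y) ^ 2 ∂ν - (∫ y, F (x, y) ∂ν) ^ 2) ∂μ =
      ∫ z, F z ^ 2 ∂(μ.prod ν) - ∫ x, (∫ y, F (x, y) ∂ν) ^ 2 ∂μ := by
    rw [integral_sub ((hF2.integral_prod_right ν).integrable μ) ((ha.pow 2).integrable μ),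
      integral_prod _ (hF2.integrable _)]
  linarith

section Pi

variable {Y : Type*} [MeasurableSpace Y]

lemma measurable_finCons {m : ℕ} :
    Measurable (fun z : Y × (Fin m → Y) => (Fin.cons z.1 z.2 : Fin (m + 1) → Y)) := by
  refine measurable_pi_lambda _ fun i => ?_
  refine Fin.cases ?_ (fun j => ?_) i
  · simpa using measurable_fst
  · simp only [Fin.cons_succ]
    exact (measurable_pi_apply j).comp measurable_snd

lemma integral_pi_succ (ν : Measure Y) [IsProbabilityMeasure ν] {m : ℕ}
    (F : (Fin (m + 1) → Y) → ℝ) :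
    ∫ y, F y ∂(Measure.pi fun _ : Fin (m + 1) => ν) =
      ∫ z : Y × (Fin m → Y), F (Fin.cons z.1 z.2) ∂(ν.prod (Measure.pi fun _ => ν)) := by
  rw [← ((measurePreserving_piFinSuccAbove (fun _ : Fin (m + 1) => ν) 0).symm).integral_comp']
  simp [MeasurableEquiv.piFinSuccAbove_symm_apply, Fin.insertNthEquiv]

/-- The Efron-Stein inequality, with arbitrary predictors `H i` not depending on the
coordinate `i`. -/
theorem variance_pi_le (ν : Measure Y) [IsProbabilityMeasure ν] {m : ℕ}
    {F : (Fin m → Y) → ℝ} (hF : IsBddMeas F) {H : Fin m → (Fin m → Y) → ℝ}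
    (hH : ∀ i, IsBddMeas (H i)) (hind : ∀ i y a, H i (Function.update y i a) = H i y) :
    ∫ y, F y ^ 2 ∂(Measure.pi fun _ => ν) - (∫ y, F y ∂(Measure.pi fun _ => ν)) ^ 2 ≤
      ∑ i, ∫ y, (F y - H i y) ^ 2 ∂(Measure.pi fun _ => ν) := by
  induction m with
  | zero =>
    have h : ∀ y, F y = F default := fun y => congrArg F (Subsingleton.elim _ _)
    simp_rw [h]
    simp
  | succ m ih =>
    set π := Measure.pi fun _ : Fin m => ν with hπ
    have hc := measurable_finCons (Y := Y) (m := m)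
    have hF' := hF.comp hc
    have hH' := fun i => (hH i).comp hc
    have hFx : ∀ x, IsBddMeas (fun y : Fin m → Y => F (Fin.cons x y)) := fun x =>
      hF'.comp measurable_prodMk_left
    have hFy : ∀ y : Fin m → Y, IsBddMeas (fun x => F (Fin.cons x y)) := fun y =>
      hF'.comp measurable_prodMk_right
    have hHx : ∀ i x, IsBddMeas (fun y : Fin m → Y => H i (Fin.cons x y)) := fun i x =>
      (hH' i).comp measurable_prodMk_left
    simp only [integral_pi_succ ν]
    refine (variance_prod_le ν π hF').trans ?_
    rw [Fin.sum_univ_succ]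
    have hsq : ∀ i, IsBddMeas (fun z : Y × (Fin m → Y) =>
        (F (Fin.cons z.1 z.2) - H i (Fin.cons z.1 z.2)) ^ 2) := fun i => (hF'.sub (hH' i)).pow 2
    refine add_le_add ?_ ?_
    · rw [integral_prod_symm _ ((hsq 0).integrable _)]
      refine integral_mono ((((hF'.pow 2).integral_prod_left ν).sub
        ((hF'.integral_prod_left ν).pow 2)).integrable π)
        (((hsq 0).integral_prod_left ν).integrable π) fun y => ?_
      -- With the other coordinates frozen, `H 0` is a constant, read off at an arbitrary `x₀`; the
      -- variance is at most the mean squared distance to any constant.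
      obtain ⟨x₀⟩ := ν.nonempty_of_neZero
      have h0 : ∀ x, H 0 (Fin.cons x y) = H 0 (Fin.cons x₀ y) := fun x => by
        rw [← hind 0 (Fin.cons x₀ y) x, Fin.update_cons_zero]
      simp only [h0]
      rw [integral_sub_const_sq (hFy y)]
      nlinarith [sq_nonneg (∫ x, F (Fin.cons x y) ∂ν - H 0 (Fin.cons x₀ y))]
    · rw [Finset.sum_congr rfl fun (i : Fin m) _ =>
        integral_prod _ ((hsq i.succ).integrable (ν.prod π)), ← integral_finsetSum _ fun i _ =>
        ((hsq i.succ).integral_prod_right π).integrable ν]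
      refine integral_mono ((((hF'.pow 2).integral_prod_right π).sub
        ((hF'.integral_prod_right π).pow 2)).integrable ν)
        ((IsBddMeas.sum fun i _ => (hsq (Fin.succ i)).integral_prod_right π).integrable ν)
        fun x => ?_
      refine ih (hFx x) (H := fun i y => H i.succ (Fin.cons x y)) (fun i => hHx _ x)
        fun i y a => ?_
      rw [← hind i.succ (Fin.cons x y) a, Fin.cons_update]

/-! ### Moments of empirical means -/

variable (ν : Measure Y) [IsProbabilityMeasure ν]

lemma IsBddMeas.sum_pi {h : Y → ℝ} (hh : IsBddMeas h) (m : ℕ) :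
    IsBddMeas (fun y : Fin m → Y => ∑ i, h (y i)) :=
  IsBddMeas.sum fun i _ => hh.comp (measurable_pi_apply i)

lemma integral_sum_pi {h : Y → ℝ} (hh : IsBddMeas h) (m : ℕ) :
    ∫ y, ∑ i, h (y i) ∂(Measure.pi fun _ : Fin m => ν) = m * ∫ x, h x ∂ν := by
  rw [integral_finsetSum _ fun i _ => (hh.comp (measurable_pi_apply i)).integrable _]
  have : ∀ i : Fin m, ∫ y, h (y i) ∂(Measure.pi fun _ : Fin m => ν) = ∫ x, h x ∂ν := fun i => by
    conv_rhs => rw [← (measurePreserving_eval (fun _ : Fin m => ν) i).map_eq]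
    rw [integral_map (measurable_pi_apply i).aemeasurable]
    exact hh.1.aestronglyMeasurable
  simp [this]

lemma integral_sum_pi_sq {h : Y → ℝ} (hh : IsBddMeas h) (m : ℕ) :
    ∫ y, (∑ i, h (y i)) ^ 2 ∂(Measure.pi fun _ : Fin m => ν) =
      m * ∫ x, h x ^ 2 ∂ν + m * (m - 1) * (∫ x, h x ∂ν) ^ 2 := by
  have h1 := variance_sum_pi (μ := fun _ : Fin m => ν) (X := fun _ => h) fun _ => hh.memLp ν 2
  rw [variance_eq_sub (by
    simpa only [Finset.sum_fn] using (hh.sum_pi m).memLp (Measure.pi fun _ : Fin m => ν) 2)] at h1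
  simp only [variance_eq_sub (hh.memLp ν 2), Pi.pow_apply, Finset.sum_apply, Finset.sum_const,
    Finset.card_univ, Fintype.card_fin, nsmul_eq_mul] at h1
  rw [integral_sum_pi ν hh] at h1
  linear_combination h1

/-- With $S$ the sum, $E S^4=\mathrm{var}(S^2)+(E S^2)^2$. Efron-Stein for $S^2$, predicted by the
square of the sum without its $i$-th term, bounds the variance by $m(8m+2)D^4\le10m^2D^4$; the other
term is at most $m^2D^4$. -/
lemma integral_sum_pi_pow_four_le {h : Y → ℝ} (hh : IsBddMeas h) (h0 : ∫ x, h x ∂ν = 0) {D : ℝ}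
    (hD : ∀ x, |h x| ≤ D) {m : ℕ} (hm : 1 ≤ m) :
    ∫ y, (∑ i, h (y i)) ^ 4 ∂(Measure.pi fun _ : Fin m => ν) ≤ 11 * D ^ 4 * m ^ 2 := by
  set π := Measure.pi fun _ : Fin m => ν
  have hS := hh.sum_pi m
  have hi : ∀ i : Fin m, IsBddMeas (fun y : Fin m → Y => h (y i)) := fun i =>
    hh.comp (measurable_pi_apply i)
  have hD2 : ∀ x, h x ^ 2 ≤ D ^ 2 := fun x => sq_le_sq' (abs_le.1 (hD x)).1 (abs_le.1 (hD x)).2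
  have hS2 : ∫ y, (∑ i, h (y i)) ^ 2 ∂π ≤ m * D ^ 2 := by
    rw [integral_sum_pi_sq ν hh, h0]
    have : ∫ x, h x ^ 2 ∂ν ≤ ∫ _, D ^ 2 ∂ν :=
      integral_mono ((hh.pow 2).integrable ν) (integrable_const _) hD2
    simp only [integral_const, probReal_univ, smul_eq_mul, one_mul] at this
    have := mul_le_mul_of_nonneg_left this (Nat.cast_nonneg (α := ℝ) m)
    linarith
  have hES := variance_pi_le ν (hS.pow 2)
    (H := fun i y => ((∑ j, h (y j)) - h (y i)) ^ 2) (fun i => (hS.sub (hi i)).pow 2) (by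
      intro i y a
      congr 1
      rw [← Finset.add_sum_erase _ _ (Finset.mem_univ i),
        ← Finset.add_sum_erase _ (fun j => h (y j)) (Finset.mem_univ i)]
      simp only [Function.update_self, add_sub_cancel_left]
      exact Finset.sum_congr rfl fun j hj => by
        rw [Function.update_of_ne (Finset.ne_of_mem_erase hj)])
  have hb : ∀ i : Fin m, ∫ y, ((∑ j, h (y j)) ^ 2 - ((∑ j, h (y j)) - h (y i)) ^ 2) ^ 2 ∂π ≤
      D ^ 2 * (8 * (m * D ^ 2) + 2 * D ^ 2) := by
    intro i
    have hmono : ∫ y, ((∑ j, h (y j)) ^ 2 - ((∑ j, h (y j)) - h (y i)) ^ 2) ^ 2 ∂π ≤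
        ∫ y, D ^ 2 * (8 * (∑ j, h (y j)) ^ 2 + 2 * D ^ 2) ∂π := by
      refine integral_mono ((((hS.pow 2).sub ((hS.sub (hi i)).pow 2)).pow 2).integrable π)
        ((((hS.pow 2).const_mul 8).add (.const _)).const_mul _ |>.integrable π) fun y => ?_
      have e : ((∑ j, h (y j)) ^ 2 - ((∑ j, h (y j)) - h (y i)) ^ 2) ^ 2 =
        h (y i) ^ 2 * (2 * (∑ j, h (y j)) - h (y i)) ^ 2 := by ring
      simp only [e]
      refine mul_le_mul (hD2 _) ?_ (sq_nonneg _) (sq_nonneg _)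
      -- Parallelogram identity: $(2S-h)^2+(2S+h)^2=8S^2+2h^2$.
      nlinarith [hD2 (y i), sq_nonneg (2 * (∑ j, h (y j)) + h (y i))]
    rw [integral_const_mul, integral_add (((hS.pow 2).const_mul 8).integrable π)
      (integrable_const _), integral_const_mul] at hmono
    simp only [integral_const, probReal_univ, smul_eq_mul, one_mul] at hmono
    refine hmono.trans (mul_le_mul_of_nonneg_left ?_ (sq_nonneg _))
    linarith
  have hsum := hES.trans (Finset.sum_le_sum fun i _ => hb i)
  simp only [← pow_mul, Finset.sum_const, Finset.card_univ, Fintype.card_fin,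
    nsmul_eq_mul] at hsum
  have hpos : 0 ≤ ∫ y, (∑ i, h (y i)) ^ 2 ∂π := integral_nonneg fun _ => sq_nonneg _
  have hsq : (∫ y, (∑ i, h (y i)) ^ 2 ∂π) ^ 2 ≤ (m * D ^ 2) ^ 2 := pow_le_pow_left₀ hpos hS2 2
  have hm' : (1 : ℝ) ≤ m := by exact_mod_cast hm
  have hmm : (m : ℝ) * D ^ 4 ≤ m ^ 2 * D ^ 4 :=
    mul_le_mul_of_nonneg_right (by nlinarith) (by positivity)
  norm_num at hsum
  nlinarith

/-- The fourth moment of the error of an empirical mean of bounded variables. -/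
lemma integral_mean_sub_pow_four_le {h : Y → ℝ} (hh : IsBddMeas h) {C : ℝ}
    (hC : ∀ x, |h x| ≤ C) {m : ℕ} (hm : 1 ≤ m) :
    ∫ y, ((∑ i, h (y i)) / m - ∫ x, h x ∂ν) ^ 4 ∂(Measure.pi fun _ : Fin m => ν) ≤
      176 * C ^ 4 / m ^ 2 := by
  have hm' : (0 : ℝ) < m := by exact_mod_cast hm
  have hd : IsBddMeas (fun x => h x - ∫ x, h x ∂ν) := hh.sub (.const _)
  have h0 : ∫ x, (h x - ∫ x, h x ∂ν) ∂ν = 0 := by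
    rw [integral_sub (hh.integrable ν) (integrable_const _)]; simp
  -- Centring doubles the bound, whence $11\cdot2^4=176$.
  have hD : ∀ x, |h x - ∫ x, h x ∂ν| ≤ 2 * C := fun x => by
    have := IsBddMeas.abs_integral_le (μ := ν) hC
    have := abs_sub (h x) (∫ x, h x ∂ν)
    linarith [hC x]
  have key := integral_sum_pi_pow_four_le ν hd h0 hD hm
  have e : ∀ y : Fin m → Y, ((∑ i, h (y i)) / m - ∫ x, h x ∂ν) ^ 4 =
      (∑ i, (h (y i) - ∫ x, h x ∂ν)) ^ 4 / (m : ℝ) ^ 4 := fun y => by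
    rw [← div_pow, Finset.sum_sub_distrib]
    simp only [Finset.sum_const, Finset.card_univ, Fintype.card_fin, nsmul_eq_mul]
    field_simp
  simp_rw [e]
  rw [integral_div, div_le_div_iff₀ (by positivity) (by positivity)]
  calc _ ≤ 11 * (2 * C) ^ 4 * m ^ 2 * (m : ℝ) ^ 2 :=
        mul_le_mul_of_nonneg_right key (by positivity)
    _ = _ := by ring

/-! ### Moments of counts -/

/-- Independence of the coordinates. Indexing by a finset counts a repeated coordinate once, which
matches the idempotence of indicators when powers of a count are expanded. -/
lemma integral_prod_indicator_pi {s : Set Y} (hs : MeasurableSet s) {m : ℕ}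
    (I : Finset (Fin m)) :
    ∫ y, ∏ i ∈ I, s.indicator (fun _ => (1 : ℝ)) (y i) ∂(Measure.pi fun _ : Fin m => ν) =
      ν.real s ^ I.card := by
  classical
  have h := integral_fintype_prod_eq_prod (𝕜 := ℝ) (μ := fun _ : Fin m => ν)
    (fun (i : Fin m) x => if i ∈ I then s.indicator (fun _ => (1 : ℝ)) x else 1)
  have e : ∀ i : Fin m, ∫ x, (if i ∈ I then s.indicator (fun _ => (1 : ℝ)) x else 1) ∂ν =
      if i ∈ I then ν.real s else 1 := fun i => by
    split_ifs
    · rw [integral_indicator hs]; simp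
    · simp
  simp only [e, Finset.prod_ite_mem, Finset.univ_inter, Finset.prod_const] at h
  exact h

/-- The cube expands over triples of indices, and a triple with $d$ distinct entries contributes
$q^d$, where $q$ is the mass of `s`. -/
lemma integral_count_pow_three_le {s : Set Y} (hs : MeasurableSet s) (m : ℕ) :
    ∫ y, (∑ i, s.indicator (fun _ => (1 : ℝ)) (y i)) ^ 3 ∂(Measure.pi fun _ : Fin m => ν) ≤
      m ^ 3 * ν.real s ^ 3 + 3 * m ^ 2 * ν.real s ^ 2 + m * ν.real s := by
  classical
  set b : Y → ℝ := s.indicator (fun _ => (1 : ℝ)) with hb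
  have hbm : IsBddMeas b := by
    refine ⟨measurable_const.indicator hs, 1, fun x => ?_⟩
    by_cases hx : x ∈ s <;> simp [hb, hx]
  have hbb : ∀ x, b x * b x = b x := fun x => by by_cases hx : x ∈ s <;> simp [hb, hx]
  have e : ∀ y : Fin m → Y, (∑ i, b (y i)) ^ 3 =
      ∑ i, ∑ j, ∑ k, ∏ l ∈ ({i, j, k} : Finset (Fin m)), b (y l) := fun y => by
    rw [pow_succ, pow_two, Finset.sum_mul_sum, Finset.sum_mul]
    refine Finset.sum_congr rfl fun i _ => ?_
    rw [Finset.sum_mul]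
    refine Finset.sum_congr rfl fun j _ => ?_
    rw [Finset.mul_sum]
    refine Finset.sum_congr rfl fun k _ => ?_
    by_cases hij : i = j
    · subst hij
      by_cases hik : i = k
      · subst hik; simp [hbb]
      · rw [Finset.insert_eq_of_mem (by simp), Finset.prod_pair hik, hbb]
    · by_cases hjk : j = k
      · subst hjk
        simp [Finset.prod_pair hij, mul_assoc, hbb]
      · by_cases hik : i = k
        · subst hik
          have : ({i, j, i} : Finset (Fin m)) = {i, j} := by ext; simp; tauto
          rw [this, Finset.prod_pair hij, mul_right_comm, hbb]
        · rw [Finset.prod_insert (by simp [hij, hik]), Finset.prod_pair hjk, mul_assoc]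
  have hI : ∀ I : Finset (Fin m), IsBddMeas (fun y : Fin m → Y => ∏ l ∈ I, b (y l)) := fun I =>
    IsBddMeas.prod fun l _ => hbm.comp (measurable_pi_apply l)
  simp_rw [e]
  rw [integral_finsetSum _ fun i _ => (IsBddMeas.sum fun j _ => IsBddMeas.sum fun k _ =>
    hI {i, j, k}).integrable _]
  simp_rw [fun i : Fin m => integral_finsetSum (μ := Measure.pi fun _ : Fin m => ν) Finset.univ
    fun j _ => (IsBddMeas.sum fun k (_ : k ∈ Finset.univ) => hI {i, j, k}).integrable _,
    fun i j : Fin m => integral_finsetSum (μ := Measure.pi fun _ : Fin m => ν) Finset.univ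
    fun k _ => (hI {i, j, k}).integrable _, hb, integral_prod_indicator_pi ν hs]
  set q := ν.real s with hq
  have hq0 : 0 ≤ q := measureReal_nonneg
  -- Every triple is charged $q^3$, plus $q^2$ for each equal pair and $q$ if all three agree. The
  -- overcounting makes the sum over triples a plain count.
  have hle : ∀ i j k : Fin m, q ^ ({i, j, k} : Finset (Fin m)).card ≤
      q ^ 3 + ((if i = j then q ^ 2 else 0) + (if j = k then q ^ 2 else 0) +
        (if i = k then q ^ 2 else 0)) + (if i = j then if j = k then q else 0 else 0) := by
    intro i j k
    by_cases hij : i = j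
    · subst hij
      by_cases hik : i = k
      · subst hik
        simp only [Finset.mem_singleton, Finset.insert_eq_of_mem, Finset.card_singleton, if_true]
        nlinarith [pow_nonneg hq0 2, pow_nonneg hq0 3]
      · rw [Finset.insert_eq_of_mem (by simp), Finset.card_pair hik]
        simp only [if_true, hik, if_false]
        nlinarith [pow_nonneg hq0 2, pow_nonneg hq0 3]
    · by_cases hjk : j = k
      · subst hjk
        simp only [Finset.mem_singleton, Finset.insert_eq_of_mem, Finset.card_pair hij, if_true,
          hij, if_false]
        nlinarith [pow_nonneg hq0 2, pow_nonneg hq0 3]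
      · by_cases hik : i = k
        · subst hik
          have : ({i, j, i} : Finset (Fin m)) = {i, j} := by ext; simp; tauto
          rw [this, Finset.card_pair hij]
          simp only [if_true, hij, hjk, if_false]
          nlinarith [pow_nonneg hq0 2, pow_nonneg hq0 3]
        · rw [Finset.card_insert_of_notMem (by simp [hij, hik]), Finset.card_pair hjk]
          simp [hij, hjk, hik]
  refine (Finset.sum_le_sum fun i _ => Finset.sum_le_sum fun j _ => Finset.sum_le_sum fun k _ =>
    hle i j k).trans (le_of_eq ?_)
  simp only [Finset.sum_add_distrib, Finset.sum_const, Finset.card_univ, Fintype.card_fin,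
    Finset.sum_ite_eq, Finset.mem_univ, if_true, nsmul_eq_mul, Finset.sum_ite_irrel]
  simp only [mul_ite, mul_zero, Finset.sum_ite_eq, Finset.mem_univ,
    if_true, Finset.sum_const, Finset.card_univ, Fintype.card_fin, nsmul_eq_mul]
  ring

/-- The variance of the sum over `t` of the squared sums of `h` over the coordinates with
tag `t`. -/
lemma variance_sum_tag_sq_le {T : Type*} [Fintype T] [DecidableEq T] [MeasurableSpace T]
    [MeasurableSingletonClass T] {τ : Y → T} (hτ : Measurable τ) {h : Y → ℝ} (hh : IsBddMeas h)
    {C : ℝ} (hC : ∀ x, |h x| ≤ C) (m : ℕ) :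
    (∫ y, (∑ t, (∑ i, if τ (y i) = t then h (y i) else 0) ^ 2) ^ 2
        ∂(Measure.pi fun _ : Fin m => ν)) -
      (∫ y, ∑ t, (∑ i, if τ (y i) = t then h (y i) else 0) ^ 2
        ∂(Measure.pi fun _ : Fin m => ν)) ^ 2 ≤
      9 * C ^ 4 * ∫ y, ∑ t, (∑ i, if τ (y i) = t then (1 : ℝ) else 0) ^ 3
        ∂(Measure.pi fun _ : Fin m => ν) := by
  set π := Measure.pi fun _ : Fin m => ν
  have hτt : ∀ t, MeasurableSet {x | τ x = t} := fun t => hτ (measurableSet_singleton t)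
  have hht : ∀ t, IsBddMeas (fun x => if τ x = t then h x else 0) := fun t =>
    hh.ite (hτt t) (.const 0)
  have hot : ∀ t, IsBddMeas (fun x => if τ x = t then (1 : ℝ) else 0) := fun t =>
    (IsBddMeas.const 1).ite (hτt t) (.const 0)
  have hS := fun t => (hht t).sum_pi m
  have hn := fun t => (hot t).sum_pi m
  have hi : ∀ t (i : Fin m), IsBddMeas (fun y : Fin m → Y => if τ (y i) = t then h (y i) else 0) :=
    fun t i => (hht t).comp (measurable_pi_apply i)
  have hF : IsBddMeas (fun y : Fin m → Y =>
      ∑ t, (∑ i, if τ (y i) = t then h (y i) else 0) ^ 2) := IsBddMeas.sum fun t _ => (hS t).pow 2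
  have hH : ∀ i, IsBddMeas (fun y : Fin m → Y => ∑ t, ((∑ j, if τ (y j) = t then h (y j) else 0) -
      if τ (y i) = t then h (y i) else 0) ^ 2) := fun i =>
    IsBddMeas.sum fun t _ => ((hS t).sub (hi t i)).pow 2
  have hES := variance_pi_le ν hF hH (by
      intro i y a
      refine Finset.sum_congr rfl fun t _ => ?_
      congr 1
      rw [← Finset.add_sum_erase _ _ (Finset.mem_univ i),
        ← Finset.add_sum_erase _ (fun j => if τ (y j) = t then h (y j) else 0) (Finset.mem_univ i)]
      simp only [Function.update_self, add_sub_cancel_left]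
      exact Finset.sum_congr rfl fun j hj => by
        rw [Function.update_of_ne (Finset.ne_of_mem_erase hj)])
  refine hES.trans ?_
  rw [← integral_finsetSum _ fun i _ => ((hF.sub (hH i)).pow 2).integrable π,
    ← integral_const_mul]
  refine integral_mono ((IsBddMeas.sum fun i _ => (hF.sub (hH i)).pow 2).integrable π)
    (((IsBddMeas.sum fun t _ => (hn t).pow 3).const_mul _).integrable π) fun y => ?_
  set n : T → ℝ := fun t => ∑ i, if τ (y i) = t then (1 : ℝ) else 0 with hndef
  have hSn : ∀ t, |∑ j, if τ (y j) = t then h (y j) else 0| ≤ C * n t := fun t => by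
    refine (Finset.abs_sum_le_sum_abs _ _).trans ?_
    rw [hndef, Finset.mul_sum]
    refine Finset.sum_le_sum fun j _ => ?_
    split_ifs
    · simpa using hC (y j)
    · simp
  -- Deleting coordinate `i` affects only the square belonging to its own tag, and changes it by
  -- $h_i(2S-h_i)$, where $|S|\le Cn$ and $n\ge1$ is the number of coordinates with that tag; hence
  -- $3C^2n$, squared.
  have hterm : ∀ i, ((∑ t, (∑ j, if τ (y j) = t then h (y j) else 0) ^ 2) -
      ∑ t, ((∑ j, if τ (y j) = t then h (y j) else 0) -
        if τ (y i) = t then h (y i) else 0) ^ 2) ^ 2 ≤ 9 * C ^ 4 * n (τ (y i)) ^ 2 := by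
    intro i
    set S := ∑ j, if τ (y j) = τ (y i) then h (y j) else 0 with hSdef
    have e : (∑ t, (∑ j, if τ (y j) = t then h (y j) else 0) ^ 2) -
      ∑ t, ((∑ j, if τ (y j) = t then h (y j) else 0) -
        if τ (y i) = t then h (y i) else 0) ^ 2 = h (y i) * (2 * S - h (y i)) := by
      rw [← Finset.sum_sub_distrib, Finset.sum_eq_single (τ (y i))]
      · rw [if_pos rfl]; ring
      · intro t _ ht
        rw [if_neg (Ne.symm ht)]; ring
      · simp
    have hC0 : 0 ≤ C := (abs_nonneg _).trans (hC (y i))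
    have hn1 : 1 ≤ n (τ (y i)) := by
      have := Finset.single_le_sum (f := fun j => if τ (y j) = τ (y i) then (1 : ℝ) else 0)
        (fun j _ => by split_ifs <;> simp) (Finset.mem_univ i)
      simpa [hndef] using this
    have hb : |h (y i) * (2 * S - h (y i))| ≤ 3 * C ^ 2 * n (τ (y i)) := by
      rw [abs_mul]
      have h2 : |2 * S - h (y i)| ≤ 3 * (C * n (τ (y i))) := by
        have h3 := abs_sub (2 * S) (h (y i))
        rw [abs_mul, abs_two] at h3
        nlinarith [hSn (τ (y i)), hC (y i)]
      calc _ ≤ C * (3 * (C * n (τ (y i)))) :=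
            mul_le_mul (hC _) h2 (abs_nonneg _) hC0
        _ = _ := by ring
    rw [e, ← sq_abs]
    calc _ ≤ (3 * C ^ 2 * n (τ (y i))) ^ 2 := pow_le_pow_left₀ (abs_nonneg _) hb 2
      _ = _ := by ring
  refine (Finset.sum_le_sum fun i _ => hterm i).trans (le_of_eq ?_)
  rw [← Finset.mul_sum]
  congr 1
  -- A tag `t` is carried by `n t` coordinates, so summing the squared tag counts over coordinates
  -- gives the sum of cubes over tags.
  have : ∀ t, n t ^ 3 = ∑ i, if τ (y i) = t then n t ^ 2 else 0 := fun t => by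
    calc n t ^ 3 = (∑ i, if τ (y i) = t then (1 : ℝ) else 0) * n t ^ 2 := by
          simp only [hndef]; ring
      _ = _ := by simp only [Finset.sum_mul, ite_mul, one_mul, zero_mul]
  change _ = ∑ t, n t ^ 3
  simp only [this]
  rw [Finset.sum_comm]
  simp

end Pi

/-! ### The offspring law -/

/-- The operator `Q f (x) = g(x) ∫ f dK(x)`. -/
def fkOp {X : Type*} [MeasurableSpace X] (g : X → ℝ) (K : Kernel X X) (f : X → ℝ) (x : X) : ℝ :=
  g x * ∫ u, f u ∂(K x)

lemma sum_potential_pos {X : Type*} {g : X → ℝ} {k : ℕ} (hk : 1 ≤ k) (hpos : ∀ x, 0 < g x)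
    (x : Fin k → X) : 0 < ∑ l, g (x l) :=
  Finset.sum_pos (fun _ _ => hpos _) ⟨⟨0, hk⟩, Finset.mem_univ _⟩

section Offspring

variable {X : Type*} [MeasurableSpace X] {g : X → ℝ} {K : Kernel X X} [IsMarkovKernel K]

lemma IsBddMeas.fkOp {f : X → ℝ} (hf : IsBddMeas f) (hg : IsBddMeas g) :
    IsBddMeas (fkOp g K f) := by
  refine hg.mul ?_
  obtain ⟨hf, C, hC⟩ := hf
  exact ⟨hf.stronglyMeasurable.integral_kernel.measurable, C,
    fun x => IsBddMeas.abs_integral_le hC⟩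

lemma fkOp_one : fkOp g K (fun _ => 1) = g := by
  ext x; simp [fkOp]

variable {k : ℕ}

lemma isProbabilityMeasure_offspringLaw (hk : 1 ≤ k) (hpos : ∀ x, 0 < g x)
    (x : Fin k → X) :
    IsProbabilityMeasure (offspringLaw g K x) := by
  have hs := sum_potential_pos hk hpos x
  constructor
  simp only [offspringLaw, Measure.coe_finsetSum, Finset.sum_apply, Measure.smul_apply,
    measure_univ, smul_eq_mul, mul_one]
  rw [← ENNReal.ofReal_sum_of_nonneg fun j _ => (div_pos (hpos _) hs).le, ← Finset.sum_div,
    div_self hs.ne', ENNReal.ofReal_one]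

lemma integral_offspringLaw (hk : 1 ≤ k) (hpos : ∀ x, 0 < g x) {h : Fin k × X → ℝ}
    (hh : IsBddMeas h) (x : Fin k → X) :
    ∫ z, h z ∂(offspringLaw g K x) =
      ∑ j, g (x j) / (∑ l, g (x l)) * ∫ u, h (j, u) ∂(K (x j)) := by
  have hs := sum_potential_pos hk hpos x
  rw [offspringLaw, integral_finsetSum_measure fun j _ =>
    (hh.integrable _).smul_measure ENNReal.ofReal_ne_top]
  refine Finset.sum_congr rfl fun j _ => ?_
  rw [integral_smul_measure, ENNReal.toReal_ofReal (div_pos (hpos _) hs).le, Measure.dirac_prod,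
    integral_map measurable_prodMk_left.aemeasurable hh.1.aestronglyMeasurable, smul_eq_mul]

/-- Integration against the offspring law after multiplication by the mean potential. -/
lemma mean_mul_integral_offspringLaw (hk : 1 ≤ k) (hpos : ∀ x, 0 < g x)
    {h : Fin k × X → ℝ} (hh : IsBddMeas h) (x : Fin k → X) :
    (∑ l, g (x l)) / k * ∫ z, h z ∂(offspringLaw g K x) =
      (∑ j, g (x j) * ∫ u, h (j, u) ∂(K (x j))) / k := by
  have hs := sum_potential_pos hk hpos x
  rw [integral_offspringLaw hk hpos hh, div_mul_eq_mul_div, Finset.mul_sum]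
  congr 1
  refine Finset.sum_congr rfl fun j _ => ?_
  field_simp

lemma measurable_offspringLaw (hg : Measurable g) :
    Measurable (fun x : Fin k → X => offspringLaw g K x) := by
  refine Measure.measurable_of_measurable_coe _ fun s hs => ?_
  simp only [offspringLaw, Measure.coe_finsetSum, Finset.sum_apply, Measure.smul_apply,
    smul_eq_mul, Measure.dirac_prod]
  refine Finset.measurable_sum _ fun j _ => Measurable.mul ?_ ?_
  · refine ENNReal.measurable_ofReal.comp (Measurable.div (hg.comp (measurable_pi_apply j)) ?_)
    exact Finset.measurable_sum _ fun l _ => hg.comp (measurable_pi_apply l)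
  · have : ∀ x : Fin k → X, (K (x j)).map (Prod.mk j) s = K (x j) (Prod.mk j ⁻¹' s) := fun x =>
      Measure.map_apply measurable_prodMk_left hs
    simp only [this]
    exact (K.measurable_coe (measurable_prodMk_left hs)).comp (measurable_pi_apply j)

/-- The law of a whole generation is a Markov kernel in the current particles. -/
lemma exists_generationKernel (hk : 1 ≤ k) (hpos : ∀ x, 0 < g x)
    (hg : Measurable g) (m : ℕ) :
    ∃ κ : Kernel (Fin k → X) (Fin m → Fin k × X), IsMarkovKernel κ ∧
      ∀ x, κ x = Measure.pi (fun _ : Fin m => offspringLaw g K x) := by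
  have := isProbabilityMeasure_offspringLaw (K := K) hk hpos
  have hmeas : Measurable
      (fun x : Fin k → X => Measure.pi (fun _ : Fin m => offspringLaw g K x)) := by
    -- Measurability in the current particles is enough on boxes, a generating π-system on which the
    -- product law is a finite product.
    refine Measurable.measure_of_isPiSystem_of_isProbabilityMeasure generateFrom_pi.symm
      isPiSystem_pi ?_
    rintro _ ⟨s, hs, rfl⟩
    simp only [Measure.pi_pi]
    refine Finset.measurable_prod _ fun i _ => ?_
    have hsi : MeasurableSet (s i) := hs i (Set.mem_univ i)
    exact (Measure.measurable_coe hsi).comp (measurable_offspringLaw hg)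
  exact ⟨⟨_, hmeas⟩, ⟨fun x => by
    change IsProbabilityMeasure (Measure.pi (fun _ : Fin m => offspringLaw g K x))
    infer_instance⟩, fun x => rfl⟩

end Offspring

/-! ### The Markov property of the particle filter -/

/-- Used for quantities inherited through a random ancestor index: Eve indices, and the tags of
parents. -/
lemma measurable_apply_of_countable {Ω ι β : Type*} {mΩ : MeasurableSpace Ω} [Countable ι]
    [MeasurableSpace ι] [MeasurableSingletonClass ι] [MeasurableSpace β] {f : ι → Ω → β}
    (hf : ∀ j, Measurable (f j)) {a : Ω → ι} (ha : Measurable a) :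
    Measurable (fun ω => f (a ω) ω) :=
  (measurable_from_prod_countable_right (f := fun z : ι × Ω => f z.1 z.2) hf).comp
    (ha.prodMk measurable_id)

/-- The product `∏_{q < p} η_q^N(G_q)`. -/
def weightN {X Ω : Type*} {k : ℕ → ℕ} (G : ℕ → X → ℝ) (ζ : (p : ℕ) → Fin (k p) → Ω → X)
    (p : ℕ) (ω : Ω) : ℝ :=
  ∏ q ∈ Finset.range p, etaN ζ q (G q) ω

/-- The particles at time `p`, their Eve indices and the weight `∏_{q < p} η_q^N(G_q)`. -/
def stateN {X Ω : Type*} {k : ℕ → ℕ} (G : ℕ → X → ℝ) (ζ : (p : ℕ) → Fin (k p) → Ω → X)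
    (A : (p : ℕ) → Fin (k (p + 1)) → Ω → Fin (k p)) (p : ℕ) (ω : Ω) :
    (Fin (k p) → X) × (Fin (k p) → Fin (k 0)) × ℝ :=
  (fun i => ζ p i ω, fun i => eve A p i ω, weightN G ζ p ω)

/-- The pairs (ancestor index, particle) which form generation `p + 1`. -/
def generationN {X Ω : Type*} {k : ℕ → ℕ} (ζ : (p : ℕ) → Fin (k p) → Ω → X)
    (A : (p : ℕ) → Fin (k (p + 1)) → Ω → Fin (k p)) (p : ℕ) (ω : Ω) :
    Fin (k (p + 1)) → Fin (k p) × X :=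
  fun i => (A p i ω, ζ (p + 1) i ω)

section History

variable {X Ω : Type*} [MeasurableSpace X] {k : ℕ → ℕ} {G : ℕ → X → ℝ}
  {ζ : (p : ℕ) → Fin (k p) → Ω → X} {A : (p : ℕ) → Fin (k (p + 1)) → Ω → Fin (k p)}

lemma measurable_particle_history {q p : ℕ} (hqp : q ≤ p) (i : Fin (k q)) :
    Measurable[history ζ A p] (ζ q i) := by
  rw [measurable_iff_comap_le]
  refine le_trans ?_ le_sup_left
  exact le_iSup_of_le q (le_iSup_of_le hqp (le_iSup_of_le i le_rfl))

lemma measurable_ancestor_history {q p : ℕ} (hqp : q < p) (i : Fin (k (q + 1))) :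
    Measurable[history ζ A p] (A q i) := by
  rw [measurable_iff_comap_le]
  refine le_trans ?_ le_sup_right
  exact le_iSup_of_le q (le_iSup_of_le hqp (le_iSup_of_le i le_rfl))

lemma measurable_eve_history {q p : ℕ} (hqp : q ≤ p) (i : Fin (k q)) :
    Measurable[history ζ A p] (eve A q i) := by
  induction q with
  | zero => exact measurable_const
  | succ q ih =>
    exact measurable_apply_of_countable (fun j => ih (Nat.le_of_succ_le hqp) j)
      (measurable_ancestor_history hqp i)

lemma measurable_etaN_history {q p : ℕ} (hqp : q ≤ p) {f : X → ℝ} (hf : Measurable f) :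
    Measurable[history ζ A p] (etaN ζ q f) :=
  Measurable.div_const (Finset.measurable_sum _ fun i _ =>
    hf.comp (measurable_particle_history hqp i)) _

lemma measurable_stateN_of {m : MeasurableSpace Ω} {p : ℕ} (h1 : ∀ i, Measurable (ζ p i))
    (h2 : ∀ i, Measurable (eve A p i)) (h3 : Measurable (weightN G ζ p)) :
    Measurable (stateN G ζ A p) :=
  (measurable_pi_lambda _ h1).prodMk ((measurable_pi_lambda _ h2).prodMk h3)

/-- The field `transition_law` conditions on events of the history; this makes events about the
state eligible. -/
lemma measurable_stateN_history (hG : ∀ q, Measurable (G q)) (p : ℕ) :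
    Measurable[history ζ A p] (stateN G ζ A p) :=
  measurable_stateN_of (fun i => measurable_particle_history le_rfl i)
    (fun i => measurable_eve_history le_rfl i) (Finset.measurable_prod _ fun q hq =>
      measurable_etaN_history (Finset.mem_range.1 hq).le (hG q))

variable [mΩ : MeasurableSpace Ω] {P : Measure Ω} {M₀ : Measure X} {M : ℕ → Kernel X X} {n : ℕ}

lemma IsParticleFilter.history_le (h : IsParticleFilter P M₀ M G n k ζ A) {p : ℕ} (hp : p ≤ n) :
    history ζ A p ≤ mΩ := by
  refine sup_le (iSup_le fun q => iSup_le fun hq => iSup_le fun i => ?_)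
    (iSup_le fun q => iSup_le fun hq => iSup_le fun i => ?_)
  · exact measurable_iff_comap_le.1 (h.measurable_particle q (hq.trans hp) i)
  · exact measurable_iff_comap_le.1 (h.measurable_ancestor q (hq.trans_le hp) i)

lemma IsParticleFilter.measurable_stateN (h : IsParticleFilter P M₀ M G n k ζ A)
    (hG : ∀ q, Measurable (G q)) {p : ℕ} (hp : p ≤ n) : Measurable (stateN G ζ A p) :=
  (measurable_stateN_history hG p).mono (h.history_le hp) le_rfl

lemma IsParticleFilter.measurable_generationN (h : IsParticleFilter P M₀ M G n k ζ A)
    {p : ℕ} (hp : p < n) : Measurable (generationN ζ A p) :=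
  measurable_pi_lambda _ fun i =>
    (h.measurable_ancestor p hp i).prodMk (h.measurable_particle (p + 1) hp i)

/-- The Markov property: integration over generation `p + 1`, given the state at time `p`. -/
theorem IsParticleFilter.integral_transition [IsProbabilityMeasure P]
    [∀ p, IsMarkovKernel (M p)] (h : IsParticleFilter P M₀ M G n k ζ A)
    (hG : ∀ q, Measurable (G q)) (hpos : ∀ q x, 0 < G q x) {p : ℕ} (hp : p < n) (hk : 1 ≤ k p)
    {F : ((Fin (k p) → X) × (Fin (k p) → Fin (k 0)) × ℝ) × (Fin (k (p + 1)) → Fin (k p) × X) → ℝ}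
    (hF : Measurable F) (hb : IsBddMeas fun ω => F (stateN G ζ A p ω, generationN ζ A p ω)) :
    Integrable (fun ω => ∫ y, F (stateN G ζ A p ω, y) ∂(Measure.pi fun _ : Fin (k (p + 1)) =>
      offspringLaw (G p) (M (p + 1)) fun j => ζ p j ω)) P ∧
    ∫ ω, F (stateN G ζ A p ω, generationN ζ A p ω) ∂P =
      ∫ ω, ∫ y, F (stateN G ζ A p ω, y) ∂(Measure.pi fun _ : Fin (k (p + 1)) =>
        offspringLaw (G p) (M (p + 1)) fun j => ζ p j ω) ∂P := by
  obtain ⟨κ, hκM, hκ⟩ := exists_generationKernel (K := M (p + 1)) hk (hpos p) (hG p) (k (p + 1))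
  have hs := h.measurable_stateN hG hp.le
  have hY := h.measurable_generationN hp
  set s := stateN G ζ A p with hsdef
  set Y := generationN ζ A p with hYdef
  -- The next generation depends on the state through the particles alone; tags and weight are
  -- carried along.
  set κ' := κ.comap (Prod.fst : (Fin (k p) → X) × (Fin (k p) → Fin (k 0)) × ℝ → _)
    measurable_fst with hκ'
  have hκs : ∀ ω, κ' (s ω) = Measure.pi fun _ : Fin (k (p + 1)) =>
      offspringLaw (G p) (M (p + 1)) fun j => ζ p j ω := fun ω => by
    rw [hκ', Kernel.comap_apply, hκ]; rfl
  have : IsProbabilityMeasure (P.map s) := Measure.isProbabilityMeasure_map hs.aemeasurable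
  have : IsProbabilityMeasure (P.map fun ω => (s ω, Y ω)) :=
    Measure.isProbabilityMeasure_map (hs.prodMk hY).aemeasurable
  -- The joint law is identified on rectangles, where the claim is `transition_law` for the event
  -- that the state lies in `U`.
  have hmap : P.map (fun ω => (s ω, Y ω)) = (P.map s) ⊗ₘ κ' := by
    refine Measure.ext_prod fun {U V} hU hV => ?_
    rw [Measure.compProd_apply_prod hU hV, Measure.map_apply (hs.prodMk hY) (hU.prod hV),
      setLIntegral_map hU (κ'.measurable_coe hV) hs]
    simp only [hκs]
    exact h.transition_law p hp (s ⁻¹' U) (measurable_stateN_history hG p hU) V hV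
  -- `F` need not be bounded on all states, since the weight is an arbitrary real there. Boundedness
  -- is known only along the filter, so integrability is transported from `P`.
  have hint : Integrable F ((P.map s) ⊗ₘ κ') := by
    rw [← hmap]
    exact (integrable_map_measure hF.aestronglyMeasurable (hs.prodMk hY).aemeasurable).2
      (hb.integrable P)
  have hint' : Integrable (fun a => ∫ y, F (a, y) ∂(κ' a)) (P.map s) :=
    Integrable.integral_compProd (κ := Kernel.const Unit (P.map s))
      (η := Kernel.prodMkLeft Unit κ') (a := ()) hint
  have e : ∫ ω, F (s ω, Y ω) ∂P = ∫ a, ∫ y, F (a, y) ∂(κ' a) ∂(P.map s) := by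
    rw [← Measure.integral_compProd hint, ← hmap,
      integral_map (hs.prodMk hY).aemeasurable hF.aestronglyMeasurable]
  rw [integral_map hs.aemeasurable hint'.aestronglyMeasurable] at e
  have hint'' := (integrable_map_measure hint'.aestronglyMeasurable hs.aemeasurable).1 hint'
  simp only [Function.comp_def] at hint''
  simp only [hκs] at e hint''
  exact ⟨hint'', e⟩

end History

/-! ### States: particles with tags and a weight -/

/-- A state consists of `k` particles, their tags, and a weight. -/
abbrev State (X : Type*) (k m : ℕ) : Type _ := (Fin k → X) × (Fin k → Fin m) × ℝ

namespace State

variable {X : Type*} {k m : ℕ}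

/-- The weighted empirical mean. -/
def mean (s : State X k m) (f : X → ℝ) : ℝ := s.2.2 * ((∑ i, f (s.1 i)) / k)

/-- The contribution to the weighted empirical mean of the particles with tag `t`. -/
def tagMean (s : State X k m) (t : Fin m) (f : X → ℝ) : ℝ :=
  s.2.2 * ((∑ i, if s.2.1 i = t then f (s.1 i) else 0) / k)

/-- The sum over the tags of the squared contributions. -/
def tagSq (s : State X k m) (f : X → ℝ) : ℝ := ∑ t, s.tagMean t f ^ 2

/-- The sum over the tags of the cubed contributions. -/
def tagCube (s : State X k m) (f : X → ℝ) : ℝ := ∑ t, s.tagMean t f ^ 3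

/-- The state formed by a new generation, whose members inherit the tags of their parents. -/
def next (g : X → ℝ) (s : State X k m) {l : ℕ} (y : Fin l → Fin k × X) : State X l m :=
  (fun i => (y i).2, fun i => s.2.1 (y i).1, s.mean g)

lemma mean_next (g : X → ℝ) (s : State X k m) {l : ℕ} (y : Fin l → Fin k × X) (f : X → ℝ) :
    (s.next g y).mean f = s.mean g * ((∑ i, f (y i).2) / l) := rfl

lemma tagMean_next (g : X → ℝ) (s : State X k m) {l : ℕ} (y : Fin l → Fin k × X) (t : Fin m)
    (f : X → ℝ) :
    (s.next g y).tagMean t f =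
      s.mean g * ((∑ i, if s.2.1 (y i).1 = t then f (y i).2 else 0) / l) := rfl

lemma sum_tagMean (s : State X k m) (f : X → ℝ) : ∑ t, s.tagMean t f = s.mean f := by
  simp only [tagMean, mean]
  rw [← Finset.mul_sum, ← Finset.sum_div, Finset.sum_comm]
  simp

variable [MeasurableSpace X]

lemma measurable_mean {f : X → ℝ} (hf : Measurable f) :
    Measurable (fun s : State X k m => s.mean f) := by
  refine Measurable.mul (by fun_prop)
    (Measurable.div_const (Finset.measurable_sum _ fun i _ => ?_) _)
  exact hf.comp ((measurable_pi_apply i).comp measurable_fst)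

lemma measurable_tagMean {f : X → ℝ} (hf : Measurable f) (t : Fin m) :
    Measurable (fun s : State X k m => s.tagMean t f) := by
  refine Measurable.mul (by fun_prop)
    (Measurable.div_const (Finset.measurable_sum _ fun i _ => ?_) _)
  refine Measurable.ite ?_ (hf.comp ((measurable_pi_apply i).comp measurable_fst)) measurable_const
  have : Measurable (fun s : State X k m => s.2.1 i) := by fun_prop
  exact this (measurableSet_singleton t)

lemma measurable_tagSq {f : X → ℝ} (hf : Measurable f) :
    Measurable (fun s : State X k m => s.tagSq f) :=
  Finset.measurable_sum _ fun t _ => (measurable_tagMean hf t).pow_const 2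

lemma measurable_tagCube {f : X → ℝ} (hf : Measurable f) :
    Measurable (fun s : State X k m => s.tagCube f) :=
  Finset.measurable_sum _ fun t _ => (measurable_tagMean hf t).pow_const 3

lemma measurable_next {g : X → ℝ} (hg : Measurable g) {l : ℕ} :
    Measurable (fun z : State X k m × (Fin l → Fin k × X) => z.1.next g z.2) := by
  refine Measurable.prodMk (by fun_prop) (Measurable.prodMk (measurable_pi_lambda _ fun i => ?_)
    ((measurable_mean hg).comp measurable_fst))
  exact measurable_apply_of_countable
    (f := fun (j : Fin k) (z : State X k m × (Fin l → Fin k × X)) => z.1.2.1 j)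
    (fun j => by fun_prop) (a := fun z => (z.2 i).1) (by fun_prop)

/-! ### One generation of a particle filter, given the current state -/

variable {g : X → ℝ} {K : Kernel X X} [IsMarkovKernel K] {l : ℕ}

lemma isBddMeas_snd {f : X → ℝ} (hf : IsBddMeas f) : IsBddMeas (fun z : Fin k × X => f z.2) :=
  hf.comp measurable_snd

lemma isBddMeas_tag {f : X → ℝ} (hf : IsBddMeas f) (s : State X k m) (t : Fin m) :
    IsBddMeas (fun z : Fin k × X => if s.2.1 z.1 = t then f z.2 else 0) := by
  refine (isBddMeas_snd hf).ite ?_ (.const 0)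
  exact (Measurable.of_discrete.comp measurable_fst : Measurable fun z : Fin k × X => s.2.1 z.1)
    (measurableSet_singleton t)

lemma isBddMeas_tagMean_next {f : X → ℝ} (hf : IsBddMeas f) (s : State X k m) (t : Fin m) :
    IsBddMeas (fun y : Fin l → Fin k × X => (s.next g y).tagMean t f) :=
  (((isBddMeas_tag hf s t).sum_pi l).div_const _).const_mul _

lemma isBddMeas_tagSq_next {f : X → ℝ} (hf : IsBddMeas f) (s : State X k m) :
    IsBddMeas (fun y : Fin l → Fin k × X => (s.next g y).tagSq f) :=
  IsBddMeas.sum fun t _ => (isBddMeas_tagMean_next hf s t).pow 2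

/-- The new weight `s.mean g` contains the sum of potentials that normalizes the resampling
probabilities, so the random denominator cancels and the result is linear in the weighted empirical
measure. -/
lemma mean_mul_integral_snd (hk : 1 ≤ k) (hpos : ∀ x, 0 < g x) {f : X → ℝ} (hf : IsBddMeas f)
    (s : State X k m) :
    s.mean g * ∫ z, f z.2 ∂(offspringLaw g K s.1) = s.mean (fkOp g K f) := by
  rw [mean, mul_assoc, mean_mul_integral_offspringLaw hk hpos (isBddMeas_snd hf)]
  rfl

lemma mean_mul_integral_tag (hk : 1 ≤ k) (hpos : ∀ x, 0 < g x) {f : X → ℝ} (hf : IsBddMeas f)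
    (s : State X k m) (t : Fin m) :
    s.mean g * ∫ z, (if s.2.1 z.1 = t then f z.2 else 0) ∂(offspringLaw g K s.1) =
      s.tagMean t (fkOp g K f) := by
  rw [mean, mul_assoc, mean_mul_integral_offspringLaw hk hpos (isBddMeas_tag hf s t), tagMean]
  congr 2
  refine Finset.sum_congr rfl fun j _ => ?_
  by_cases h : s.2.1 j = t <;> simp [h, fkOp]

lemma integral_mean_next (hk : 1 ≤ k) (hl : 1 ≤ l) (hpos : ∀ x, 0 < g x) {f : X → ℝ}
    (hf : IsBddMeas f) (s : State X k m) :
    ∫ y, (s.next g y).mean f ∂(Measure.pi fun _ : Fin l => offspringLaw g K s.1) =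
      s.mean (fkOp g K f) := by
  have := isProbabilityMeasure_offspringLaw (K := K) hk hpos s.1
  have hl' : (l : ℝ) ≠ 0 := by exact_mod_cast (by omega : l ≠ 0)
  simp only [mean_next]
  rw [integral_const_mul, integral_div, integral_sum_pi _ (isBddMeas_snd hf),
    mul_div_cancel_left₀ _ hl', mean_mul_integral_snd hk hpos hf]

/-- Of the pairs of indices, a fraction $1/l$ is diagonal and gives the second moment; the others
are independent and give the squared mean. The factors `w` are grouped with the integrals so that
the cancellation of the normalizing sum applies to each. -/
lemma integral_sq_weighted_sum {Y : Type*} [MeasurableSpace Y] (ν : Measure Y)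
    [IsProbabilityMeasure ν] (hl : 1 ≤ l) {h : Y → ℝ} (hh : IsBddMeas h) (w : ℝ) :
    ∫ y, (w * ((∑ i, h (y i)) / l)) ^ 2 ∂(Measure.pi fun _ : Fin l => ν) =
      (1 / l) * (w * (w * ∫ x, h x ^ 2 ∂ν)) + (1 - 1 / l) * (w * ∫ x, h x ∂ν) ^ 2 := by
  have hl' : (l : ℝ) ≠ 0 := by exact_mod_cast (by omega : l ≠ 0)
  have e : ∀ y : Fin l → Y, (w * ((∑ i, h (y i)) / l)) ^ 2 =
      (w / l) ^ 2 * (∑ i, h (y i)) ^ 2 := fun y => by ring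
  simp_rw [e]
  rw [integral_const_mul, integral_sum_pi_sq ν hh]
  field_simp

lemma integral_mean_next_sq (hk : 1 ≤ k) (hl : 1 ≤ l) (hpos : ∀ x, 0 < g x) {f : X → ℝ}
    (hf : IsBddMeas f) (s : State X k m) :
    ∫ y, (s.next g y).mean f ^ 2 ∂(Measure.pi fun _ : Fin l => offspringLaw g K s.1) =
      (1 / l) * (s.mean g * s.mean (fkOp g K fun x => f x ^ 2)) +
        (1 - 1 / l) * s.mean (fkOp g K f) ^ 2 := by
  have := isProbabilityMeasure_offspringLaw (K := K) hk hpos s.1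
  simp only [mean_next]
  rw [integral_sq_weighted_sum _ hl (isBddMeas_snd hf), mean_mul_integral_snd hk hpos hf,
    mean_mul_integral_snd hk hpos (hf.pow 2)]

/-- Two offspring share a tag either because they are the same offspring or because their parents
share it. A particle always shares its own tag, so the diagonal term is the one in
`integral_mean_next_sq`: this coincidence is what makes the estimator unbiased. -/
lemma integral_tagSq_next (hk : 1 ≤ k) (hl : 1 ≤ l) (hpos : ∀ x, 0 < g x) {f : X → ℝ}
    (hf : IsBddMeas f) (s : State X k m) :
    ∫ y, (s.next g y).tagSq f ∂(Measure.pi fun _ : Fin l => offspringLaw g K s.1) =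
      (1 / l) * (s.mean g * s.mean (fkOp g K fun x => f x ^ 2)) +
        (1 - 1 / l) * s.tagSq (fkOp g K f) := by
  have := isProbabilityMeasure_offspringLaw (K := K) hk hpos s.1
  simp only [tagSq]
  rw [integral_finsetSum _ fun t _ => ((isBddMeas_tagMean_next hf s t).pow 2).integrable _]
  have key : ∀ t, ∫ y, (s.next g y).tagMean t f ^ 2
      ∂(Measure.pi fun _ : Fin l => offspringLaw g K s.1) =
      (1 / l) * (s.mean g * s.tagMean t (fkOp g K fun x => f x ^ 2)) +
        (1 - 1 / l) * s.tagMean t (fkOp g K f) ^ 2 := fun t => by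
    simp only [tagMean_next]
    rw [integral_sq_weighted_sum _ hl (isBddMeas_tag hf s t), mean_mul_integral_tag hk hpos hf,
      ← mean_mul_integral_tag hk hpos (hf.pow 2)]
    simp only [ite_pow, ne_eq, OfNat.ofNat_ne_zero, not_false_eq_true, zero_pow]
  rw [Finset.sum_congr rfl fun t _ => key t, Finset.sum_add_distrib, ← Finset.mul_sum,
    ← Finset.mul_sum, ← Finset.mul_sum, sum_tagMean]

lemma integral_mean_next_sub_pow_four_le (hk : 1 ≤ k) (hl : 1 ≤ l) (hpos : ∀ x, 0 < g x)
    {f : X → ℝ} (hf : IsBddMeas f) {C : ℝ} (hC : ∀ x, |f x| ≤ C) (s : State X k m) :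
    ∫ y, ((s.next g y).mean f - s.mean (fkOp g K f)) ^ 4
        ∂(Measure.pi fun _ : Fin l => offspringLaw g K s.1) ≤
      s.mean g ^ 4 * (176 * C ^ 4 / l ^ 2) := by
  have := isProbabilityMeasure_offspringLaw (K := K) hk hpos s.1
  simp only [mean_next, ← mean_mul_integral_snd hk hpos hf, ← mul_sub, mul_pow]
  rw [integral_const_mul]
  refine mul_le_mul_of_nonneg_left ?_ (by positivity)
  exact integral_mean_sub_pow_four_le _ (isBddMeas_snd hf) (fun z => hC _) hl

/-- The number of offspring with tag `t` is a count of independent trials whose success probability,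
multiplied by `s.mean g`, is `s.tagMean t g`. The three terms come from index triples with three,
two and one distinct entries. -/
lemma integral_tagCube_next_le (hk : 1 ≤ k) (hl : 1 ≤ l) (hpos : ∀ x, 0 < g x)
    (s : State X k m) (hw : 0 ≤ s.mean g) :
    ∫ y, (s.next g y).tagCube (fun _ => 1)
        ∂(Measure.pi fun _ : Fin l => offspringLaw g K s.1) ≤
      s.tagCube g + 3 / l * (s.mean g * s.tagSq g) + 1 / l ^ 2 * s.mean g ^ 3 := by
  have := isProbabilityMeasure_offspringLaw (K := K) hk hpos s.1
  have hl' : (0 : ℝ) < l := by exact_mod_cast hl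
  set ν := offspringLaw g K s.1 with hν
  have h1 : IsBddMeas (fun _ : X => (1 : ℝ)) := .const 1
  simp only [tagCube]
  rw [integral_finsetSum _ fun t _ => ((isBddMeas_tagMean_next h1 s t).pow 3).integrable _]
  have key : ∀ t, ∫ y, (s.next g y).tagMean t (fun _ => 1) ^ 3 ∂(Measure.pi fun _ : Fin l => ν) ≤
      s.tagMean t g ^ 3 + 3 / l * (s.mean g * s.tagMean t g ^ 2) +
        1 / l ^ 2 * (s.mean g ^ 2 * s.tagMean t g) := by
    intro t
    have hset : MeasurableSet {z : Fin k × X | s.2.1 z.1 = t} :=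
      (Measurable.of_discrete.comp measurable_fst :
        Measurable fun z : Fin k × X => s.2.1 z.1) (measurableSet_singleton t)
    have hq : s.mean g * ν.real {z : Fin k × X | s.2.1 z.1 = t} = s.tagMean t g := by
      rw [← fkOp_one (g := g) (K := K), ← mean_mul_integral_tag hk hpos h1, ← hν, fkOp_one,
        ← integral_indicator_one hset]
      simp only [Set.indicator_apply, Set.mem_ofPred_eq, Pi.one_apply]
    have e : ∀ y : Fin l → Fin k × X, (s.next g y).tagMean t (fun _ => 1) ^ 3 =
        (s.mean g / l) ^ 3 * (∑ i, {z : Fin k × X | s.2.1 z.1 = t}.indicator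
          (fun _ => (1 : ℝ)) (y i)) ^ 3 := fun y => by
      simp only [tagMean_next, Set.indicator_apply, Set.mem_ofPred_eq]
      ring
    simp_rw [e]
    rw [integral_const_mul]
    refine (mul_le_mul_of_nonneg_left (integral_count_pow_three_le ν hset l)
      (by positivity)).trans (le_of_eq ?_)
    rw [← hq]
    field_simp
  refine (Finset.sum_le_sum fun t _ => key t).trans (le_of_eq ?_)
  rw [Finset.sum_add_distrib, Finset.sum_add_distrib, ← Finset.mul_sum, ← Finset.mul_sum,
    ← Finset.mul_sum, ← Finset.mul_sum, sum_tagMean, tagSq]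
  ring

/-- The left side is a conditional variance, so `variance_sum_tag_sq_le` applies. The bound stays an
integral over the new generation, so that averaging over the past turns it into the expected
`tagCube` one time later. -/
lemma integral_tagSq_next_sub_sq_le (hk : 1 ≤ k) (hl : 1 ≤ l) (hpos : ∀ x, 0 < g x) {f : X → ℝ}
    (hf : IsBddMeas f) {C : ℝ} (hC : ∀ x, |f x| ≤ C) (s : State X k m) :
    ∫ y, ((s.next g y).tagSq f - ((1 / l) * (s.mean g * s.mean (fkOp g K fun x => f x ^ 2)) +
        (1 - 1 / l) * s.tagSq (fkOp g K f))) ^ 2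
        ∂(Measure.pi fun _ : Fin l => offspringLaw g K s.1) ≤
      ∫ y, 9 * C ^ 4 / l * (s.mean g * (s.next g y).tagCube (fun _ => 1))
        ∂(Measure.pi fun _ : Fin l => offspringLaw g K s.1) := by
  have := isProbabilityMeasure_offspringLaw (K := K) hk hpos s.1
  have hl' : (l : ℝ) ≠ 0 := by exact_mod_cast (by omega : l ≠ 0)
  set ν := offspringLaw g K s.1 with hν
  have hτ : Measurable fun z : Fin k × X => s.2.1 z.1 := Measurable.of_discrete.comp measurable_fst
  rw [← integral_tagSq_next hk hl hpos hf, ← hν, integral_sub_const_sq (isBddMeas_tagSq_next hf s)]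
  have hv := variance_sum_tag_sq_le ν hτ (isBddMeas_snd hf) (fun z => hC _) l
  have e2 : ∀ y : Fin l → Fin k × X, (s.next g y).tagSq f = (s.mean g / l) ^ 2 *
      ∑ t, (∑ i, if s.2.1 (y i).1 = t then f (y i).2 else 0) ^ 2 := fun y => by
    simp only [tagSq, tagMean_next, Finset.mul_sum]
    exact Finset.sum_congr rfl fun t _ => by ring
  -- Three of the four factors `s.mean g / l` are absorbed by `tagCube`; the fourth stays in front.
  have e3 : ∀ y : Fin l → Fin k × X, 9 * C ^ 4 / l * (s.mean g *
      (s.next g y).tagCube (fun _ => 1)) = (s.mean g / l) ^ 4 * (9 * C ^ 4 *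
      ∑ t, (∑ i, if s.2.1 (y i).1 = t then (1 : ℝ) else 0) ^ 3) := fun y => by
    simp only [tagCube, tagMean_next, Finset.mul_sum]
    refine Finset.sum_congr rfl fun t _ => ?_
    field_simp
  simp_rw [e3, e2, mul_pow]
  simp_rw [integral_const_mul]
  have := mul_le_mul_of_nonneg_left hv (by positivity : 0 ≤ (s.mean g / l) ^ 4)
  nlinarith [this]

end State

/-! ### The Feynman-Kac measures -/

section FeynmanKac

variable {X : Type*} [MeasurableSpace X] {M₀ : Measure X} {M : ℕ → Kernel X X} {G : ℕ → X → ℝ}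

lemma integral_etaMeas (p : ℕ) (f : X → ℝ) :
    ∫ x, f x ∂(etaMeas M₀ M G p) =
      (∫ x, f x ∂(gammaMeas M₀ M G p)) / (gammaMeas M₀ M G p).real Set.univ := by
  rw [etaMeas, integral_smul_measure, ENNReal.toReal_inv, smul_eq_mul, div_eq_inv_mul]
  rfl

variable [IsProbabilityMeasure M₀] [∀ p, IsMarkovKernel (M p)]

lemma isFiniteMeasure_gammaMeas (hG : ∀ p, IsBddMeas (G p)) (p : ℕ) :
    IsFiniteMeasure (gammaMeas M₀ M G p) := by
  induction p with
  | zero => exact inferInstanceAs (IsFiniteMeasure M₀)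
  | succ p ih =>
    have : IsFiniteMeasure
        ((gammaMeas M₀ M G p).withDensity (fun x => ENNReal.ofReal (G p x))) := by
      have := ((hG p).integrable (gammaMeas M₀ M G p)).lintegral_lt_top
      exact isFiniteMeasure_withDensity this.ne
    exact inferInstanceAs (IsFiniteMeasure
      ((M (p + 1)) ∘ₘ (gammaMeas M₀ M G p).withDensity (fun x => ENNReal.ofReal (G p x))))

/-- Moves a time step from the measure to the function; this is why the inductions on time below
generalize over `f`. -/
lemma integral_gammaMeas_succ (hG : ∀ p, IsBddMeas (G p)) (hpos : ∀ p x, 0 < G p x) (p : ℕ)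
    {f : X → ℝ} (hf : IsBddMeas f) :
    ∫ x, f x ∂(gammaMeas M₀ M G (p + 1)) =
      ∫ x, fkOp (G p) (M (p + 1)) f x ∂(gammaMeas M₀ M G p) := by
  have := isFiniteMeasure_gammaMeas (M₀ := M₀) (M := M) hG p
  have := isFiniteMeasure_gammaMeas (M₀ := M₀) (M := M) hG (p + 1)
  have hint := hf.integrable (gammaMeas M₀ M G (p + 1))
  rw [gammaMeas] at hint ⊢
  rw [Measure.comp_eq_comp_const_apply] at hint ⊢
  rw [Kernel.integral_comp hint, Kernel.const_apply,
    integral_withDensity_eq_integral_toReal_smul (hG p).1.ennreal_ofReal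
      (Eventually.of_forall fun x => ENNReal.ofReal_lt_top)]
  refine integral_congr_ae (Eventually.of_forall fun x => ?_)
  simp [fkOp, ENNReal.toReal_ofReal (hpos p x).le]

lemma gammaMeas_real_univ (hG : ∀ p, IsBddMeas (G p)) (p : ℕ) :
    (gammaMeas M₀ M G p).real Set.univ = ∫ _, (1 : ℝ) ∂(gammaMeas M₀ M G p) := by
  have := isFiniteMeasure_gammaMeas (M₀ := M₀) (M := M) hG p
  simp

lemma gammaMeas_real_univ_pos (hG : ∀ p, IsBddMeas (G p)) (hpos : ∀ p x, 0 < G p x) (p : ℕ) :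
    0 < (gammaMeas M₀ M G p).real Set.univ := by
  induction p with
  | zero => change 0 < M₀.real Set.univ; simp
  | succ p ih =>
    have := isFiniteMeasure_gammaMeas (M₀ := M₀) (M := M) hG p
    rw [gammaMeas_real_univ hG, integral_gammaMeas_succ hG hpos p (.const 1), fkOp_one,
      integral_pos_iff_support_of_nonneg (fun x => (hpos p x).le) ((hG p).integrable _)]
    have hs : Function.support (G p) = Set.univ := by
      ext x; simp [(hpos p x).ne']
    rw [hs]
    exact (ENNReal.toReal_pos_iff.1 ih).1

/-- The Cauchy-Schwarz inequality for a finite measure. -/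
lemma sq_integral_le_mul_real_univ {μ : Measure X} [IsFiniteMeasure μ] {f : X → ℝ}
    (hf : IsBddMeas f) :
    (∫ x, f x ∂μ) ^ 2 ≤ (∫ x, f x ^ 2 ∂μ) * μ.real Set.univ := by
  set m := μ.real Set.univ
  have h0 : 0 ≤ ∫ x, (m * f x - ∫ x, f x ∂μ) ^ 2 ∂μ := integral_nonneg fun _ => sq_nonneg _
  have e : ∀ x, (m * f x - ∫ x, f x ∂μ) ^ 2 =
      m ^ 2 * f x ^ 2 - (2 * m * ∫ x, f x ∂μ) * f x + (∫ x, f x ∂μ) ^ 2 := fun x => by ring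
  simp_rw [e] at h0
  rw [integral_add ((((hf.pow 2).const_mul _).sub (hf.const_mul _)).integrable μ)
    (integrable_const _), integral_sub (((hf.pow 2).const_mul _).integrable μ)
    ((hf.const_mul _).integrable μ), integral_const_mul, integral_const_mul, integral_const,
    smul_eq_mul] at h0
  have hm : 0 ≤ m := measureReal_nonneg
  rcases hm.eq_or_lt with hm0 | hm0
  · have : μ = 0 := by
      rw [← Measure.measure_univ_eq_zero]
      exact (measureReal_eq_zero_iff).1 hm0.symm
    simp [this]
  · have : 0 ≤ m * ((∫ x, f x ^ 2 ∂μ) * m - (∫ x, f x ∂μ) ^ 2) := by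
      change 0 ≤ _ + m * _ at h0
      nlinarith
    nlinarith [nonneg_of_mul_nonneg_right this hm0]

end FeynmanKac

/-! ### One step of the particle filter -/

section Step

variable {X Ω : Type*} {k : ℕ → ℕ} {G : ℕ → X → ℝ}
  {ζ : (p : ℕ) → Fin (k p) → Ω → X} {A : (p : ℕ) → Fin (k (p + 1)) → Ω → Fin (k p)}

lemma stateN_succ (p : ℕ) (ω : Ω) :
    stateN G ζ A (p + 1) ω = State.next (G p) (stateN G ζ A p ω) (generationN ζ A p ω) := by
  simp only [stateN, State.next, generationN, State.mean, eve, weightN, Finset.prod_range_succ,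
    etaN]

lemma gammaN_eq_mean (p : ℕ) (f : X → ℝ) (ω : Ω) :
    gammaN G ζ p f ω = State.mean (stateN G ζ A p ω) f := rfl

lemma etaN_nonneg {f : X → ℝ} (hf : ∀ x, 0 ≤ f x) (p : ℕ) (ω : Ω) : 0 ≤ etaN ζ p f ω :=
  div_nonneg (Finset.sum_nonneg fun _ _ => hf _) (Nat.cast_nonneg _)

lemma abs_sum_div_card_le {m : ℕ} {a : Fin m → ℝ} {C : ℝ} (hC0 : 0 ≤ C) (hC : ∀ i, |a i| ≤ C) :
    |(∑ i, a i) / m| ≤ C := by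
  rw [abs_div, Nat.abs_cast]
  refine div_le_of_le_mul₀ (Nat.cast_nonneg _) hC0 ?_
  refine (Finset.abs_sum_le_sum_abs _ _).trans ((Finset.sum_le_sum fun i _ => hC i).trans ?_)
  simp [mul_comm]

lemma abs_etaN_le {f : X → ℝ} {C : ℝ} (hC0 : 0 ≤ C) (hC : ∀ x, |f x| ≤ C) (p : ℕ) (ω : Ω) :
    |etaN ζ p f ω| ≤ C :=
  abs_sum_div_card_le hC0 fun _ => hC _

lemma weightN_nonneg (hpos : ∀ q x, 0 < G q x) (p : ℕ) (ω : Ω) : 0 ≤ weightN G ζ p ω :=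
  Finset.prod_nonneg fun q _ => etaN_nonneg (fun x => (hpos q x).le) q ω

lemma weightN_le (hpos : ∀ q x, 0 < G q x) {B : ℕ → ℝ} (hB0 : ∀ q, 0 ≤ B q)
    (hB : ∀ q x, |G q x| ≤ B q) (p : ℕ) (ω : Ω) :
    weightN G ζ p ω ≤ ∏ q ∈ Finset.range p, B q :=
  Finset.prod_le_prod (fun q _ => etaN_nonneg (fun x => (hpos q x).le) q ω) fun q _ =>
    (le_abs_self _).trans (abs_etaN_le (hB0 q) (hB q) q ω)

lemma abs_mean_le (hpos : ∀ q x, 0 < G q x) {B : ℕ → ℝ} (hB0 : ∀ q, 0 ≤ B q)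
    (hB : ∀ q x, |G q x| ≤ B q) {f : X → ℝ} {C : ℝ} (hC0 : 0 ≤ C) (hC : ∀ x, |f x| ≤ C) (p : ℕ)
    (ω : Ω) : |State.mean (stateN G ζ A p ω) f| ≤ (∏ q ∈ Finset.range p, B q) * C := by
  rw [State.mean, abs_mul]
  refine mul_le_mul ?_ (abs_sum_div_card_le hC0 fun _ => hC _) (abs_nonneg _)
    (Finset.prod_nonneg fun q _ => hB0 q)
  exact (abs_of_nonneg (weightN_nonneg hpos p ω)).trans_le (weightN_le hpos hB0 hB p ω)

lemma mean_potential_nonneg (hpos : ∀ q x, 0 < G q x) (p : ℕ) (ω : Ω) :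
    0 ≤ State.mean (stateN G ζ A p ω) (G p) :=
  mul_nonneg (weightN_nonneg hpos p ω) (etaN_nonneg (fun x => (hpos p x).le) p ω)

lemma tagMean_nonneg (hpos : ∀ q x, 0 < G q x) {f : X → ℝ} (hf : ∀ x, 0 ≤ f x) (p : ℕ)
    (t : Fin (k 0)) (ω : Ω) : 0 ≤ State.tagMean (stateN G ζ A p ω) t f := by
  refine mul_nonneg (weightN_nonneg hpos p ω)
    (div_nonneg (Finset.sum_nonneg fun i _ => ?_) (Nat.cast_nonneg _))
  split_ifs
  exacts [hf _, le_rfl]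

lemma tagMean_le (hpos : ∀ q x, 0 < G q x) {f : X → ℝ} {b : ℝ} (hb : ∀ x, f x ≤ b) (p : ℕ)
    (t : Fin (k 0)) (ω : Ω) : State.tagMean (stateN G ζ A p ω) t f ≤
      b * State.tagMean (stateN G ζ A p ω) t (fun _ => 1) := by
  simp only [State.tagMean]
  rw [mul_left_comm, ← mul_div_assoc b, Finset.mul_sum]
  refine mul_le_mul_of_nonneg_left (div_le_div_of_nonneg_right (Finset.sum_le_sum fun i _ => ?_)
    (Nat.cast_nonneg _)) (weightN_nonneg hpos p ω)
  split_ifs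
  · simpa using hb _
  · simp

lemma tagSq_nonneg (f : X → ℝ) (p : ℕ) (ω : Ω) : 0 ≤ State.tagSq (stateN G ζ A p ω) f :=
  Finset.sum_nonneg fun _ _ => sq_nonneg _

lemma tagCube_nonneg (hpos : ∀ q x, 0 < G q x) {f : X → ℝ} (hf : ∀ x, 0 ≤ f x) (p : ℕ) (ω : Ω) :
    0 ≤ State.tagCube (stateN G ζ A p ω) f :=
  Finset.sum_nonneg fun t _ => pow_nonneg (tagMean_nonneg hpos hf p t ω) 3

lemma tagSq_le (hpos : ∀ q x, 0 < G q x) {f : X → ℝ} (hf : ∀ x, 0 ≤ f x) {b : ℝ}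
    (hb : ∀ x, f x ≤ b) (p : ℕ) (ω : Ω) : State.tagSq (stateN G ζ A p ω) f ≤
      b ^ 2 * State.tagSq (stateN G ζ A p ω) (fun _ => 1) := by
  simp only [State.tagSq, Finset.mul_sum, ← mul_pow]
  exact Finset.sum_le_sum fun t _ =>
    pow_le_pow_left₀ (tagMean_nonneg hpos hf p t ω) (tagMean_le hpos hb p t ω) 2

lemma tagCube_le (hpos : ∀ q x, 0 < G q x) {f : X → ℝ} (hf : ∀ x, 0 ≤ f x) {b : ℝ}
    (hb : ∀ x, f x ≤ b) (p : ℕ) (ω : Ω) : State.tagCube (stateN G ζ A p ω) f ≤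
      b ^ 3 * State.tagCube (stateN G ζ A p ω) (fun _ => 1) := by
  simp only [State.tagCube, Finset.mul_sum, ← mul_pow]
  exact Finset.sum_le_sum fun t _ =>
    pow_le_pow_left₀ (tagMean_nonneg hpos hf p t ω) (tagMean_le hpos hb p t ω) 3

lemma mean_zero (f : X → ℝ) (ω : Ω) :
    State.mean (stateN G ζ A 0 ω) f = (∑ i, f (ζ 0 i ω)) / k 0 := by
  simp [State.mean, stateN, weightN]

lemma tagMean_zero (t : Fin (k 0)) (f : X → ℝ) (ω : Ω) :
    State.tagMean (stateN G ζ A 0 ω) t f = f (ζ 0 t ω) / k 0 := by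
  change weightN G ζ 0 ω * ((∑ i, if i = t then f (ζ 0 i ω) else 0) / k 0) = _
  simp [weightN]

/-- At time 0 each particle is its own Eve, so only diagonal pairs remain. -/
lemma tagSq_zero (f : X → ℝ) (ω : Ω) :
    State.tagSq (stateN G ζ A 0 ω) f =
      1 / k 0 * State.mean (stateN G ζ A 0 ω) (fun x => f x ^ 2) := by
  simp only [mean_zero, State.tagSq, tagMean_zero]
  rw [Finset.sum_div, Finset.mul_sum]
  exact Finset.sum_congr rfl fun i _ => by ring

lemma tagCube_zero (hk : 1 ≤ k 0) (ω : Ω) :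
    State.tagCube (stateN G ζ A 0 ω) (fun _ => 1) = 1 / (k 0 : ℝ) ^ 2 := by
  have hk' : (k 0 : ℝ) ≠ 0 := by exact_mod_cast (by omega : k 0 ≠ 0)
  simp only [State.tagCube, tagMean_zero, Finset.sum_const, Finset.card_univ, Fintype.card_fin,
    nsmul_eq_mul]
  field_simp

variable [MeasurableSpace X] [MeasurableSpace Ω] {P : Measure Ω} {M₀ : Measure X}
  {M : ℕ → Kernel X X} {n : ℕ}

namespace IsParticleFilter

lemma isBddMeas_etaN (h : IsParticleFilter P M₀ M G n k ζ A) {p : ℕ} (hp : p ≤ n) {f : X → ℝ}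
    (hf : IsBddMeas f) : IsBddMeas (etaN ζ p f) :=
  (IsBddMeas.sum fun i _ => hf.comp (h.measurable_particle p hp i)).div_const _

lemma isBddMeas_weightN (h : IsParticleFilter P M₀ M G n k ζ A) (hG : ∀ q, IsBddMeas (G q))
    {p : ℕ} (hp : p ≤ n) : IsBddMeas (weightN G ζ p) :=
  IsBddMeas.prod fun q hq => h.isBddMeas_etaN ((Finset.mem_range.1 hq).le.trans hp) (hG q)

lemma isBddMeas_mean (h : IsParticleFilter P M₀ M G n k ζ A) (hG : ∀ q, IsBddMeas (G q))
    {p : ℕ} (hp : p ≤ n) {f : X → ℝ} (hf : IsBddMeas f) :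
    IsBddMeas (fun ω => State.mean (stateN G ζ A p ω) f) :=
  (h.isBddMeas_weightN hG hp).mul (h.isBddMeas_etaN hp hf)

lemma isBddMeas_tagMean (h : IsParticleFilter P M₀ M G n k ζ A) (hG : ∀ q, IsBddMeas (G q))
    {p : ℕ} (hp : p ≤ n) (t : Fin (k 0)) {f : X → ℝ} (hf : IsBddMeas f) :
    IsBddMeas (fun ω => State.tagMean (stateN G ζ A p ω) t f) := by
  refine (h.isBddMeas_weightN hG hp).mul ((IsBddMeas.sum fun i _ => IsBddMeas.ite ?_
    (hf.comp (h.measurable_particle p hp i)) (.const 0)).div_const _)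
  exact ((measurable_eve_history le_rfl i).mono (h.history_le hp) le_rfl)
    (measurableSet_singleton t)

lemma isBddMeas_tagSq (h : IsParticleFilter P M₀ M G n k ζ A) (hG : ∀ q, IsBddMeas (G q))
    {p : ℕ} (hp : p ≤ n) {f : X → ℝ} (hf : IsBddMeas f) :
    IsBddMeas (fun ω => State.tagSq (stateN G ζ A p ω) f) :=
  IsBddMeas.sum fun t _ => (h.isBddMeas_tagMean hG hp t hf).pow 2

lemma isBddMeas_tagCube (h : IsParticleFilter P M₀ M G n k ζ A) (hG : ∀ q, IsBddMeas (G q))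
    {p : ℕ} (hp : p ≤ n) {f : X → ℝ} (hf : IsBddMeas f) :
    IsBddMeas (fun ω => State.tagCube (stateN G ζ A p ω) f) :=
  IsBddMeas.sum fun t _ => (h.isBddMeas_tagMean hG hp t hf).pow 3

/-! #### The initial generation -/

lemma integral_initial (h : IsParticleFilter P M₀ M G n k ζ A) {F : (Fin (k 0) → X) → ℝ}
    (hF : Measurable F) :
    ∫ ω, F (fun i => ζ 0 i ω) ∂P = ∫ x, F x ∂(Measure.pi fun _ : Fin (k 0) => M₀) := by
  rw [← h.initial_law, integral_map _ hF.aestronglyMeasurable]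
  exact (measurable_pi_lambda _ fun i => h.measurable_particle 0 (Nat.zero_le _) i).aemeasurable

lemma integral_mean_zero [IsProbabilityMeasure M₀] (h : IsParticleFilter P M₀ M G n k ζ A)
    (hk : 1 ≤ k 0) {f : X → ℝ} (hf : IsBddMeas f) :
    ∫ ω, State.mean (stateN G ζ A 0 ω) f ∂P = ∫ x, f x ∂M₀ := by
  have hk' : (k 0 : ℝ) ≠ 0 := by exact_mod_cast (by omega : k 0 ≠ 0)
  simp only [mean_zero]
  rw [h.integral_initial (F := fun x => (∑ i, f (x i)) / k 0) ((hf.sum_pi _).1.div_const _),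
    integral_div, integral_sum_pi M₀ hf, mul_div_cancel_left₀ _ hk']

lemma integral_mean_zero_sq [IsProbabilityMeasure M₀] (h : IsParticleFilter P M₀ M G n k ζ A)
    (hk : 1 ≤ k 0) {f : X → ℝ} (hf : IsBddMeas f) :
    ∫ ω, State.mean (stateN G ζ A 0 ω) f ^ 2 ∂P =
      (1 / k 0) * (∫ x, f x ^ 2 ∂M₀) + (1 - 1 / k 0) * (∫ x, f x ∂M₀) ^ 2 := by
  simp only [mean_zero]
  rw [h.integral_initial (F := fun x => ((∑ i, f (x i)) / k 0) ^ 2)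
    (((hf.sum_pi _).1.div_const _).pow_const 2)]
  simpa using State.integral_sq_weighted_sum M₀ hk hf 1

lemma integral_mean_zero_sub_pow_four_le [IsProbabilityMeasure M₀]
    (h : IsParticleFilter P M₀ M G n k ζ A) (hk : 1 ≤ k 0) {f : X → ℝ} (hf : IsBddMeas f) {C : ℝ}
    (hC : ∀ x, |f x| ≤ C) :
    ∫ ω, (State.mean (stateN G ζ A 0 ω) f - ∫ x, f x ∂M₀) ^ 4 ∂P ≤
      176 * C ^ 4 / (k 0 : ℝ) ^ 2 := by
  simp only [mean_zero]
  rw [h.integral_initial (F := fun x => ((∑ i, f (x i)) / k 0 - ∫ x, f x ∂M₀) ^ 4)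
    ((((hf.sum_pi _).1.div_const _).sub_const _).pow_const 4)]
  exact integral_mean_sub_pow_four_le M₀ hf hC hk

/-! #### One step -/

variable [IsProbabilityMeasure P] [∀ p, IsMarkovKernel (M p)]

/-- The Markov property, for functions of two successive states. -/
lemma integral_next (h : IsParticleFilter P M₀ M G n k ζ A) (hG : ∀ q, IsBddMeas (G q))
    (hpos : ∀ q x, 0 < G q x) {p : ℕ} (hp : p < n) (hk : 1 ≤ k p)
    {F : State X (k p) (k 0) × State X (k (p + 1)) (k 0) → ℝ} (hF : Measurable F)
    (hb : IsBddMeas fun ω => F (stateN G ζ A p ω, stateN G ζ A (p + 1) ω)) :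
    Integrable (fun ω => ∫ y, F (stateN G ζ A p ω, State.next (G p) (stateN G ζ A p ω) y)
      ∂(Measure.pi fun _ : Fin (k (p + 1)) =>
        offspringLaw (G p) (M (p + 1)) (stateN G ζ A p ω).1)) P ∧
    ∫ ω, F (stateN G ζ A p ω, stateN G ζ A (p + 1) ω) ∂P =
      ∫ ω, ∫ y, F (stateN G ζ A p ω, State.next (G p) (stateN G ζ A p ω) y)
        ∂(Measure.pi fun _ : Fin (k (p + 1)) =>
          offspringLaw (G p) (M (p + 1)) (stateN G ζ A p ω).1) ∂P := by
  simp only [stateN_succ] at hb ⊢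
  exact h.integral_transition (fun q => (hG q).1) hpos hp hk
    (F := fun z => F (z.1, State.next (G p) z.1 z.2))
    (hF.comp (measurable_fst.prodMk (State.measurable_next (hG p).1))) hb

lemma integral_mean_succ (h : IsParticleFilter P M₀ M G n k ζ A) (hG : ∀ q, IsBddMeas (G q))
    (hpos : ∀ q x, 0 < G q x) (hk : ∀ q ≤ n, 2 ≤ k q) {p : ℕ} (hp : p < n) {f : X → ℝ}
    (hf : IsBddMeas f) :
    ∫ ω, State.mean (stateN G ζ A (p + 1) ω) f ∂P =
      ∫ ω, State.mean (stateN G ζ A p ω) (fkOp (G p) (M (p + 1)) f) ∂P := by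
  have hkp := (hk p hp.le).trans' one_le_two
  have hkp' := (hk (p + 1) hp).trans' one_le_two
  rw [(h.integral_next hG hpos hp hkp (F := fun z => z.2.mean f)
    ((State.measurable_mean hf.1).comp measurable_snd) (h.isBddMeas_mean hG hp hf)).2]
  simp only [State.integral_mean_next hkp hkp' (hpos p) hf]

lemma integral_mean_sq_succ (h : IsParticleFilter P M₀ M G n k ζ A) (hG : ∀ q, IsBddMeas (G q))
    (hpos : ∀ q x, 0 < G q x) (hk : ∀ q ≤ n, 2 ≤ k q) {p : ℕ} (hp : p < n) {f : X → ℝ}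
    (hf : IsBddMeas f) :
    ∫ ω, State.mean (stateN G ζ A (p + 1) ω) f ^ 2 ∂P =
      (1 / k (p + 1)) * (∫ ω, State.mean (stateN G ζ A p ω) (G p) *
        State.mean (stateN G ζ A p ω) (fkOp (G p) (M (p + 1)) fun x => f x ^ 2) ∂P) +
      (1 - 1 / k (p + 1)) *
        ∫ ω, State.mean (stateN G ζ A p ω) (fkOp (G p) (M (p + 1)) f) ^ 2 ∂P := by
  have hkp := (hk p hp.le).trans' one_le_two
  have hkp' := (hk (p + 1) hp).trans' one_le_two
  rw [(h.integral_next hG hpos hp hkp (F := fun z => z.2.mean f ^ 2)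
    (((State.measurable_mean hf.1).comp measurable_snd).pow_const 2)
    ((h.isBddMeas_mean hG hp hf).pow 2)).2]
  simp only [State.integral_mean_next_sq hkp hkp' (hpos p) hf]
  rw [integral_add, integral_const_mul, integral_const_mul]
  · exact (((h.isBddMeas_mean hG hp.le (hG p)).mul
      (h.isBddMeas_mean hG hp.le ((hf.pow 2).fkOp (hG p)))).const_mul _).integrable P
  · exact (((h.isBddMeas_mean hG hp.le (hf.fkOp (hG p))).pow 2).const_mul _).integrable P

lemma integral_tagSq_succ (h : IsParticleFilter P M₀ M G n k ζ A) (hG : ∀ q, IsBddMeas (G q))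
    (hpos : ∀ q x, 0 < G q x) (hk : ∀ q ≤ n, 2 ≤ k q) {p : ℕ} (hp : p < n) {f : X → ℝ}
    (hf : IsBddMeas f) :
    ∫ ω, State.tagSq (stateN G ζ A (p + 1) ω) f ∂P =
      (1 / k (p + 1)) * (∫ ω, State.mean (stateN G ζ A p ω) (G p) *
        State.mean (stateN G ζ A p ω) (fkOp (G p) (M (p + 1)) fun x => f x ^ 2) ∂P) +
      (1 - 1 / k (p + 1)) *
        ∫ ω, State.tagSq (stateN G ζ A p ω) (fkOp (G p) (M (p + 1)) f) ∂P := by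
  have hkp := (hk p hp.le).trans' one_le_two
  have hkp' := (hk (p + 1) hp).trans' one_le_two
  rw [(h.integral_next hG hpos hp hkp (F := fun z => z.2.tagSq f)
    ((State.measurable_tagSq hf.1).comp measurable_snd) (h.isBddMeas_tagSq hG hp hf)).2]
  simp only [State.integral_tagSq_next hkp hkp' (hpos p) hf]
  rw [integral_add, integral_const_mul, integral_const_mul]
  · exact (((h.isBddMeas_mean hG hp.le (hG p)).mul
      (h.isBddMeas_mean hG hp.le ((hf.pow 2).fkOp (hG p)))).const_mul _).integrable P
  · exact ((h.isBddMeas_tagSq hG hp.le (hf.fkOp (hG p))).const_mul _).integrable P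

lemma integral_mean_succ_sub_pow_four_le (h : IsParticleFilter P M₀ M G n k ζ A)
    (hG : ∀ q, IsBddMeas (G q)) (hpos : ∀ q x, 0 < G q x) (hk : ∀ q ≤ n, 2 ≤ k q) {p : ℕ}
    (hp : p < n) {W : ℝ} (hW : ∀ ω, State.mean (stateN G ζ A p ω) (G p) ≤ W) {f : X → ℝ}
    (hf : IsBddMeas f) {C : ℝ} (hC : ∀ x, |f x| ≤ C) :
    ∫ ω, (State.mean (stateN G ζ A (p + 1) ω) f -
      State.mean (stateN G ζ A p ω) (fkOp (G p) (M (p + 1)) f)) ^ 4 ∂P ≤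
      W ^ 4 * (176 * C ^ 4 / (k (p + 1) : ℝ) ^ 2) := by
  have hkp := (hk p hp.le).trans' one_le_two
  have hkp' := (hk (p + 1) hp).trans' one_le_two
  have hQ := hf.fkOp (K := M (p + 1)) (hG p)
  have hstep := h.integral_next hG hpos hp hkp
    (F := fun z => (z.2.mean f - z.1.mean (fkOp (G p) (M (p + 1)) f)) ^ 4)
    ((((State.measurable_mean hf.1).comp measurable_snd).sub
      ((State.measurable_mean hQ.1).comp measurable_fst)).pow_const 4)
    (((h.isBddMeas_mean hG hp hf).sub (h.isBddMeas_mean hG hp.le hQ)).pow 4)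
  rw [hstep.2]
  refine (integral_mono hstep.1 (integrable_const _) fun ω =>
    (State.integral_mean_next_sub_pow_four_le hkp hkp' (hpos p) hf hC _).trans
      (mul_le_mul_of_nonneg_right (pow_le_pow_left₀ (mean_potential_nonneg hpos p ω) (hW ω) 4)
        (by positivity))).trans ?_
  simp

lemma integral_tagCube_succ_le (h : IsParticleFilter P M₀ M G n k ζ A)
    (hG : ∀ q, IsBddMeas (G q)) (hpos : ∀ q x, 0 < G q x) (hk : ∀ q ≤ n, 2 ≤ k q) {p : ℕ}
    (hp : p < n) {W : ℝ} (hW : ∀ ω, State.mean (stateN G ζ A p ω) (G p) ≤ W) {b : ℝ}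
    (hb : ∀ x, G p x ≤ b) :
    ∫ ω, State.tagCube (stateN G ζ A (p + 1) ω) (fun _ => 1) ∂P ≤
      b ^ 3 * (∫ ω, State.tagCube (stateN G ζ A p ω) (fun _ => 1) ∂P) +
      3 / k (p + 1) * (W * (b ^ 2 * ∫ ω, State.tagSq (stateN G ζ A p ω) (fun _ => 1) ∂P)) +
      1 / (k (p + 1) : ℝ) ^ 2 * W ^ 3 := by
  have hkp := (hk p hp.le).trans' one_le_two
  have hkp' := (hk (p + 1) hp).trans' one_le_two
  have h1 : IsBddMeas (fun _ : X => (1 : ℝ)) := .const 1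
  have hstep := h.integral_next hG hpos hp hkp (F := fun z => z.2.tagCube (fun _ => 1))
    ((State.measurable_tagCube h1.1).comp measurable_snd) (h.isBddMeas_tagCube hG hp h1)
  have hc3 := (h.isBddMeas_tagCube hG hp.le h1).const_mul (b ^ 3)
  have hc2 := (((h.isBddMeas_tagSq hG hp.le h1).const_mul (b ^ 2)).const_mul W).const_mul
    (3 / (k (p + 1) : ℝ))
  rw [hstep.2]
  refine (integral_mono hstep.1 (((hc3.add hc2).add (.const (1 / (k (p + 1) : ℝ) ^ 2 * W ^ 3))
    ).integrable P) fun ω =>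
    (State.integral_tagCube_next_le hkp hkp' (hpos p) _ (mean_potential_nonneg hpos p ω)).trans
      ?_).trans (le_of_eq ?_)
  · have hm := mean_potential_nonneg (A := A) (ζ := ζ) hpos p ω
    have hs := tagSq_nonneg (G := G) (A := A) (ζ := ζ) (G p) p ω
    refine add_le_add (add_le_add (tagCube_le hpos (fun x => (hpos p x).le) hb p ω)
      (mul_le_mul_of_nonneg_left (mul_le_mul (hW ω) (tagSq_le hpos (fun x => (hpos p x).le) hb p ω)
        hs (hm.trans (hW ω))) (by positivity)))
      (mul_le_mul_of_nonneg_left (pow_le_pow_left₀ hm (hW ω) 3) (by positivity))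
  · rw [integral_add ((hc3.add hc2).integrable P) (integrable_const _),
      integral_add (hc3.integrable P) (hc2.integrable P)]
    simp only [integral_const_mul, integral_const, probReal_univ, smul_eq_mul, one_mul]

lemma integral_tagSq_succ_sub_sq_le (h : IsParticleFilter P M₀ M G n k ζ A)
    (hG : ∀ q, IsBddMeas (G q)) (hpos : ∀ q x, 0 < G q x) (hk : ∀ q ≤ n, 2 ≤ k q) {p : ℕ}
    (hp : p < n) {W : ℝ} (hW : ∀ ω, State.mean (stateN G ζ A p ω) (G p) ≤ W) {f : X → ℝ}
    (hf : IsBddMeas f) {C : ℝ} (hC : ∀ x, |f x| ≤ C) :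
    ∫ ω, (State.tagSq (stateN G ζ A (p + 1) ω) f -
      ((1 / k (p + 1)) * (State.mean (stateN G ζ A p ω) (G p) *
        State.mean (stateN G ζ A p ω) (fkOp (G p) (M (p + 1)) fun x => f x ^ 2)) +
      (1 - 1 / k (p + 1)) *
        State.tagSq (stateN G ζ A p ω) (fkOp (G p) (M (p + 1)) f))) ^ 2 ∂P ≤
      9 * C ^ 4 / k (p + 1) *
        (W * ∫ ω, State.tagCube (stateN G ζ A (p + 1) ω) (fun _ => 1) ∂P) := by
  have hkp := (hk p hp.le).trans' one_le_two
  have hkp' := (hk (p + 1) hp).trans' one_le_two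
  have h1 : IsBddMeas (fun _ : X => (1 : ℝ)) := .const 1
  have hQ := hf.fkOp (K := M (p + 1)) (hG p)
  have hQ2 := (hf.pow 2).fkOp (K := M (p + 1)) (hG p)
  have hstep := h.integral_next hG hpos hp hkp
    (F := fun z => (z.2.tagSq f - ((1 / k (p + 1)) * (z.1.mean (G p) *
      z.1.mean (fkOp (G p) (M (p + 1)) fun x => f x ^ 2)) +
      (1 - 1 / k (p + 1)) * z.1.tagSq (fkOp (G p) (M (p + 1)) f))) ^ 2)
    ((((State.measurable_tagSq hf.1).comp measurable_snd).sub
      ((((((State.measurable_mean (hG p).1).comp measurable_fst).mul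
        ((State.measurable_mean hQ2.1).comp measurable_fst))).const_mul _).add
      (((State.measurable_tagSq hQ.1).comp measurable_fst).const_mul _))).pow_const 2)
    (((h.isBddMeas_tagSq hG hp hf).sub ((((h.isBddMeas_mean hG hp.le (hG p)).mul
      (h.isBddMeas_mean hG hp.le hQ2)).const_mul _).add
      ((h.isBddMeas_tagSq hG hp.le hQ).const_mul _))).pow 2)
  have hcube := ((h.isBddMeas_mean hG hp.le (hG p)).mul
    (h.isBddMeas_tagCube hG hp h1)).const_mul (9 * C ^ 4 / k (p + 1))
  have hstep' := h.integral_next hG hpos hp hkp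
    (F := fun z => 9 * C ^ 4 / k (p + 1) * (z.1.mean (G p) * z.2.tagCube (fun _ => 1)))
    ((((State.measurable_mean (hG p).1).comp measurable_fst).mul
      ((State.measurable_tagCube h1.1).comp measurable_snd)).const_mul _) hcube
  rw [hstep.2]
  refine (integral_mono hstep.1 hstep'.1 fun ω =>
    State.integral_tagSq_next_sub_sq_le hkp hkp' (hpos p) hf hC _).trans ?_
  rw [← hstep'.2, ← integral_const_mul W, ← integral_const_mul]
  refine integral_mono (hcube.integrable P)
    ((((h.isBddMeas_tagCube hG hp h1).const_mul W).const_mul _).integrable P) fun ω => ?_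
  exact mul_le_mul_of_nonneg_left (mul_le_mul_of_nonneg_right (hW ω)
    (tagCube_nonneg hpos (fun _ => zero_le_one) (p + 1) ω)) (by positivity)

end IsParticleFilter

end Step

/-! ### Lack of bias -/

/-- The product `∏_{q ≤ p} k_q / (k_q - 1)`. -/
def biasFactor (k : ℕ → ℕ) (p : ℕ) : ℝ :=
  ∏ q ∈ Finset.range (p + 1), (k q : ℝ) / ((k q : ℝ) - 1)

lemma biasFactor_succ (k : ℕ → ℕ) (p : ℕ) :
    biasFactor k (p + 1) = biasFactor k p * ((k (p + 1) : ℝ) / ((k (p + 1) : ℝ) - 1)) :=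
  Finset.prod_range_succ _ _

lemma sum_sum_ite_ne {ι T : Type*} [Fintype ι] [Fintype T] [DecidableEq T] (e : ι → T)
    (a : ι → ℝ) :
    ∑ i, ∑ j, (if e i ≠ e j then a i * a j else 0) =
      (∑ i, a i) ^ 2 - ∑ t, (∑ i, if e i = t then a i else 0) ^ 2 := by
  have h1 : (∑ i, a i) ^ 2 = ∑ i, ∑ j, a i * a j := by rw [sq, Finset.sum_mul_sum]
  have h2 : ∑ t, (∑ i, if e i = t then a i else 0) ^ 2 =
      ∑ i, ∑ j, if e i = e j then a i * a j else 0 := by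
    simp_rw [sq, Finset.sum_mul_sum]
    rw [Finset.sum_comm]
    refine Finset.sum_congr rfl fun i _ => ?_
    rw [Finset.sum_comm]
    refine Finset.sum_congr rfl fun j _ => ?_
    simp only [ite_mul, zero_mul, Finset.sum_ite_eq, Finset.mem_univ, if_true, mul_ite, mul_zero]
  rw [h1, h2, ← Finset.sum_sub_distrib]
  refine Finset.sum_congr rfl fun i _ => ?_
  rw [← Finset.sum_sub_distrib]
  refine Finset.sum_congr rfl fun j _ => ?_
  by_cases h : e i = e j <;> simp [h]

section Unbiased

variable {X Ω : Type*} {k : ℕ → ℕ} {G : ℕ → X → ℝ}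
  {ζ : (p : ℕ) → Fin (k p) → Ω → X} {A : (p : ℕ) → Fin (k (p + 1)) → Ω → Fin (k p)}

lemma mean_one {p : ℕ} (hk : 1 ≤ k p) (ω : Ω) :
    State.mean (stateN G ζ A p ω) (fun _ => 1) = weightN G ζ p ω := by
  have hk0 : (k p : ℝ) ≠ 0 := by exact_mod_cast (by omega : k p ≠ 0)
  change weightN G ζ p ω * ((∑ _i : Fin (k p), (1 : ℝ)) / k p) = _
  simp [hk0]

/-- The variance estimator, weighted by the square of the normalizing constant estimator. -/
lemma gammaN_one_sq_mul_varEst {n : ℕ} (hk : 2 ≤ k n) (φ : X → ℝ) (ω : Ω) :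
    gammaN G ζ n (fun _ => 1) ω ^ 2 * varEst ζ A n φ ω =
      biasFactor k n * State.tagSq (stateN G ζ A n ω) φ -
        (biasFactor k n - 1) * State.mean (stateN G ζ A n ω) φ ^ 2 := by
  have hk1 : (2 : ℝ) ≤ k n := by exact_mod_cast hk
  have hk' : (k n : ℝ) ≠ 0 := by positivity
  have hk'' : (k n : ℝ) - 1 ≠ 0 := by linarith
  rw [gammaN_eq_mean (A := A), mean_one (hk.trans' one_le_two), varEst, sum_sum_ite_ne]
  have h1 : State.mean (stateN G ζ A n ω) φ = weightN G ζ n ω * etaN ζ n φ ω := rfl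
  have h2 : State.tagSq (stateN G ζ A n ω) φ = weightN G ζ n ω ^ 2 *
      (∑ t, (∑ i, if eve A n i ω = t then φ (ζ n i ω) else 0) ^ 2) / (k n : ℝ) ^ 2 := by
    simp only [State.tagSq, Finset.mul_sum, Finset.sum_div]
    refine Finset.sum_congr rfl fun t _ => ?_
    rw [State.tagMean, mul_pow, div_pow, mul_div_assoc]
    rfl
  -- The product in `varEst` stops before `n`; its prefactor $1/(k_n(k_n-1))$ is the missing factor
  -- $k_n/(k_n-1)$ divided by $k_n^2$.
  have h3 : biasFactor k n = (∏ p ∈ Finset.range n, (k p : ℝ) / ((k p : ℝ) - 1)) *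
      ((k n : ℝ) / ((k n : ℝ) - 1)) := Finset.prod_range_succ _ _
  have h4 : ∑ i, φ (ζ n i ω) = etaN ζ n φ ω * k n := by
    rw [etaN]; field_simp
  rw [h1, h2, h3, h4]
  field_simp
  ring

variable [MeasurableSpace X] [MeasurableSpace Ω] {P : Measure Ω} [IsProbabilityMeasure P]
  {M₀ : Measure X} [IsProbabilityMeasure M₀] {M : ℕ → Kernel X X} [∀ p, IsMarkovKernel (M p)]
  {n : ℕ}

namespace IsParticleFilter

/-- `γ_p^N(f)` is an unbiased estimator of `γ_p(f)`. -/
lemma integral_mean (h : IsParticleFilter P M₀ M G n k ζ A) (hG : ∀ q, IsBddMeas (G q))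
    (hpos : ∀ q x, 0 < G q x) (hk : ∀ q ≤ n, 2 ≤ k q) {p : ℕ} (hp : p ≤ n) {f : X → ℝ}
    (hf : IsBddMeas f) :
    ∫ ω, State.mean (stateN G ζ A p ω) f ∂P = ∫ x, f x ∂(gammaMeas M₀ M G p) := by
  induction p generalizing f with
  | zero => exact h.integral_mean_zero ((hk 0 hp).trans' one_le_two) hf
  | succ p ih =>
    rw [h.integral_mean_succ hG hpos hk hp hf, ih (Nat.le_of_succ_le hp) (hf.fkOp (hG p)),
      integral_gammaMeas_succ hG hpos p hf]

/-- The corrected combination of `tagSq` and `mean ^ 2` is an unbiased estimator of the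
variance of `γ_p^N(f)`. -/
lemma integral_varEst (h : IsParticleFilter P M₀ M G n k ζ A) (hG : ∀ q, IsBddMeas (G q))
    (hpos : ∀ q x, 0 < G q x) (hk : ∀ q ≤ n, 2 ≤ k q) {p : ℕ} (hp : p ≤ n) {f : X → ℝ}
    (hf : IsBddMeas f) :
    biasFactor k p * (∫ ω, State.tagSq (stateN G ζ A p ω) f ∂P) -
        (biasFactor k p - 1) * (∫ ω, State.mean (stateN G ζ A p ω) f ^ 2 ∂P) =
      (∫ ω, State.mean (stateN G ζ A p ω) f ^ 2 ∂P) - (∫ x, f x ∂(gammaMeas M₀ M G p)) ^ 2 := by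
  induction p generalizing f with
  | zero =>
    have hk0 := (hk 0 hp).trans' one_le_two
    have hk1 : (2 : ℝ) ≤ k 0 := by exact_mod_cast hk 0 hp
    have hk' : (k 0 : ℝ) ≠ 0 := by positivity
    have hk'' : (k 0 : ℝ) - 1 ≠ 0 := by linarith
    simp only [tagSq_zero]
    rw [integral_const_mul, h.integral_mean_zero hk0 (hf.pow 2), h.integral_mean_zero_sq hk0 hf,
      gammaMeas, biasFactor]
    simp only [zero_add, Finset.range_one, Finset.prod_singleton]
    field_simp
    ring
  | succ p ih =>
    have hk1 : (2 : ℝ) ≤ k (p + 1) := by exact_mod_cast hk (p + 1) hp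
    have hk' : (k (p + 1) : ℝ) ≠ 0 := by positivity
    have hk'' : (k (p + 1) : ℝ) - 1 ≠ 0 := by linarith
    -- The claim is equivalent to `biasFactor` times the mean of `mean ^ 2 - tagSq` being
    -- $\gamma_p(f)^2$. In that difference `B` cancels, and the remaining factor $1-1/\kappa$ turns
    -- `biasFactor k (p + 1)` into `biasFactor k p`.
    have ih' := ih (Nat.le_of_succ_le hp) (hf.fkOp (K := M (p + 1)) (hG p))
    rw [h.integral_tagSq_succ hG hpos hk hp hf, h.integral_mean_sq_succ hG hpos hk hp hf,
      integral_gammaMeas_succ hG hpos p hf, biasFactor_succ]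
    set B := ∫ ω, State.mean (stateN G ζ A p ω) (G p) *
        State.mean (stateN G ζ A p ω) (fkOp (G p) (M (p + 1)) fun x => f x ^ 2) ∂P
    set Z := ∫ ω, State.tagSq (stateN G ζ A p ω) (fkOp (G p) (M (p + 1)) f) ∂P
    set U := ∫ ω, State.mean (stateN G ζ A p ω) (fkOp (G p) (M (p + 1)) f) ^ 2 ∂P
    set a := biasFactor k p
    set κ := (k (p + 1) : ℝ)
    field_simp
    linear_combination (κ * (κ - 1)) * ih'

end IsParticleFilter

end Unbiased

/-! ### Convergence in mean and in probability -/

section Convergence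

variable {Ω : ℕ → Type*} [∀ N, MeasurableSpace (Ω N)] {P : (N : ℕ) → Measure (Ω N)}

/-- Convergence in `L¹` to a constant; the variables `Y N` may live on different probability
spaces. -/
structure TendstoInMean (P : (N : ℕ) → Measure (Ω N)) (Y : (N : ℕ) → Ω N → ℝ) (a : ℝ) :
    Prop where
  isBddMeas : ∀ᶠ N in atTop, IsBddMeas (Y N)
  tendsto : Tendsto (fun N => ∫ ω, |Y N ω - a| ∂(P N)) atTop (𝓝 0)

lemma TendstoInProb.congr {Y Z : (N : ℕ) → Ω N → ℝ} {a : ℝ} (hY : TendstoInProb P Y a)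
    (h : ∀ᶠ N in atTop, ∀ ω, Y N ω = Z N ω) : TendstoInProb P Z a := by
  intro ε hε
  refine (hY ε hε).congr' ?_
  filter_upwards [h] with N hN
  simp only [hN]

/-- The continuous mapping theorem for two sequences with constant limits. -/
lemma TendstoInProb.map₂ {Y Z : (N : ℕ) → Ω N → ℝ} {a b : ℝ} (hY : TendstoInProb P Y a)
    (hZ : TendstoInProb P Z b) {F : ℝ → ℝ → ℝ}
    (hF : ContinuousAt (fun z : ℝ × ℝ => F z.1 z.2) (a, b)) :
    TendstoInProb P (fun N ω => F (Y N ω) (Z N ω)) (F a b) := by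
  intro ε hε
  obtain ⟨δ, hδ, hd⟩ := Metric.continuousAt_iff.1 hF ε hε
  have h0 : Tendsto (fun N => P N {ω | δ ≤ |Y N ω - a|} + P N {ω | δ ≤ |Z N ω - b|}) atTop
      (𝓝 0) := by simpa using (hY δ hδ).add (hZ δ hδ)
  refine tendsto_of_tendsto_of_tendsto_of_le_of_le tendsto_const_nhds h0 (fun _ => zero_le) ?_
  refine fun N => (measure_mono fun ω hω => ?_).trans (measure_union_le _ _)
  by_contra hcon
  simp only [Set.mem_union, Set.mem_ofPred_eq, not_or, not_le] at hcon hω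
  have := hd (x := (Y N ω, Z N ω)) (by
    rw [Prod.dist_eq, max_lt_iff]; simpa [Real.dist_eq] using hcon)
  rw [Real.dist_eq] at this
  exact absurd hω (not_le.2 this)

namespace TendstoInMean

variable {Y Z : (N : ℕ) → Ω N → ℝ} {a b : ℝ}

lemma congr (hY : TendstoInMean P Y a) (h : ∀ᶠ N in atTop, ∀ ω, Y N ω = Z N ω) :
    TendstoInMean P Z a := by
  constructor
  · filter_upwards [hY.isBddMeas, h] with N h1 h2
    exact (funext h2 : Y N = Z N) ▸ h1
  · refine hY.tendsto.congr' ?_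
    filter_upwards [h] with N hN
    simp only [hN]

variable [∀ N, IsProbabilityMeasure (P N)]

lemma add (hY : TendstoInMean P Y a) (hZ : TendstoInMean P Z b) :
    TendstoInMean P (fun N ω => Y N ω + Z N ω) (a + b) := by
  constructor
  · filter_upwards [hY.isBddMeas, hZ.isBddMeas] with N h1 h2 using h1.add h2
  · refine squeeze_zero' (Eventually.of_forall fun N => integral_nonneg fun _ => abs_nonneg _) ?_
      (by simpa using hY.tendsto.add hZ.tendsto)
    filter_upwards [hY.isBddMeas, hZ.isBddMeas] with N h1 h2
    have i1 := (h1.sub (.const a)).abs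
    have i2 := (h2.sub (.const b)).abs
    rw [← integral_add (i1.integrable _) (i2.integrable _)]
    refine integral_mono (((h1.add h2).sub (.const _)).abs.integrable _)
      ((i1.add i2).integrable _) fun ω => ?_
    have e : Y N ω + Z N ω - (a + b) = (Y N ω - a) + (Z N ω - b) := by ring
    simp only [e]
    exact abs_add_le _ _

lemma seq_mul (hY : TendstoInMean P Y a) {u : ℕ → ℝ} {l : ℝ} (hu : Tendsto u atTop (𝓝 l)) :
    TendstoInMean P (fun N ω => u N * Y N ω) (l * a) := by
  constructor
  · filter_upwards [hY.isBddMeas] with N h1 using h1.const_mul _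
  · have hlim : Tendsto (fun N => |u N| * (∫ ω, |Y N ω - a| ∂(P N)) + |u N - l| * |a|) atTop
        (𝓝 0) := by
      have h1 := hu.abs.mul hY.tendsto
      have h2 := ((hu.sub_const l).abs).mul_const |a|
      simpa using h1.add h2
    refine squeeze_zero' (Eventually.of_forall fun N => integral_nonneg fun _ => abs_nonneg _) ?_
      hlim
    filter_upwards [hY.isBddMeas] with N h1
    have i1 := (h1.sub (.const a)).abs
    have e1 : |u N - l| * |a| = ∫ _, |u N - l| * |a| ∂(P N) := by simp
    rw [← integral_const_mul, e1, ← integral_add ((i1.const_mul _).integrable _)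
      (integrable_const _)]
    refine integral_mono (((h1.const_mul _).sub (.const _)).abs.integrable _)
      (((i1.const_mul _).add (.const _)).integrable _) fun ω => ?_
    have e : u N * Y N ω - l * a = u N * (Y N ω - a) + (u N - l) * a := by ring
    simp only [e, ← abs_mul]
    exact abs_add_le _ _

/-- $YZ-ab=Z(Y-a)+a(Z-b)$, so a uniform bound is needed on one factor only. -/
lemma mul_of_bdd (hY : TendstoInMean P Y a) (hZ : TendstoInMean P Z b) {C : ℝ}
    (hC : ∀ᶠ N in atTop, ∀ ω, |Z N ω| ≤ C) :
    TendstoInMean P (fun N ω => Y N ω * Z N ω) (a * b) := by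
  constructor
  · filter_upwards [hY.isBddMeas, hZ.isBddMeas] with N h1 h2 using h1.mul h2
  · have hlim : Tendsto (fun N => C * (∫ ω, |Y N ω - a| ∂(P N)) +
        |a| * ∫ ω, |Z N ω - b| ∂(P N)) atTop (𝓝 0) := by
      simpa using (hY.tendsto.const_mul C).add (hZ.tendsto.const_mul |a|)
    refine squeeze_zero' (Eventually.of_forall fun N => integral_nonneg fun _ => abs_nonneg _) ?_
      hlim
    filter_upwards [hY.isBddMeas, hZ.isBddMeas, hC] with N h1 h2 h3
    have i1 := (h1.sub (.const a)).abs
    have i2 := (h2.sub (.const b)).abs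
    rw [← integral_const_mul, ← integral_const_mul, ← integral_add ((i1.const_mul _).integrable _)
      ((i2.const_mul _).integrable _)]
    refine integral_mono (((h1.mul h2).sub (.const _)).abs.integrable _)
      (((i1.const_mul _).add (i2.const_mul _)).integrable _) fun ω => ?_
    have e : Y N ω * Z N ω - a * b = Z N ω * (Y N ω - a) + a * (Z N ω - b) := by ring
    simp only [e]
    refine (abs_add_le _ _).trans ?_
    rw [abs_mul, abs_mul]
    exact add_le_add (mul_le_mul_of_nonneg_right (h3 ω) (abs_nonneg _)) le_rfl

lemma of_integral_sq (hY : ∀ᶠ N in atTop, IsBddMeas (Y N))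
    (h : Tendsto (fun N => ∫ ω, (Y N ω - a) ^ 2 ∂(P N)) atTop (𝓝 0)) : TendstoInMean P Y a := by
  refine ⟨hY, ?_⟩
  have h2 : Tendsto (fun N => Real.sqrt (∫ ω, (Y N ω - a) ^ 2 ∂(P N))) atTop (𝓝 0) := by
    simpa [Function.comp_def] using (Real.continuous_sqrt.tendsto 0).comp h
  refine squeeze_zero' (Eventually.of_forall fun N => integral_nonneg fun _ => abs_nonneg _) ?_ h2
  filter_upwards [hY] with N h1
  refine Real.le_sqrt_of_sq_le ?_
  simpa only [sq_abs] using sq_integral_le (μ := P N) (h1.sub (.const a)).abs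

lemma tendsto_integral (hY : TendstoInMean P Y a) :
    Tendsto (fun N => ∫ ω, Y N ω ∂(P N)) atTop (𝓝 a) := by
  rw [tendsto_iff_norm_sub_tendsto_zero]
  refine squeeze_zero' (Eventually.of_forall fun N => norm_nonneg _) ?_ hY.tendsto
  filter_upwards [hY.isBddMeas] with N h1
  have e : (∫ ω, Y N ω ∂(P N)) - a = ∫ ω, (Y N ω - a) ∂(P N) := by
    rw [integral_sub (h1.integrable _) (integrable_const _)]; simp
  rw [e]
  exact norm_integral_le_integral_norm _

lemma tendstoInProb (hY : TendstoInMean P Y a) : TendstoInProb P Y a := by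
  intro ε hε
  have h0 : Tendsto (fun N => ENNReal.ofReal ((∫ ω, |Y N ω - a| ∂(P N)) / ε)) atTop (𝓝 0) := by
    have := ENNReal.tendsto_ofReal (hY.tendsto.div_const ε)
    simpa using this
  refine tendsto_of_tendsto_of_tendsto_of_le_of_le' tendsto_const_nhds h0
    (Eventually.of_forall fun _ => zero_le) ?_
  filter_upwards [hY.isBddMeas] with N h1
  have i1 := (h1.sub (.const a)).abs
  have := mul_meas_ge_le_integral_of_nonneg (μ := P N)
    (Eventually.of_forall fun ω => abs_nonneg (Y N ω - a)) (i1.integrable _) ε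
  rw [← ofReal_measureReal]
  refine ENNReal.ofReal_le_ofReal ?_
  rw [le_div_iff₀ hε, mul_comm]
  exact this

end TendstoInMean

end Convergence

/-! ### Rates of convergence -/

lemma add_pow_four_le (a b : ℝ) : (a + b) ^ 4 ≤ 8 * (a ^ 4 + b ^ 4) := by
  nlinarith [sq_nonneg (a ^ 2 - b ^ 2), sq_nonneg (a - b), sq_nonneg ((a - b) ^ 2),
    mul_nonneg (sq_nonneg (a - b)) (add_nonneg (sq_nonneg a) (sq_nonneg b)),
    mul_nonneg (sq_nonneg (a - b)) (sq_nonneg (a + b))]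

/-- A sequence of particle filters whose numbers of particles at time `p` are asymptotic
to `c p * N`. -/
structure IsFilterSequence {X : Type*} [MeasurableSpace X] {Ω : ℕ → Type*}
    [∀ N, MeasurableSpace (Ω N)] (P : (N : ℕ) → Measure (Ω N)) (M₀ : Measure X)
    (M : ℕ → Kernel X X) (G : ℕ → X → ℝ) (n : ℕ) (c : ℕ → ℝ) {k : ℕ → ℕ → ℕ}
    (ζ : (N p : ℕ) → Fin (k N p) → Ω N → X)
    (A : (N p : ℕ) → Fin (k N (p + 1)) → Ω N → Fin (k N p)) (N₀ : ℕ) (R : ℝ) : Prop where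
  isBddMeas_potential : ∀ q, IsBddMeas (G q)
  potential_pos : ∀ q x, 0 < G q x
  filter : ∀ N, N₀ ≤ N → IsParticleFilter (P N) M₀ M G n (k N) (ζ N) (A N)
  two_le : ∀ N, N₀ ≤ N → ∀ p ≤ n, 2 ≤ k N p
  le_mul : ∀ N, N₀ ≤ N → ∀ p ≤ n, (N : ℝ) ≤ R * k N p
  ratio : ∀ p ≤ n, Tendsto (fun N : ℕ => (N : ℝ) / k N p) atTop (𝓝 (1 / c p))

namespace IsFilterSequence

variable {X : Type*} [MeasurableSpace X] {Ω : ℕ → Type*} [∀ N, MeasurableSpace (Ω N)]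
  {P : (N : ℕ) → Measure (Ω N)} {M₀ : Measure X} {M : ℕ → Kernel X X}
  {G : ℕ → X → ℝ} {n : ℕ} {c : ℕ → ℝ} {k : ℕ → ℕ → ℕ} {ζ : (N p : ℕ) → Fin (k N p) → Ω N → X}
  {A : (N p : ℕ) → Fin (k N (p + 1)) → Ω N → Fin (k N p)} {N₀ : ℕ} {R : ℝ}

lemma cast_pos (h : IsFilterSequence P M₀ M G n c ζ A N₀ R) {N p : ℕ} (hN : N₀ ≤ N)
    (hp : p ≤ n) : (0 : ℝ) < k N p := by
  have := h.two_le N hN p hp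
  exact_mod_cast (by omega : 0 < k N p)

lemma div_le (h : IsFilterSequence P M₀ M G n c ζ A N₀ R) {N p : ℕ} (hN : N₀ ≤ N)
    (hp : p ≤ n) : (N : ℝ) / k N p ≤ R := by
  rw [div_le_iff₀ (h.cast_pos hN hp)]
  exact h.le_mul N hN p hp

lemma tendsto_inv (h : IsFilterSequence P M₀ M G n c ζ A N₀ R) {p : ℕ} (hp : p ≤ n) :
    Tendsto (fun N => 1 / (k N p : ℝ)) atTop (𝓝 0) := by
  have h1 := (h.ratio p hp).mul (tendsto_one_div_atTop_nhds_zero_nat (𝕜 := ℝ))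
  rw [mul_zero] at h1
  refine h1.congr' ?_
  filter_upwards [eventually_gt_atTop 0] with N hN
  have : (N : ℝ) ≠ 0 := by exact_mod_cast hN.ne'
  field_simp

/-- A bound on `γ_p^N(f)` which is uniform in `N`. -/
lemma exists_mean_le (h : IsFilterSequence P M₀ M G n c ζ A N₀ R) (p : ℕ) {f : X → ℝ}
    (hf : IsBddMeas f) :
    ∃ W, 0 ≤ W ∧ ∀ N ω, |State.mean (stateN G (ζ N) (A N) p ω) f| ≤ W := by
  choose B hB0 hB using fun q => (h.isBddMeas_potential q).exists_nonneg
  obtain ⟨C, hC0, hC⟩ := hf.exists_nonneg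
  exact ⟨(∏ q ∈ Finset.range p, B q) * C, mul_nonneg (Finset.prod_nonneg fun q _ => hB0 q) hC0,
    fun N ω => abs_mean_le h.potential_pos hB0 hB hC0 hC p ω⟩

/-- For $r=k/(k-1)$ one has $N(r-1)=(N/k)\,r$ and $N(br-1)=N(b-1)r+N(r-1)$. The induction uses the
second limit at time `p`. -/
lemma tendsto_mul_biasFactor_sub_one (h : IsFilterSequence P M₀ M G n c ζ A N₀ R) {p : ℕ}
    (hp : p ≤ n) :
    Tendsto (fun N => biasFactor (k N) p) atTop (𝓝 1) ∧
    Tendsto (fun N : ℕ => (N : ℝ) * (biasFactor (k N) p - 1)) atTop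
      (𝓝 (∑ q ∈ Finset.range (p + 1), 1 / c q)) := by
  have hone : ∀ q ≤ n, Tendsto (fun N => (k N q : ℝ) / ((k N q : ℝ) - 1)) atTop (𝓝 1) := by
    intro q hq
    have h1 : Tendsto (fun N => (1 - 1 / (k N q : ℝ))⁻¹) atTop (𝓝 1) := by
      simpa using ((h.tendsto_inv hq).const_sub 1).inv₀ (by norm_num)
    refine h1.congr' ?_
    filter_upwards [eventually_ge_atTop N₀] with N hN
    have := h.cast_pos hN hq
    field_simp
  have hNone : ∀ q ≤ n, Tendsto (fun N : ℕ => (N : ℝ) * ((k N q : ℝ) / ((k N q : ℝ) - 1) - 1)) atTop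
      (𝓝 (1 / c q)) := by
    intro q hq
    have h1 := (h.ratio q hq).mul (hone q hq)
    rw [mul_one] at h1
    refine h1.congr' ?_
    filter_upwards [eventually_ge_atTop N₀] with N hN
    have h2 : (2 : ℝ) ≤ k N q := by exact_mod_cast h.two_le N hN q hq
    have : (k N q : ℝ) - 1 ≠ 0 := by linarith
    field_simp
    ring
  induction p with
  | zero =>
    simp only [biasFactor, zero_add, Finset.range_one, Finset.prod_singleton,
      Finset.sum_singleton]
    exact ⟨hone 0 hp, hNone 0 hp⟩
  | succ p ih =>
    obtain ⟨ih1, ih2⟩ := ih (Nat.le_of_succ_le hp)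
    simp only [biasFactor_succ]
    refine ⟨by simpa using ih1.mul (hone _ hp), ?_⟩
    rw [Finset.sum_range_succ]
    have := (ih2.mul (hone _ hp)).add (hNone _ hp)
    rw [mul_one] at this
    exact this.congr fun N => by ring

variable [∀ N, IsProbabilityMeasure (P N)] [IsProbabilityMeasure M₀] [∀ p, IsMarkovKernel (M p)]

/-- The fourth moment of the error of `γ_p^N(f)` is of order `N⁻²`. -/
lemma exists_fourth_moment_le (h : IsFilterSequence P M₀ M G n c ζ A N₀ R) {p : ℕ} (hp : p ≤ n)
    {f : X → ℝ} (hf : IsBddMeas f) :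
    ∃ K, ∀ N, N₀ ≤ N → (N : ℝ) ^ 2 * ∫ ω, (State.mean (stateN G (ζ N) (A N) p ω) f -
      ∫ x, f x ∂(gammaMeas M₀ M G p)) ^ 4 ∂(P N) ≤ K := by
  have hG := h.isBddMeas_potential
  have hpos := h.potential_pos
  have hR : ∀ N, N₀ ≤ N → ∀ q ≤ n, ((N : ℝ) / k N q) ^ 2 ≤ R ^ 2 := fun N hN q hq =>
    pow_le_pow_left₀ (by positivity) (h.div_le hN hq) 2
  induction p generalizing f with
  | zero =>
    obtain ⟨C, hC0, hC⟩ := hf.exists_nonneg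
    refine ⟨R ^ 2 * (176 * C ^ 4), fun N hN => ?_⟩
    have h4 := (h.filter N hN).integral_mean_zero_sub_pow_four_le
      ((h.two_le N hN 0 hp).trans' one_le_two) hf hC
    calc _ ≤ (N : ℝ) ^ 2 * (176 * C ^ 4 / (k N 0 : ℝ) ^ 2) :=
          mul_le_mul_of_nonneg_left h4 (by positivity)
      _ = ((N : ℝ) / k N 0) ^ 2 * (176 * C ^ 4) := by ring
      _ ≤ _ := mul_le_mul_of_nonneg_right (hR N hN 0 hp) (by positivity)
  | succ p ih =>
    obtain ⟨C, hC0, hC⟩ := hf.exists_nonneg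
    obtain ⟨W, hW0, hW⟩ := h.exists_mean_le p (hG p)
    have hQ := hf.fkOp (K := M (p + 1)) (hG p)
    obtain ⟨K, hK⟩ := ih (Nat.le_of_succ_le hp) hQ
    refine ⟨8 * (R ^ 2 * (W ^ 4 * (176 * C ^ 4)) + K), fun N hN => ?_⟩
    have hF := h.filter N hN
    have h4 := hF.integral_mean_succ_sub_pow_four_le hG hpos (h.two_le N hN) hp
      (fun ω => (le_abs_self _).trans (hW N ω)) hf hC
    have i1 := ((hF.isBddMeas_mean hG hp hf).sub
      (hF.isBddMeas_mean hG (Nat.le_of_succ_le hp) hQ)).pow 4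
    have i2 := ((hF.isBddMeas_mean hG (Nat.le_of_succ_le hp) hQ).sub
      (.const (∫ x, fkOp (G p) (M (p + 1)) f x ∂(gammaMeas M₀ M G p)))).pow 4
    -- The error at time `p + 1` is the fresh sampling error plus the error at time `p` for `fkOp (G
    -- p) (M (p + 1)) f`, which the induction hypothesis covers.
    have hle : ∫ ω, (State.mean (stateN G (ζ N) (A N) (p + 1) ω) f -
        ∫ x, f x ∂(gammaMeas M₀ M G (p + 1))) ^ 4 ∂(P N) ≤
        8 * ((∫ ω, (State.mean (stateN G (ζ N) (A N) (p + 1) ω) f -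
          State.mean (stateN G (ζ N) (A N) p ω) (fkOp (G p) (M (p + 1)) f)) ^ 4 ∂(P N)) +
        ∫ ω, (State.mean (stateN G (ζ N) (A N) p ω) (fkOp (G p) (M (p + 1)) f) -
          ∫ x, fkOp (G p) (M (p + 1)) f x ∂(gammaMeas M₀ M G p)) ^ 4 ∂(P N)) := by
      rw [integral_gammaMeas_succ hG hpos p hf, ← integral_add (i1.integrable _)
        (i2.integrable _), ← integral_const_mul]
      refine integral_mono ((((hF.isBddMeas_mean hG hp hf).sub (.const _)).pow 4).integrable _)
        (((i1.add i2).const_mul 8).integrable _) fun ω => ?_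
      have := add_pow_four_le
        (State.mean (stateN G (ζ N) (A N) (p + 1) ω) f -
          State.mean (stateN G (ζ N) (A N) p ω) (fkOp (G p) (M (p + 1)) f))
        (State.mean (stateN G (ζ N) (A N) p ω) (fkOp (G p) (M (p + 1)) f) -
          ∫ x, fkOp (G p) (M (p + 1)) f x ∂(gammaMeas M₀ M G p))
      simpa only [sub_add_sub_cancel] using this
    calc _ ≤ (N : ℝ) ^ 2 * _ := mul_le_mul_of_nonneg_left hle (by positivity)
      _ ≤ (N : ℝ) ^ 2 * (8 * (W ^ 4 * (176 * C ^ 4 / (k N (p + 1) : ℝ) ^ 2) +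
        ∫ ω, (State.mean (stateN G (ζ N) (A N) p ω) (fkOp (G p) (M (p + 1)) f) -
          ∫ x, fkOp (G p) (M (p + 1)) f x ∂(gammaMeas M₀ M G p)) ^ 4 ∂(P N))) := by gcongr
      _ = 8 * (((N : ℝ) / k N (p + 1)) ^ 2 * (W ^ 4 * (176 * C ^ 4)) + (N : ℝ) ^ 2 *
        ∫ ω, (State.mean (stateN G (ζ N) (A N) p ω) (fkOp (G p) (M (p + 1)) f) -
          ∫ x, fkOp (G p) (M (p + 1)) f x ∂(gammaMeas M₀ M G p)) ^ 4 ∂(P N)) := by ring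
      _ ≤ _ := by
        have := hK N hN
        have := hR N hN (p + 1) hp
        gcongr

/-- The probability that two particles have the same Eve index is of order `N⁻¹`. -/
lemma exists_tagSq_le (h : IsFilterSequence P M₀ M G n c ζ A N₀ R) {p : ℕ} (hp : p ≤ n) :
    ∃ K, 0 ≤ K ∧ ∀ N, N₀ ≤ N →
      (N : ℝ) * ∫ ω, State.tagSq (stateN G (ζ N) (A N) p ω) (fun _ => 1) ∂(P N) ≤ K := by
  have hG := h.isBddMeas_potential
  have hpos := h.potential_pos
  have h1 : IsBddMeas (fun _ : X => (1 : ℝ)) := .const 1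
  induction p with
  | zero =>
    -- `R` carries no sign assumption, and `K` has to be nonnegative for the monotonicity steps that
    -- use it.
    refine ⟨max R 0, le_max_right _ _, fun N hN => ?_⟩
    have hk := (h.two_le N hN 0 hp).trans' one_le_two
    simp only [tagSq_zero]
    rw [integral_const_mul, (h.filter N hN).integral_mean_zero hk (h1.pow 2)]
    simpa [div_eq_mul_inv] using Or.inl (h.div_le hN hp)
  | succ p ih =>
    obtain ⟨K, hK0, hK⟩ := ih (Nat.le_of_succ_le hp)
    obtain ⟨W, hW0, hW⟩ := h.exists_mean_le p (hG p)
    obtain ⟨b, hb0, hb⟩ := (hG p).exists_nonneg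
    refine ⟨max R 0 * (W * W) + b ^ 2 * K, by positivity, fun N hN => ?_⟩
    have hF := h.filter N hN
    have hk0 := h.cast_pos hN hp
    have hk1 : (1 : ℝ) ≤ k N (p + 1) := by
      exact_mod_cast (h.two_le N hN (p + 1) hp).trans' one_le_two
    rw [hF.integral_tagSq_succ hG hpos (h.two_le N hN) hp h1]
    simp only [one_pow, fkOp_one]
    have hm := hF.isBddMeas_mean hG (Nat.le_of_succ_le hp) (hG p)
    have hB : ∫ ω, State.mean (stateN G (ζ N) (A N) p ω) (G p) *
        State.mean (stateN G (ζ N) (A N) p ω) (G p) ∂(P N) ≤ W * W := by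
      refine (le_abs_self _).trans (IsBddMeas.abs_integral_le fun ω => ?_)
      rw [abs_mul]
      exact mul_le_mul (hW N ω) (hW N ω) (abs_nonneg _) hW0
    have hS : ∫ ω, State.tagSq (stateN G (ζ N) (A N) p ω) (G p) ∂(P N) ≤
        b ^ 2 * ∫ ω, State.tagSq (stateN G (ζ N) (A N) p ω) (fun _ => 1) ∂(P N) := by
      rw [← integral_const_mul]
      exact integral_mono ((hF.isBddMeas_tagSq hG (Nat.le_of_succ_le hp) (hG p)).integrable _)
        (((hF.isBddMeas_tagSq hG (Nat.le_of_succ_le hp) h1).const_mul _).integrable _)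
        fun ω => tagSq_le hpos (fun x => (hpos p x).le) (fun x => (le_abs_self _).trans (hb x)) p ω
    have hS0 : 0 ≤ ∫ ω, State.tagSq (stateN G (ζ N) (A N) p ω) (G p) ∂(P N) :=
      integral_nonneg fun ω => tagSq_nonneg _ p ω
    have hle1 : (1 - 1 / (k N (p + 1) : ℝ)) *
        ∫ ω, State.tagSq (stateN G (ζ N) (A N) p ω) (G p) ∂(P N) ≤
        b ^ 2 * ∫ ω, State.tagSq (stateN G (ζ N) (A N) p ω) (fun _ => 1) ∂(P N) := by
      refine (mul_le_of_le_one_left hS0 ?_).trans hS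
      have : 0 ≤ 1 / (k N (p + 1) : ℝ) := by positivity
      linarith
    have hR : (N : ℝ) / k N (p + 1) ≤ max R 0 := (h.div_le hN hp).trans (le_max_left _ _)
    calc _ ≤ (N : ℝ) * (1 / k N (p + 1) * (W * W) +
          b ^ 2 * ∫ ω, State.tagSq (stateN G (ζ N) (A N) p ω) (fun _ => 1) ∂(P N)) := by gcongr
      _ = (N : ℝ) / k N (p + 1) * (W * W) + b ^ 2 * ((N : ℝ) *
          ∫ ω, State.tagSq (stateN G (ζ N) (A N) p ω) (fun _ => 1) ∂(P N)) := by ring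
      _ ≤ _ := by
        have := hK N hN
        gcongr

/-- The probability that three particles have the same Eve index is of order `N⁻²`. -/
lemma exists_tagCube_le (h : IsFilterSequence P M₀ M G n c ζ A N₀ R) {p : ℕ} (hp : p ≤ n) :
    ∃ K, 0 ≤ K ∧ ∀ N, N₀ ≤ N →
      (N : ℝ) ^ 2 * ∫ ω, State.tagCube (stateN G (ζ N) (A N) p ω) (fun _ => 1) ∂(P N) ≤ K := by
  have hG := h.isBddMeas_potential
  have hpos := h.potential_pos
  have hR : ∀ N, N₀ ≤ N → ∀ q ≤ n, ((N : ℝ) / k N q) ^ 2 ≤ R ^ 2 := fun N hN q hq =>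
    pow_le_pow_left₀ (by positivity) (h.div_le hN hq) 2
  induction p with
  | zero =>
    refine ⟨R ^ 2, by positivity, fun N hN => ?_⟩
    simp only [tagCube_zero ((h.two_le N hN 0 hp).trans' one_le_two)]
    simpa [div_eq_mul_inv, mul_pow] using hR N hN 0 hp
  | succ p ih =>
    obtain ⟨K, hK0, hK⟩ := ih (Nat.le_of_succ_le hp)
    obtain ⟨L, hL0, hL⟩ := h.exists_tagSq_le (Nat.le_of_succ_le hp)
    obtain ⟨W, hW0, hW⟩ := h.exists_mean_le p (hG p)
    obtain ⟨b, hb0, hb⟩ := (hG p).exists_nonneg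
    refine ⟨b ^ 3 * K + 3 * max R 0 * (W * (b ^ 2 * L)) + R ^ 2 * W ^ 3, by positivity,
      fun N hN => ?_⟩
    have hstep := (h.filter N hN).integral_tagCube_succ_le hG hpos (h.two_le N hN) hp
      (fun ω => (le_abs_self _).trans (hW N ω)) (fun x => (le_abs_self _).trans (hb x))
    have hR' : (N : ℝ) / k N (p + 1) ≤ max R 0 := (h.div_le hN hp).trans (le_max_left _ _)
    refine (mul_le_mul_of_nonneg_left hstep (by positivity)).trans ?_
    set D3 := ∫ ω, State.tagCube (stateN G (ζ N) (A N) p ω) (fun _ => 1) ∂(P N)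
    set D2 := ∫ ω, State.tagSq (stateN G (ζ N) (A N) p ω) (fun _ => 1) ∂(P N) with hD2
    have hD20 : 0 ≤ D2 := integral_nonneg fun ω => tagSq_nonneg _ p ω
    calc _ = b ^ 3 * ((N : ℝ) ^ 2 * D3) + 3 * ((N : ℝ) / k N (p + 1)) *
          (W * (b ^ 2 * ((N : ℝ) * D2))) + ((N : ℝ) / k N (p + 1)) ^ 2 * W ^ 3 := by ring
      _ ≤ _ := by
        have := hK N hN
        have := hL N hN
        have := hR N hN (p + 1) hp
        gcongr

/-! ### Limits -/

lemma tendstoInMean_mean (h : IsFilterSequence P M₀ M G n c ζ A N₀ R) {p : ℕ} (hp : p ≤ n)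
    {f : X → ℝ} (hf : IsBddMeas f) :
    TendstoInMean P (fun N ω => State.mean (stateN G (ζ N) (A N) p ω) f)
      (∫ x, f x ∂(gammaMeas M₀ M G p)) := by
  have hbdd : ∀ᶠ N in atTop, IsBddMeas fun ω => State.mean (stateN G (ζ N) (A N) p ω) f := by
    filter_upwards [eventually_ge_atTop N₀] with N hN
    exact (h.filter N hN).isBddMeas_mean h.isBddMeas_potential hp hf
  obtain ⟨K, hK⟩ := h.exists_fourth_moment_le hp hf
  refine .of_integral_sq hbdd ?_
  -- The second moment is at most the square root of the fourth, hence at most $\sqrt K/N$.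
  have hlim : Tendsto (fun N : ℕ => Real.sqrt K * (1 / (N : ℝ))) atTop (𝓝 0) := by
    simpa using (tendsto_one_div_atTop_nhds_zero_nat (𝕜 := ℝ)).const_mul (Real.sqrt K)
  refine squeeze_zero' (Eventually.of_forall fun N => integral_nonneg fun _ => sq_nonneg _) ?_ hlim
  filter_upwards [hbdd, eventually_ge_atTop N₀, eventually_gt_atTop 0] with N hb hN hN0
  have hN' : (0 : ℝ) < N := by exact_mod_cast hN0
  have h4 := sq_integral_le (μ := P N) ((hb.sub (.const (∫ x, f x ∂(gammaMeas M₀ M G p)))).pow 2)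
  simp only [← pow_mul] at h4
  norm_num at h4
  rw [mul_one_div, le_div_iff₀ hN']
  refine Real.le_sqrt_of_sq_le ?_
  rw [mul_pow, mul_comm]
  exact (mul_le_mul_of_nonneg_left h4 (by positivity)).trans (hK N hN)

end IsFilterSequence

/-- The limit of `N` times the sum over the Eve indices of the squared contributions to
`γ_p^N(f)`. -/
def tagSqLim {X : Type*} [MeasurableSpace X] (M₀ : Measure X) (M : ℕ → Kernel X X)
    (G : ℕ → X → ℝ) (c : ℕ → ℝ) : ℕ → (X → ℝ) → ℝ
  | 0, f => 1 / c 0 * ∫ x, f x ^ 2 ∂M₀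
  | p + 1, f => tagSqLim M₀ M G c p (fkOp (G p) (M (p + 1)) f) +
      1 / c (p + 1) * ((gammaMeas M₀ M G (p + 1)).real Set.univ *
        ∫ x, f x ^ 2 ∂(gammaMeas M₀ M G (p + 1)))

namespace IsFilterSequence

variable {X : Type*} [MeasurableSpace X] {Ω : ℕ → Type*} [∀ N, MeasurableSpace (Ω N)]
  {P : (N : ℕ) → Measure (Ω N)} {M₀ : Measure X} {M : ℕ → Kernel X X}
  {G : ℕ → X → ℝ} {n : ℕ} {c : ℕ → ℝ} {k : ℕ → ℕ → ℕ} {ζ : (N p : ℕ) → Fin (k N p) → Ω N → X}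
  {A : (N p : ℕ) → Fin (k N (p + 1)) → Ω N → Fin (k N p)} {N₀ : ℕ} {R : ℝ}
  [∀ N, IsProbabilityMeasure (P N)] [IsProbabilityMeasure M₀] [∀ p, IsMarkovKernel (M p)]

/-- $N\,T_{p+1}(f)$ is its conditional mean given generation $p$ plus a fluctuation. The mean
converges by the law of large numbers and the induction hypothesis for $Q_pf$ (`hcond`); the
fluctuation vanishes in $L^2$ (`herr`). -/
lemma tendstoInMean_tagSq (h : IsFilterSequence P M₀ M G n c ζ A N₀ R) {p : ℕ} (hp : p ≤ n)
    {f : X → ℝ} (hf : IsBddMeas f) :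
    TendstoInMean P (fun N ω => (N : ℝ) * State.tagSq (stateN G (ζ N) (A N) p ω) f)
      (tagSqLim M₀ M G c p f) := by
  have hG := h.isBddMeas_potential
  have hpos := h.potential_pos
  induction p generalizing f with
  | zero =>
    refine ((h.tendstoInMean_mean hp (hf.pow 2)).seq_mul (h.ratio 0 hp)).congr
      (Eventually.of_forall fun N ω => ?_)
    rw [tagSq_zero]; ring
  | succ p ih =>
    have hp' := Nat.le_of_succ_le hp
    have hQ := hf.fkOp (K := M (p + 1)) (hG p)
    have hQ2 := (hf.pow 2).fkOp (K := M (p + 1)) (hG p)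
    obtain ⟨W, hW0, hW⟩ := h.exists_mean_le p (hG p)
    obtain ⟨W₂, hW₂0, hW₂⟩ := h.exists_mean_le p hQ2
    obtain ⟨C, hC0, hC⟩ := hf.exists_nonneg
    obtain ⟨K, hK0, hK⟩ := h.exists_tagCube_le hp
    have hprod := (h.tendstoInMean_mean hp' (hG p)).mul_of_bdd (h.tendstoInMean_mean hp' hQ2)
      (Eventually.of_forall fun N => hW₂ N)
    have hinv : Tendsto (fun N => 1 - 1 / (k N (p + 1) : ℝ)) atTop (𝓝 1) := by
      simpa using (h.tendsto_inv hp).const_sub 1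
    have hcond := (hprod.seq_mul (h.ratio (p + 1) hp)).add ((ih hp' hQ).seq_mul hinv)
    have hbdd : ∀ᶠ N : ℕ in atTop, IsBddMeas fun ω =>
        (N : ℝ) * (State.tagSq (stateN G (ζ N) (A N) (p + 1) ω) f -
        ((1 / k N (p + 1)) * (State.mean (stateN G (ζ N) (A N) p ω) (G p) *
          State.mean (stateN G (ζ N) (A N) p ω) (fkOp (G p) (M (p + 1)) fun x => f x ^ 2)) +
        (1 - 1 / k N (p + 1)) *
          State.tagSq (stateN G (ζ N) (A N) p ω) (fkOp (G p) (M (p + 1)) f))) := by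
      filter_upwards [eventually_ge_atTop N₀] with N hN
      have hF := h.filter N hN
      exact ((hF.isBddMeas_tagSq hG hp hf).sub ((((hF.isBddMeas_mean hG hp' (hG p)).mul
        (hF.isBddMeas_mean hG hp' hQ2)).const_mul _).add
        ((hF.isBddMeas_tagSq hG hp' hQ).const_mul _))).const_mul _
    have herr : TendstoInMean P (fun N ω =>
        (N : ℝ) * (State.tagSq (stateN G (ζ N) (A N) (p + 1) ω) f -
        ((1 / k N (p + 1)) * (State.mean (stateN G (ζ N) (A N) p ω) (G p) *
          State.mean (stateN G (ζ N) (A N) p ω) (fkOp (G p) (M (p + 1)) fun x => f x ^ 2)) +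
        (1 - 1 / k N (p + 1)) *
          State.tagSq (stateN G (ζ N) (A N) p ω) (fkOp (G p) (M (p + 1)) f)))) 0 := by
      refine .of_integral_sq hbdd ?_
      -- The factor $N^2$ from the scaling is absorbed by the expected `tagCube`, at most $K/N^2$;
      -- the factor $1/k$ of the conditional variance is what remains.
      have hlim : Tendsto (fun N : ℕ => 9 * C ^ 4 * W * K * (1 / (k N (p + 1) : ℝ))) atTop
          (𝓝 0) := by simpa using (h.tendsto_inv hp).const_mul (9 * C ^ 4 * W * K)
      refine squeeze_zero' (Eventually.of_forall fun N => integral_nonneg fun _ => sq_nonneg _) ?_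
        hlim
      filter_upwards [eventually_ge_atTop N₀] with N hN
      have hstep := (h.filter N hN).integral_tagSq_succ_sub_sq_le hG hpos (h.two_le N hN) hp
        (fun ω => (le_abs_self _).trans (hW N ω)) hf hC
      simp only [sub_zero, mul_pow]
      rw [integral_const_mul]
      refine (mul_le_mul_of_nonneg_left hstep (by positivity)).trans ?_
      calc _ = 9 * C ^ 4 * W * ((N : ℝ) ^ 2 *
            ∫ ω, State.tagCube (stateN G (ζ N) (A N) (p + 1) ω) (fun _ => 1) ∂(P N)) *
            (1 / (k N (p + 1) : ℝ)) := by ring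
        _ ≤ _ := by
          have := hK N hN
          gcongr
    have hfin := (herr.add hcond).congr (Z := fun N ω =>
      (N : ℝ) * State.tagSq (stateN G (ζ N) (A N) (p + 1) ω) f)
      (Eventually.of_forall fun N ω => by ring)
    convert hfin using 1
    rw [tagSqLim, gammaMeas_real_univ hG, integral_gammaMeas_succ hG hpos p (.const 1),
      integral_gammaMeas_succ hG hpos p (hf.pow 2), fkOp_one]
    ring

end IsFilterSequence

/-! ### The asymptotic variance -/

section AsymptoticVariance

variable {X : Type*} [MeasurableSpace X] {M₀ : Measure X} [IsProbabilityMeasure M₀]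
  {M : ℕ → Kernel X X} [∀ p, IsMarkovKernel (M p)] {G : ℕ → X → ℝ} {c : ℕ → ℝ}

/-- Gives nonnegativity of the asymptotic variance. It is Cauchy-Schwarz at each time separately,
because $\gamma_p(Q_pf)=\gamma_{p+1}(f)$ makes the squared integral the same at every time. -/
lemma sum_mul_sq_le_tagSqLim (hG : ∀ p, IsBddMeas (G p)) (hpos : ∀ p x, 0 < G p x)
    (hc : ∀ p, 0 < c p) (p : ℕ) {f : X → ℝ} (hf : IsBddMeas f) :
    (∑ q ∈ Finset.range (p + 1), 1 / c q) * (∫ x, f x ∂(gammaMeas M₀ M G p)) ^ 2 ≤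
      tagSqLim M₀ M G c p f := by
  induction p generalizing f with
  | zero =>
    simp only [zero_add, Finset.range_one, Finset.sum_singleton, gammaMeas, tagSqLim]
    exact mul_le_mul_of_nonneg_left (sq_integral_le hf) (by have := hc 0; positivity)
  | succ p ih =>
    have := isFiniteMeasure_gammaMeas (M₀ := M₀) (M := M) hG (p + 1)
    have ih' := ih (hf.fkOp (K := M (p + 1)) (hG p))
    rw [← integral_gammaMeas_succ hG hpos p hf] at ih'
    have hcs := sq_integral_le_mul_real_univ (μ := gammaMeas M₀ M G (p + 1)) hf
    rw [Finset.sum_range_succ, add_mul, tagSqLim]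
    refine add_le_add ih' (mul_le_mul_of_nonneg_left ?_ (by have := hc (p + 1); positivity))
    rwa [mul_comm]

lemma fkOp_add_const_mul {g : X → ℝ} {K : Kernel X X} [IsMarkovKernel K] {f₁ f₂ : X → ℝ}
    (h₁ : IsBddMeas f₁) (h₂ : IsBddMeas f₂) (a : ℝ) :
    fkOp g K (fun x => f₁ x + a * f₂ x) = fun x => fkOp g K f₁ x + a * fkOp g K f₂ x := by
  ext x
  simp only [fkOp]
  rw [integral_add (h₁.integrable _) ((h₂.const_mul a).integrable _), integral_const_mul]
  ring

/-- Polarization written with values of the quadratic form only, so that no bilinear form has to be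
carried through the recursion of `tagSqLim`. -/
lemma integral_add_const_mul_sq {μ : Measure X} [IsFiniteMeasure μ] {f₁ f₂ : X → ℝ}
    (h₁ : IsBddMeas f₁) (h₂ : IsBddMeas f₂) (a : ℝ) :
    ∫ x, (f₁ x + a * f₂ x) ^ 2 ∂μ = (1 - a) * (∫ x, f₁ x ^ 2 ∂μ) +
      (a ^ 2 - a) * (∫ x, f₂ x ^ 2 ∂μ) + a * ∫ x, (f₁ x + f₂ x) ^ 2 ∂μ := by
  have e : ∀ x, (f₁ x + a * f₂ x) ^ 2 =
      (1 - a) * f₁ x ^ 2 + (a ^ 2 - a) * f₂ x ^ 2 + a * (f₁ x + f₂ x) ^ 2 := fun x => by ring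
  have i1 := (h₁.pow 2).const_mul (1 - a)
  have i2 := (h₂.pow 2).const_mul (a ^ 2 - a)
  have i3 := ((h₁.add h₂).pow 2).const_mul a
  simp_rw [e]
  rw [integral_add ((i1.add i2).integrable μ) (i3.integrable μ),
    integral_add (i1.integrable μ) (i2.integrable μ)]
  simp only [integral_const_mul]

/-- `tagSqLim` is a quadratic form. -/
lemma tagSqLim_add_const_mul (hG : ∀ p, IsBddMeas (G p)) (p : ℕ)
    {f₁ f₂ : X → ℝ} (h₁ : IsBddMeas f₁) (h₂ : IsBddMeas f₂) (a : ℝ) :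
    tagSqLim M₀ M G c p (fun x => f₁ x + a * f₂ x) = (1 - a) * tagSqLim M₀ M G c p f₁ +
      (a ^ 2 - a) * tagSqLim M₀ M G c p f₂ + a * tagSqLim M₀ M G c p (fun x => f₁ x + f₂ x) := by
  induction p generalizing f₁ f₂ with
  | zero =>
    simp only [tagSqLim]
    rw [integral_add_const_mul_sq h₁ h₂]
    ring
  | succ p ih =>
    have := isFiniteMeasure_gammaMeas (M₀ := M₀) (M := M) hG (p + 1)
    have hone := fkOp_add_const_mul (g := G p) (K := M (p + 1)) h₁ h₂ 1
    simp only [one_mul] at hone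
    simp only [tagSqLim]
    rw [fkOp_add_const_mul h₁ h₂, hone, ih (h₁.fkOp (hG p)) (h₂.fkOp (hG p)),
      integral_add_const_mul_sq h₁ h₂]
    ring

/-- The asymptotic variance of `γ_n^N(φ) / γ_n(1)`. -/
def asymptoticVar (M₀ : Measure X) (M : ℕ → Kernel X X) (G : ℕ → X → ℝ) (c : ℕ → ℝ) (n : ℕ)
    (φ : X → ℝ) : ℝ :=
  (tagSqLim M₀ M G c n φ -
    (∑ q ∈ Finset.range (n + 1), 1 / c q) * (∫ x, φ x ∂(gammaMeas M₀ M G n)) ^ 2) /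
    (gammaMeas M₀ M G n).real Set.univ ^ 2

lemma asymptoticVar_nonneg (hG : ∀ p, IsBddMeas (G p)) (hpos : ∀ p x, 0 < G p x)
    (hc : ∀ p, 0 < c p) (n : ℕ) {φ : X → ℝ} (hφ : IsBddMeas φ) :
    0 ≤ asymptoticVar M₀ M G c n φ :=
  div_nonneg (sub_nonneg.2 (sum_mul_sq_le_tagSqLim hG hpos hc n hφ)) (sq_nonneg _)

/-- The functions on the right do not involve `a`, which enters through the coefficients alone.
`varEst_sub_const` is the same identity for the estimator, where `a` may then be random. -/
lemma asymptoticVar_sub_const (hG : ∀ p, IsBddMeas (G p)) (n : ℕ) {φ : X → ℝ}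
    (hφ : IsBddMeas φ) (a : ℝ) :
    asymptoticVar M₀ M G c n (fun x => φ x - a) =
      (1 + a) * asymptoticVar M₀ M G c n φ + (a ^ 2 + a) * asymptoticVar M₀ M G c n (fun _ => 1) -
        a * asymptoticVar M₀ M G c n (fun x => φ x + 1) := by
  have := isFiniteMeasure_gammaMeas (M₀ := M₀) (M := M) hG n
  have e : (fun x => φ x - a) = fun x => φ x + (-a) * (fun _ : X => (1 : ℝ)) x := by
    ext x; simp [sub_eq_add_neg]
  have i1 : ∫ x, (φ x + 1) ∂(gammaMeas M₀ M G n) =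
      (∫ x, φ x ∂(gammaMeas M₀ M G n)) + (gammaMeas M₀ M G n).real Set.univ := by
    rw [integral_add (hφ.integrable _) (integrable_const _)]; simp
  have i2 : ∫ x, (φ x - a) ∂(gammaMeas M₀ M G n) =
      (∫ x, φ x ∂(gammaMeas M₀ M G n)) - a * (gammaMeas M₀ M G n).real Set.univ := by
    rw [integral_sub (hφ.integrable _) (integrable_const _)]; simp [mul_comm]
  have hq : tagSqLim M₀ M G c n (fun x => φ x - a) = (1 + a) * tagSqLim M₀ M G c n φ +
      (a ^ 2 + a) * tagSqLim M₀ M G c n (fun _ => 1) -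
      a * tagSqLim M₀ M G c n (fun x => φ x + 1) := by
    rw [e, tagSqLim_add_const_mul hG n hφ (.const 1)]; ring
  simp only [asymptoticVar, hq, i1, i2, integral_const, smul_eq_mul, mul_one]
  ring

end AsymptoticVariance

/-! ### Limits of the variance and of the variance estimator -/

lemma varEst_sub_const {X Ω : Type*} {k : ℕ → ℕ} {ζ : (p : ℕ) → Fin (k p) → Ω → X}
    {A : (p : ℕ) → Fin (k (p + 1)) → Ω → Fin (k p)} {n : ℕ} (hk : 1 ≤ k n) (φ : X → ℝ) (a : ℝ)
    (ω : Ω) :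
    varEst ζ A n (fun x => φ x - a) ω =
      (1 + a) * varEst ζ A n φ ω + (a ^ 2 + a) * varEst ζ A n (fun _ => 1) ω -
        a * varEst ζ A n (fun x => φ x + 1) ω := by
  have hk' : (k n : ℝ) ≠ 0 := by exact_mod_cast (by omega : k n ≠ 0)
  have e1 : etaN ζ n (fun x => φ x - a) ω = etaN ζ n φ ω - a := by
    simp only [etaN, Finset.sum_sub_distrib, Finset.sum_const, Finset.card_univ,
      Fintype.card_fin, nsmul_eq_mul]
    field_simp
  have e2 : etaN ζ n (fun x => φ x + 1) ω = etaN ζ n φ ω + 1 := by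
    simp only [etaN, Finset.sum_add_distrib, Finset.sum_const, Finset.card_univ,
      Fintype.card_fin, nsmul_eq_mul]
    field_simp
  have e3 : etaN ζ n (fun _ => 1) ω = 1 := by
    simp [etaN, hk']
  have e4 : (∑ i : Fin (k n), ∑ j : Fin (k n), if eve A n i ω ≠ eve A n j ω then
      (φ (ζ n i ω) - a) * (φ (ζ n j ω) - a) else 0) =
      (1 + a) * (∑ i : Fin (k n), ∑ j : Fin (k n), if eve A n i ω ≠ eve A n j ω then
        φ (ζ n i ω) * φ (ζ n j ω) else 0) +
      (a ^ 2 + a) * (∑ i : Fin (k n), ∑ j : Fin (k n), if eve A n i ω ≠ eve A n j ω then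
        (1 : ℝ) * 1 else 0) -
      a * (∑ i : Fin (k n), ∑ j : Fin (k n), if eve A n i ω ≠ eve A n j ω then
        (φ (ζ n i ω) + 1) * (φ (ζ n j ω) + 1) else 0) := by
    simp only [Finset.mul_sum, ← Finset.sum_add_distrib, ← Finset.sum_sub_distrib]
    refine Finset.sum_congr rfl fun i _ => Finset.sum_congr rfl fun j _ => ?_
    split_ifs <;> ring
  simp only [varEst, e1, e2, e3, e4]
  ring

lemma weightN_pos {X Ω : Type*} {k : ℕ → ℕ} {G : ℕ → X → ℝ} {ζ : (p : ℕ) → Fin (k p) → Ω → X}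
    (hpos : ∀ q x, 0 < G q x) {p : ℕ} (hk : ∀ q ≤ p, 1 ≤ k q) (ω : Ω) : 0 < weightN G ζ p ω :=
  Finset.prod_pos fun q hq => div_pos
    (sum_potential_pos (hk q (Finset.mem_range.1 hq).le) (hpos q) fun i => ζ q i ω)
    (by exact_mod_cast hk q (Finset.mem_range.1 hq).le)

lemma IsParticleFilter.integral_weighted_varEst {X Ω : Type*} [MeasurableSpace X]
    [MeasurableSpace Ω] {k : ℕ → ℕ} {G : ℕ → X → ℝ} {ζ : (p : ℕ) → Fin (k p) → Ω → X}
    {A : (p : ℕ) → Fin (k (p + 1)) → Ω → Fin (k p)} {P : Measure Ω} [IsProbabilityMeasure P]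
    {M₀ : Measure X} [IsProbabilityMeasure M₀] {M : ℕ → Kernel X X} [∀ p, IsMarkovKernel (M p)]
    {n : ℕ} (h : IsParticleFilter P M₀ M G n k ζ A) (hG : ∀ q, IsBddMeas (G q))
    (hpos : ∀ q x, 0 < G q x) (hk : ∀ q ≤ n, 2 ≤ k q) {φ : X → ℝ} (hφ : IsBddMeas φ) :
    ∫ ω, gammaN G ζ n (fun _ => 1) ω ^ 2 * varEst ζ A n φ ω ∂P =
      (∫ ω, State.mean (stateN G ζ A n ω) φ ^ 2 ∂P) -
        (∫ x, φ x ∂(gammaMeas M₀ M G n)) ^ 2 := by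
  simp only [gammaN_one_sq_mul_varEst (hk n le_rfl)]
  rw [integral_sub (((h.isBddMeas_tagSq hG le_rfl hφ).const_mul _).integrable _)
    ((((h.isBddMeas_mean hG le_rfl hφ).pow 2).const_mul _).integrable _), integral_const_mul,
    integral_const_mul, h.integral_varEst hG hpos hk le_rfl hφ]

namespace IsFilterSequence

variable {X : Type*} [MeasurableSpace X] {Ω : ℕ → Type*} [∀ N, MeasurableSpace (Ω N)]
  {P : (N : ℕ) → Measure (Ω N)} {M₀ : Measure X} {M : ℕ → Kernel X X}
  {G : ℕ → X → ℝ} {n : ℕ} {c : ℕ → ℝ} {k : ℕ → ℕ → ℕ} {ζ : (N p : ℕ) → Fin (k N p) → Ω N → X}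
  {A : (N p : ℕ) → Fin (k N (p + 1)) → Ω N → Fin (k N p)} {N₀ : ℕ} {R : ℝ}
  [∀ N, IsProbabilityMeasure (P N)] [IsProbabilityMeasure M₀] [∀ p, IsMarkovKernel (M p)]

lemma tendstoInMean_weighted_varEst (h : IsFilterSequence P M₀ M G n c ζ A N₀ R) {φ : X → ℝ}
    (hφ : IsBddMeas φ) :
    TendstoInMean P (fun N ω => (N : ℝ) *
      (gammaN G (ζ N) n (fun _ => 1) ω ^ 2 * varEst (ζ N) (A N) n φ ω))
      (tagSqLim M₀ M G c n φ -
        (∑ q ∈ Finset.range (n + 1), 1 / c q) * (∫ x, φ x ∂(gammaMeas M₀ M G n)) ^ 2) := by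
  obtain ⟨W, hW0, hW⟩ := h.exists_mean_le n hφ
  obtain ⟨hα, hNα⟩ := h.tendsto_mul_biasFactor_sub_one le_rfl
  have hm := h.tendstoInMean_mean le_rfl hφ
  have hlim := ((h.tendstoInMean_tagSq le_rfl hφ).seq_mul hα).add
    ((hm.mul_of_bdd hm (Eventually.of_forall fun N => hW N)).seq_mul hNα.neg)
  convert hlim.congr (Z := fun N ω => (N : ℝ) *
      (gammaN G (ζ N) n (fun _ => 1) ω ^ 2 * varEst (ζ N) (A N) n φ ω)) ?_ using 1
  · ring
  · filter_upwards [eventually_ge_atTop N₀] with N hN ω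
    rw [gammaN_one_sq_mul_varEst (h.two_le N hN n le_rfl)]
    ring

/-- Expectations converge under the $L^1$ convergence of the weighted estimator, and by lack of bias
they equal $N$ times the variance exactly. -/
lemma tendsto_mul_second_moment (h : IsFilterSequence P M₀ M G n c ζ A N₀ R) {φ : X → ℝ}
    (hφ : IsBddMeas φ) :
    Tendsto (fun N : ℕ => (N : ℝ) *
      ((∫ ω, State.mean (stateN G (ζ N) (A N) n ω) φ ^ 2 ∂(P N)) -
        (∫ x, φ x ∂(gammaMeas M₀ M G n)) ^ 2)) atTop
      (𝓝 (tagSqLim M₀ M G c n φ -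
        (∑ q ∈ Finset.range (n + 1), 1 / c q) * (∫ x, φ x ∂(gammaMeas M₀ M G n)) ^ 2)) := by
  refine (h.tendstoInMean_weighted_varEst hφ).tendsto_integral.congr' ?_
  filter_upwards [eventually_ge_atTop N₀] with N hN
  rw [integral_const_mul, (h.filter N hN).integral_weighted_varEst h.isBddMeas_potential
    h.potential_pos (h.two_le N hN) hφ]

lemma tendsto_mul_variance_gammaN (h : IsFilterSequence P M₀ M G n c ζ A N₀ R) {φ : X → ℝ}
    (hφ : IsBddMeas φ) :
    Tendsto (fun N : ℕ => (N : ℝ) * variance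
      (fun ω => gammaN G (ζ N) n φ ω / (gammaMeas M₀ M G n).real Set.univ) (P N)) atTop
      (𝓝 (asymptoticVar M₀ M G c n φ)) := by
  refine ((h.tendsto_mul_second_moment hφ).div_const
    ((gammaMeas M₀ M G n).real Set.univ ^ 2)).congr' ?_
  filter_upwards [eventually_ge_atTop N₀] with N hN
  have hF := h.filter N hN
  have hG := h.isBddMeas_potential
  have hb := hF.isBddMeas_mean hG le_rfl hφ
  have e : variance (fun ω => gammaN G (ζ N) n φ ω / (gammaMeas M₀ M G n).real Set.univ) (P N) =
      ((∫ ω, State.mean (stateN G (ζ N) (A N) n ω) φ ^ 2 ∂(P N)) -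
        (∫ x, φ x ∂(gammaMeas M₀ M G n)) ^ 2) / (gammaMeas M₀ M G n).real Set.univ ^ 2 := by
    simp only [gammaN_eq_mean (A := A N)]
    rw [variance_eq_sub ((hb.div_const _).memLp (P N) 2)]
    simp only [Pi.pow_apply, div_pow, integral_div]
    rw [hF.integral_mean hG h.potential_pos (h.two_le N hN) le_rfl hφ]
    ring
  rw [e, mul_div_assoc]

/-- The weighted estimator is divided by $\gamma_n^N(1)^2$. This is positive but not bounded away
from zero uniformly, so the argument passes from $L^1$ to convergence in probability. -/
lemma tendstoInProb_varEst (h : IsFilterSequence P M₀ M G n c ζ A N₀ R) {φ : X → ℝ}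
    (hφ : IsBddMeas φ) :
    TendstoInProb P (fun N ω => (N : ℝ) * varEst (ζ N) (A N) n φ ω)
      (asymptoticVar M₀ M G c n φ) := by
  have hG := h.isBddMeas_potential
  have hγ := gammaMeas_real_univ_pos (M₀ := M₀) (M := M) hG h.potential_pos n
  have h1 := h.tendstoInMean_mean le_rfl (.const 1)
  rw [← gammaMeas_real_univ hG] at h1
  have hlim := (h.tendstoInMean_weighted_varEst hφ).tendstoInProb.map₂ h1.tendstoInProb
    (F := fun x y => x / y ^ 2)
    (ContinuousAt.div continuousAt_fst (continuousAt_snd.pow 2) (by positivity))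
  refine hlim.congr ?_
  filter_upwards [eventually_ge_atTop N₀] with N hN ω
  have hw := weightN_pos (ζ := ζ N) h.potential_pos
    (fun q hq => (h.two_le N hN q hq).trans' one_le_two) ω
  have hk := (h.two_le N hN n le_rfl).trans' one_le_two
  rw [gammaN_eq_mean (A := A N), mean_one hk]
  field_simp

lemma tendstoInProb_etaN (h : IsFilterSequence P M₀ M G n c ζ A N₀ R) {φ : X → ℝ}
    (hφ : IsBddMeas φ) :
    TendstoInProb P (fun N ω => etaN (ζ N) n φ ω) (∫ x, φ x ∂(etaMeas M₀ M G n)) := by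
  have hG := h.isBddMeas_potential
  have hγ := gammaMeas_real_univ_pos (M₀ := M₀) (M := M) hG h.potential_pos n
  have h1 := h.tendstoInMean_mean le_rfl (.const 1)
  rw [← gammaMeas_real_univ hG] at h1
  have hlim := (h.tendstoInMean_mean le_rfl hφ).tendstoInProb.map₂ h1.tendstoInProb
    (F := fun x y => x / y) (ContinuousAt.div continuousAt_fst continuousAt_snd hγ.ne')
  rw [integral_etaMeas]
  refine hlim.congr ?_
  filter_upwards [eventually_ge_atTop N₀] with N hN ω
  have hw := weightN_pos (ζ := ζ N) h.potential_pos
    (fun q hq => (h.two_le N hN q hq).trans' one_le_two) ω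
  have hk := (h.two_le N hN n le_rfl).trans' one_le_two
  rw [mean_one hk]
  exact mul_div_cancel_left₀ _ hw.ne'

/-- The centring is random, but `varEst_sub_const` reduces to estimators of three fixed functions
with coefficients continuous in $\eta_n^N(\varphi)$, which converges in probability. -/
lemma tendstoInProb_varEst_centered (h : IsFilterSequence P M₀ M G n c ζ A N₀ R) {φ : X → ℝ}
    (hφ : IsBddMeas φ) :
    TendstoInProb P
      (fun N ω => (N : ℝ) * varEst (ζ N) (A N) n (fun x => φ x - etaN (ζ N) n φ ω) ω)
      (asymptoticVar M₀ M G c n (fun x => φ x - ∫ y, φ y ∂(etaMeas M₀ M G n))) := by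
  have hη := h.tendstoInProb_etaN hφ
  have h1 := h.tendstoInProb_varEst hφ
  have h2 := h.tendstoInProb_varEst (.const 1)
  have h3 := h.tendstoInProb_varEst (hφ.add (.const 1))
  have t1 := hη.map₂ h1 (F := fun a v => (1 + a) * v)
    (by fun_prop)
  have t2 := hη.map₂ h2 (F := fun a v => (a ^ 2 + a) * v)
    (by fun_prop)
  have t3 := hη.map₂ h3 (F := fun a v => a * v) (by fun_prop)
  have t12 := t1.map₂ t2 (F := fun x y => x + y) (by fun_prop)
  have t := t12.map₂ t3 (F := fun x y => x - y) (by fun_prop)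
  rw [asymptoticVar_sub_const h.isBddMeas_potential n hφ]
  refine t.congr ?_
  filter_upwards [eventually_ge_atTop N₀] with N hN ω
  rw [varEst_sub_const ((h.two_le N hN n le_rfl).trans' one_le_two)]
  ring

end IsFilterSequence

/-! ### The mean squared error of the normalized approximation -/

/-- Two weighted arithmetic-geometric inequalities, replacing a third moment by fourth moments. For
$x,d$ of order $N^{-1/2}$ and $r=\sqrt N$ all terms have order $N^{-3/2}$. -/
lemma sq_mul_abs_le {x d r : ℝ} (hr : 0 < r) :
    x ^ 2 * |d| ≤ r / 2 * x ^ 4 + r / 4 * d ^ 4 + 1 / (4 * r ^ 3) := by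
  set s := r⁻¹ with hs
  have hrs : r * s = 1 := mul_inv_cancel₀ hr.ne'
  have e : 1 / (4 * r ^ 3) = s ^ 3 / 4 := by rw [hs]; field_simp
  have hd : |d| ^ 2 = d ^ 2 := sq_abs d
  have h1 : 0 ≤ r / 2 * (x ^ 2 - s * |d|) ^ 2 := by positivity
  have h2 : 0 ≤ r / 4 * (d ^ 2 - s ^ 2) ^ 2 := by positivity
  have e1 : r / 2 * (x ^ 2 - s * |d|) ^ 2 =
      r / 2 * x ^ 4 - x ^ 2 * |d| + s / 2 * d ^ 2 := by
    rw [← hd]; linear_combination (-(x ^ 2 * |d|) + s / 2 * |d| ^ 2) * hrs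
  have e2 : r / 4 * (d ^ 2 - s ^ 2) ^ 2 = r / 4 * d ^ 4 - s / 2 * d ^ 2 + s ^ 3 / 4 := by
    linear_combination (-(s / 2 * d ^ 2) + s ^ 3 / 4) * hrs
  rw [e]
  linarith

/-- A ratio `e = x / T` with denominator `T` near `t` is compared with `x / t`. -/
lemma abs_sq_mul_sub_le {e T t W C : ℝ} (ht : 0 < t) (hT : 0 ≤ T) (hTW : T ≤ W)
    (he : |e| ≤ C) :
    |e ^ 2 * (t ^ 2 - T ^ 2)| ≤
      4 * (t + W) / t ^ 2 * ((T * e) ^ 2 * |T - t|) + 16 * C ^ 2 / t ^ 2 * (T - t) ^ 4 := by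
  have hfac : |e ^ 2 * (t ^ 2 - T ^ 2)| = e ^ 2 * (|T - t| * (t + T)) := by
    have : t ^ 2 - T ^ 2 = -(T - t) * (t + T) := by ring
    rw [this, abs_mul, abs_mul, abs_neg, abs_of_nonneg (sq_nonneg e),
      abs_of_nonneg (by positivity : 0 ≤ t + T)]
  have he2 : e ^ 2 ≤ C ^ 2 := by rw [← sq_abs]; exact pow_le_pow_left₀ (abs_nonneg _) he 2
  have hW : 0 ≤ W := hT.trans hTW
  -- If $T\ge t/2$, then $e^2$ is at most $4(Te)^2/t^2$. Otherwise $|T-t|\ge t/2$, and the fourth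
  -- power of $T-t$ pays for the crude bound $e^2\le C^2$.
  rcases le_total (t / 2) T with hcase | hcase
  · refine le_add_of_le_of_nonneg ?_ (by positivity)
    rw [hfac, div_mul_eq_mul_div, le_div_iff₀ (by positivity)]
    have h4 : t ^ 2 ≤ 4 * T ^ 2 := by nlinarith
    have h5 : 0 ≤ e ^ 2 * |T - t| := by positivity
    calc e ^ 2 * (|T - t| * (t + T)) * t ^ 2 = (e ^ 2 * |T - t|) * ((t + T) * t ^ 2) := by ring
      _ ≤ (e ^ 2 * |T - t|) * ((t + W) * (4 * T ^ 2)) := by gcongr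
      _ = _ := by ring
  · refine le_add_of_nonneg_of_le (by positivity) ?_
    rw [hfac, div_mul_eq_mul_div, le_div_iff₀ (by positivity)]
    have habs : |T - t| = t - T := by rw [abs_sub_comm, abs_of_nonneg (by linarith)]
    have hd : t / 2 ≤ t - T := by linarith
    have h4 : (t / 2) ^ 4 ≤ (T - t) ^ 4 := by
      have := pow_le_pow_left₀ (by positivity) hd 4
      calc _ ≤ (t - T) ^ 4 := this
        _ = _ := by ring
    have h5 : |T - t| * (t + T) ≤ t ^ 2 := by rw [habs]; nlinarith
    calc e ^ 2 * (|T - t| * (t + T)) * t ^ 2 ≤ C ^ 2 * t ^ 2 * t ^ 2 := by gcongr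
      _ = 16 * C ^ 2 * (t / 2) ^ 4 := by ring
      _ ≤ _ := by gcongr

namespace IsFilterSequence

variable {X : Type*} [MeasurableSpace X] {Ω : ℕ → Type*} [∀ N, MeasurableSpace (Ω N)]
  {P : (N : ℕ) → Measure (Ω N)} {M₀ : Measure X} {M : ℕ → Kernel X X}
  {G : ℕ → X → ℝ} {n : ℕ} {c : ℕ → ℝ} {k : ℕ → ℕ → ℕ} {ζ : (N p : ℕ) → Fin (k N p) → Ω N → X}
  {A : (N p : ℕ) → Fin (k N (p + 1)) → Ω N → Fin (k N p)} {N₀ : ℕ} {R : ℝ}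
  [∀ N, IsProbabilityMeasure (P N)] [IsProbabilityMeasure M₀] [∀ p, IsMarkovKernel (M p)]

/-- Normalization by `γ_n^N(1)` and by `γ_n(1)` are asymptotically equivalent for functions
with `γ_n(ψ) = 0`. -/
lemma tendsto_normalization_error (h : IsFilterSequence P M₀ M G n c ζ A N₀ R) {ψ : X → ℝ}
    (hψ : IsBddMeas ψ) (h0 : ∫ x, ψ x ∂(gammaMeas M₀ M G n) = 0) :
    Tendsto (fun N : ℕ => (N : ℝ) * ∫ ω, etaN (ζ N) n ψ ω ^ 2 *
      ((gammaMeas M₀ M G n).real Set.univ ^ 2 -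
        State.mean (stateN G (ζ N) (A N) n ω) (fun _ => 1) ^ 2) ∂(P N)) atTop (𝓝 0) := by
  have hG := h.isBddMeas_potential
  have ht := gammaMeas_real_univ_pos (M₀ := M₀) (M := M) hG h.potential_pos n
  set t := (gammaMeas M₀ M G n).real Set.univ with htdef
  have hone : IsBddMeas (fun _ : X => (1 : ℝ)) := .const 1
  obtain ⟨C, hC0, hC⟩ := hψ.exists_nonneg
  obtain ⟨W, hW0, hW⟩ := h.exists_mean_le n hone
  obtain ⟨K, hK⟩ := h.exists_fourth_moment_le le_rfl hψ
  obtain ⟨K', hK'⟩ := h.exists_fourth_moment_le le_rfl hone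
  rw [h0] at hK
  rw [← gammaMeas_real_univ hG, ← htdef] at hK'
  set a := 4 * (t + W) / t ^ 2 with ha
  set b := 16 * C ^ 2 / t ^ 2 with hb
  have ha0 : 0 ≤ a := by positivity
  have hb0 : 0 ≤ b := by positivity
  have hsq : Tendsto (fun N : ℕ => 1 / Real.sqrt N) atTop (𝓝 0) := by
    have := (Real.tendsto_sqrt_atTop.comp (tendsto_natCast_atTop_atTop (R := ℝ))).inv_tendsto_atTop
    exact this.congr fun N => by simp
  -- With $r=\sqrt N$ in `sq_mul_abs_le`, the first summand of `abs_sq_mul_sub_le` has mean of order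
  -- $N^{-3/2}$ and the second of order $N^{-2}$; both are then multiplied by $N$.
  have hlim : Tendsto (fun N : ℕ => a * (K / 2 + K' / 4 + 1 / 4) * (1 / Real.sqrt N) +
      b * K' * (1 / (N : ℝ))) atTop (𝓝 0) := by
    simpa using (hsq.const_mul (a * (K / 2 + K' / 4 + 1 / 4))).add
      ((tendsto_one_div_atTop_nhds_zero_nat (𝕜 := ℝ)).const_mul (b * K'))
  refine squeeze_zero_norm' ?_ hlim
  filter_upwards [eventually_ge_atTop N₀, eventually_gt_atTop 0] with N hN hN0
  have hN' : (0 : ℝ) < N := by exact_mod_cast hN0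
  have hF := h.filter N hN
  have hk := (h.two_le N hN n le_rfl).trans' one_le_two
  set r := Real.sqrt N with hr
  have hr0 : 0 < r := Real.sqrt_pos.2 hN'
  have hr2 : r ^ 2 = N := Real.sq_sqrt hN'.le
  have hmean : ∀ ω, State.mean (stateN G (ζ N) (A N) n ω) ψ =
      State.mean (stateN G (ζ N) (A N) n ω) (fun _ => 1) * etaN (ζ N) n ψ ω := fun ω => by
    rw [mean_one hk]; rfl
  have bX := hF.isBddMeas_mean hG le_rfl hψ
  have bT := hF.isBddMeas_mean hG le_rfl hone
  have bE := hF.isBddMeas_etaN le_rfl hψ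
  have b1 := ((bX.sub (.const 0)).pow 4)
  have b2 := ((bT.sub (.const t)).pow 4)
  have hpt : ∀ ω, |etaN (ζ N) n ψ ω ^ 2 *
      (t ^ 2 - State.mean (stateN G (ζ N) (A N) n ω) (fun _ => 1) ^ 2)| ≤
      a * (r / 2) * (State.mean (stateN G (ζ N) (A N) n ω) ψ - 0) ^ 4 +
      (a * (r / 4) + b) * (State.mean (stateN G (ζ N) (A N) n ω) (fun _ => 1) - t) ^ 4 +
      a * (1 / (4 * r ^ 3)) := by
    intro ω
    have hT0 : 0 ≤ State.mean (stateN G (ζ N) (A N) n ω) (fun _ => 1) := by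
      rw [mean_one hk]; exact weightN_nonneg h.potential_pos n ω
    have h1 := abs_sq_mul_sub_le ht hT0 ((le_abs_self _).trans (hW N ω))
      (abs_etaN_le (ζ := ζ N) hC0 hC n ω)
    rw [← hmean] at h1
    have h2 := mul_le_mul_of_nonneg_left
      (sq_mul_abs_le (x := State.mean (stateN G (ζ N) (A N) n ω) ψ)
        (d := State.mean (stateN G (ζ N) (A N) n ω) (fun _ => 1) - t) hr0) ha0
    rw [sub_zero]
    refine h1.trans ((add_le_add_left h2 _).trans (le_of_eq ?_))
    ring
  have hint : ∫ ω, |etaN (ζ N) n ψ ω ^ 2 *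
      (t ^ 2 - State.mean (stateN G (ζ N) (A N) n ω) (fun _ => 1) ^ 2)| ∂(P N) ≤
      a * (r / 2) * (∫ ω, (State.mean (stateN G (ζ N) (A N) n ω) ψ - 0) ^ 4 ∂(P N)) +
      (a * (r / 4) + b) *
        (∫ ω, (State.mean (stateN G (ζ N) (A N) n ω) (fun _ => 1) - t) ^ 4 ∂(P N)) +
      a * (1 / (4 * r ^ 3)) := by
    refine (integral_mono (((bE.pow 2).mul
      ((IsBddMeas.const (t ^ 2)).sub (bT.pow 2))).abs.integrable (P N)) ((((b1.const_mul _).add (b2.const_mul _)).add (.const _)).integrable _)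
      hpt).trans (le_of_eq ?_)
    rw [integral_add (((b1.const_mul _).add (b2.const_mul _)).integrable _) (integrable_const _),
      integral_add ((b1.const_mul _).integrable _) ((b2.const_mul _).integrable _),
      integral_const_mul, integral_const_mul]
    simp
  have hKN := hK N hN
  have hKN' := hK' N hN
  set I := ∫ ω, (State.mean (stateN G (ζ N) (A N) n ω) ψ - 0) ^ 4 ∂(P N)
  set I' := ∫ ω, (State.mean (stateN G (ζ N) (A N) n ω) (fun _ => 1) - t) ^ 4 ∂(P N)
  rw [norm_mul, Real.norm_of_nonneg hN'.le]
  refine (mul_le_mul_of_nonneg_left ((norm_integral_le_integral_norm _).trans hint) hN'.le).trans ?_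
  calc (N : ℝ) * (a * (r / 2) * I + (a * (r / 4) + b) * I' + a * (1 / (4 * r ^ 3))) =
        a * (((N : ℝ) ^ 2 * I) / 2 + ((N : ℝ) ^ 2 * I') / 4 + 1 / 4) * (1 / r) +
          b * ((N : ℝ) ^ 2 * I') * (1 / (N : ℝ)) := by
        rw [← hr2]; field_simp; ring
    _ ≤ _ := by gcongr

/-- For $\psi=\varphi-\eta_n(\varphi)$, $t=\gamma_n(1)$ and $T=\gamma_n^N(1)$ one has
$t^2\eta_n^N(\psi)^2=\gamma_n^N(\psi)^2+\eta_n^N(\psi)^2(t^2-T^2)$. As $\gamma_n(\psi)=0$, the first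
term has a known limit and the second is negligible. -/
lemma tendsto_mul_mse_etaN (h : IsFilterSequence P M₀ M G n c ζ A N₀ R) {φ : X → ℝ}
    (hφ : IsBddMeas φ) :
    Tendsto (fun N : ℕ => (N : ℝ) *
      ∫ ω, (etaN (ζ N) n φ ω - ∫ x, φ x ∂(etaMeas M₀ M G n)) ^ 2 ∂(P N)) atTop
      (𝓝 (asymptoticVar M₀ M G c n (fun x => φ x - ∫ y, φ y ∂(etaMeas M₀ M G n)))) := by
  have hG := h.isBddMeas_potential
  have := isFiniteMeasure_gammaMeas (M₀ := M₀) (M := M) hG n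
  have ht := gammaMeas_real_univ_pos (M₀ := M₀) (M := M) hG h.potential_pos n
  have hη := integral_etaMeas (M₀ := M₀) (M := M) (G := G) n φ
  set t := (gammaMeas M₀ M G n).real Set.univ with htdef
  set η := ∫ x, φ x ∂(etaMeas M₀ M G n)
  have hψ : IsBddMeas (fun x => φ x - η) := hφ.sub (.const η)
  have h0 : ∫ x, (φ x - η) ∂(gammaMeas M₀ M G n) = 0 := by
    rw [integral_sub (hφ.integrable _) (integrable_const _), integral_const, ← htdef, hη,
      smul_eq_mul]
    field_simp
    ring
  have hlim := ((h.tendsto_mul_second_moment hψ).add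
    (h.tendsto_normalization_error hψ h0)).div_const (t ^ 2)
  rw [add_zero] at hlim
  refine hlim.congr' ?_
  filter_upwards [eventually_ge_atTop N₀] with N hN
  have hF := h.filter N hN
  have hk := (h.two_le N hN n le_rfl).trans' one_le_two
  have hk' : (k N n : ℝ) ≠ 0 := by exact_mod_cast (by omega : k N n ≠ 0)
  have bE := hF.isBddMeas_etaN le_rfl hψ
  have bX := hF.isBddMeas_mean hG le_rfl hψ
  have bT := hF.isBddMeas_mean hG le_rfl (.const 1)
  have e1 : ∀ ω, etaN (ζ N) n φ ω - η = etaN (ζ N) n (fun x => φ x - η) ω := fun ω => by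
    simp only [etaN, Finset.sum_sub_distrib, Finset.sum_const, Finset.card_univ,
      Fintype.card_fin, nsmul_eq_mul]
    field_simp
  have e2 : ∀ ω, t ^ 2 * etaN (ζ N) n (fun x => φ x - η) ω ^ 2 =
      State.mean (stateN G (ζ N) (A N) n ω) (fun x => φ x - η) ^ 2 +
      etaN (ζ N) n (fun x => φ x - η) ω ^ 2 *
        (t ^ 2 - State.mean (stateN G (ζ N) (A N) n ω) (fun _ => 1) ^ 2) := fun ω => by
    have : State.mean (stateN G (ζ N) (A N) n ω) (fun x => φ x - η) =
        State.mean (stateN G (ζ N) (A N) n ω) (fun _ => 1) *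
          etaN (ζ N) n (fun x => φ x - η) ω := by
      rw [mean_one hk]; rfl
    rw [this]; ring
  have e3 : t ^ 2 * ∫ ω, etaN (ζ N) n (fun x => φ x - η) ω ^ 2 ∂(P N) =
      (∫ ω, State.mean (stateN G (ζ N) (A N) n ω) (fun x => φ x - η) ^ 2 ∂(P N)) +
      ∫ ω, etaN (ζ N) n (fun x => φ x - η) ω ^ 2 *
        (t ^ 2 - State.mean (stateN G (ζ N) (A N) n ω) (fun _ => 1) ^ 2) ∂(P N) := by
    rw [← integral_const_mul, ← integral_add ((bX.pow 2).integrable _)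
      (((bE.pow 2).mul ((IsBddMeas.const (t ^ 2)).sub (bT.pow 2))).integrable _)]
    exact integral_congr_ae (Eventually.of_forall e2)
  simp only [e1]
  rw [h0, div_eq_iff (by positivity)]
  linear_combination (-(N : ℝ)) * e3

end IsFilterSequence

/-! ### Particle numbers proportional to `N` -/

lemma tendsto_div_numParticles {c : ℕ → ℝ} {p : ℕ} (hc : 0 < c p) :
    Tendsto (fun N : ℕ => (N : ℝ) / numParticles c N p) atTop (𝓝 (1 / c p)) := by
  have h := ((tendsto_nat_ceil_mul_div_atTop hc.le).comp
    (tendsto_natCast_atTop_atTop (R := ℝ))).inv₀ hc.ne'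
  rw [one_div]
  refine h.congr fun N => ?_
  simp [numParticles]

lemma isFilterSequence_numParticles {X : Type*} [MeasurableSpace X] {Ω : ℕ → Type*}
    [∀ N, MeasurableSpace (Ω N)] {P : (N : ℕ) → Measure (Ω N)} {M₀ : Measure X}
    {M : ℕ → Kernel X X} {G : ℕ → X → ℝ} (hG : ∀ q, IsBddMeas (G q)) (hpos : ∀ q x, 0 < G q x)
    {c : ℕ → ℝ} (hc : ∀ p, 0 < c p) {n : ℕ}
    {ζ : (N p : ℕ) → Fin (numParticles c N p) → Ω N → X}
    {A : (N p : ℕ) → Fin (numParticles c N (p + 1)) → Ω N → Fin (numParticles c N p)}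
    (h : ∀ N, (∀ p ≤ n, 2 ≤ numParticles c N p) →
      IsParticleFilter (P N) M₀ M G n (numParticles c N) (ζ N) (A N)) {N₀ : ℕ}
    (hN₀ : ∀ N, N₀ ≤ N → ∀ p ≤ n, 2 ≤ numParticles c N p) :
    IsFilterSequence P M₀ M G n c ζ A N₀ (∑ q ∈ Finset.range (n + 1), 1 / c q) where
  isBddMeas_potential := hG
  potential_pos := hpos
  filter N hN := h N (hN₀ N hN)
  two_le := hN₀
  le_mul N _ p hp := by
    have h1 : 1 / c p ≤ ∑ q ∈ Finset.range (n + 1), 1 / c q :=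
      Finset.single_le_sum (f := fun q => 1 / c q) (fun q _ => (one_div_pos.2 (hc q)).le)
        (Finset.mem_range.2 (by omega))
    have h2 : c p * N ≤ numParticles c N p := Nat.le_ceil _
    calc (N : ℝ) = 1 / c p * (c p * N) := by have := (hc p).ne'; field_simp
      _ ≤ 1 / c p * numParticles c N p :=
        mul_le_mul_of_nonneg_left h2 (one_div_pos.2 (hc p)).le
      _ ≤ _ := mul_le_mul_of_nonneg_right h1 (Nat.cast_nonneg _)
  ratio p _ := tendsto_div_numParticles (hc p)

lemma exists_two_le_numParticles {c : ℕ → ℝ} (hc : ∀ p, 0 < c p) (n : ℕ) :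
    ∃ N₀, ∀ N, N₀ ≤ N → ∀ p ≤ n, 2 ≤ numParticles c N p := by
  -- The sum dominates each $1/c_p$, so beyond this threshold $c_pN\ge2$ for all $p\le n$ at once.
  refine ⟨⌈2 * ∑ q ∈ Finset.range (n + 1), 1 / c q⌉₊, fun N hN p hp => ?_⟩
  have h1 : 1 / c p ≤ ∑ q ∈ Finset.range (n + 1), 1 / c q :=
    Finset.single_le_sum (f := fun q => 1 / c q) (fun q _ => (one_div_pos.2 (hc q)).le)
      (Finset.mem_range.2 (by omega))
  have h2 : 2 * (1 / c p) ≤ N := by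
    have := Nat.ceil_le.1 hN
    linarith
  have h3 : (2 : ℝ) ≤ c p * N := by
    calc (2 : ℝ) = c p * (2 * (1 / c p)) := by have := (hc p).ne'; field_simp
      _ ≤ _ := mul_le_mul_of_nonneg_left h2 (hc p).le
  have h4 : (2 : ℝ) ≤ numParticles c N p := h3.trans (Nat.le_ceil _)
  exact_mod_cast h4

end

end ParticleFilter

/-! ### Assembly of the theorem -/

open ParticleFilter

theorem theorem1 {X : Type*} [MeasurableSpace X]
    (M₀ : Measure X) [IsProbabilityMeasure M₀]
    (M : ℕ → Kernel X X) [∀ p, IsMarkovKernel (M p)]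
    (G : ℕ → X → ℝ) (hG_meas : ∀ p, Measurable (G p)) (hG_pos : ∀ p x, 0 < G p x)
    (hG_bdd : ∀ p, ∃ C : ℝ, ∀ x, G p x ≤ C)
    (c : ℕ → ℝ) (hc : ∀ p, 0 < c p) (n : ℕ) :
    ∃ σsq : (X → ℝ) → ℝ,
      (∀ φ, IsBddMeas φ → 0 ≤ σsq φ) ∧
      ∀ (Ω : ℕ → Type*) [∀ N, MeasurableSpace (Ω N)]
        (P : (N : ℕ) → Measure (Ω N)) [∀ N, IsProbabilityMeasure (P N)]
        (ζ : (N p : ℕ) → Fin (numParticles c N p) → Ω N → X)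
        (A : (N p : ℕ) → Fin (numParticles c N (p + 1)) → Ω N → Fin (numParticles c N p)),
        (∀ N, (∀ p ≤ n, 2 ≤ numParticles c N p) →
          IsParticleFilter (P N) M₀ M G n (numParticles c N) (ζ N) (A N)) →
        ∀ φ : X → ℝ, IsBddMeas φ →
          -- `σsq` is the asymptotic variance map
          Tendsto (fun N : ℕ => (N : ℝ) * variance
              (fun ω => gammaN G (ζ N) n φ ω / (gammaMeas M₀ M G n).real Set.univ) (P N))
            atTop (𝓝 (σsq φ)) ∧
          Tendsto (fun N : ℕ => (N : ℝ) *
              ∫ ω, (etaN (ζ N) n φ ω - ∫ x, φ x ∂(etaMeas M₀ M G n)) ^ 2 ∂(P N))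
            atTop (𝓝 (σsq (fun x => φ x - ∫ y, φ y ∂(etaMeas M₀ M G n)))) ∧
          -- lack of bias
          (∀ N, (∀ p ≤ n, 2 ≤ numParticles c N p) →
            MemLp (gammaN G (ζ N) n φ) 2 (P N) ∧
            Integrable (fun ω => gammaN G (ζ N) n (fun _ => 1) ω ^ 2 *
              varEst (ζ N) (A N) n φ ω) (P N) ∧
            ∫ ω, gammaN G (ζ N) n (fun _ => 1) ω ^ 2 * varEst (ζ N) (A N) n φ ω ∂(P N) =
              variance (gammaN G (ζ N) n φ) (P N)) ∧
          -- consistency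
          TendstoInProb P (fun N ω => (N : ℝ) * varEst (ζ N) (A N) n φ ω) (σsq φ) ∧
          TendstoInProb P
            (fun N ω => (N : ℝ) *
              varEst (ζ N) (A N) n (fun x => φ x - etaN (ζ N) n φ ω) ω)
            (σsq (fun x => φ x - ∫ y, φ y ∂(etaMeas M₀ M G n))) := by
  have hG : ∀ q, IsBddMeas (G q) := fun q => by
    obtain ⟨C, hC⟩ := hG_bdd q
    exact ⟨hG_meas q, C, fun x => by rw [abs_of_pos (hG_pos q x)]; exact hC x⟩
  refine ⟨asymptoticVar M₀ M G c n, fun φ hφ => asymptoticVar_nonneg hG hG_pos hc n hφ, ?_⟩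
  intro Ω _ P _ ζ A hPF φ hφ
  obtain ⟨N₀, hN₀⟩ := exists_two_le_numParticles hc n
  have hseq := isFilterSequence_numParticles hG hG_pos hc hPF hN₀
  refine ⟨hseq.tendsto_mul_variance_gammaN hφ, hseq.tendsto_mul_mse_etaN hφ, fun N hk => ?_,
    hseq.tendstoInProb_varEst hφ, hseq.tendstoInProb_varEst_centered hφ⟩
  -- Lack of bias is not asymptotic: `N` may lie below `N₀`, so the filter comes from the hypothesis
  -- and not from `hseq`.
  have hF := hPF N hk
  have hm := hF.isBddMeas_mean hG le_rfl hφ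
  have ht := hF.isBddMeas_tagSq hG le_rfl hφ
  refine ⟨hm.memLp _ 2, ?_, ?_⟩
  · simp only [gammaN_one_sq_mul_varEst (hk n le_rfl)]
    exact ((ht.const_mul _).sub ((hm.pow 2).const_mul _)).integrable _
  · have hv : variance (gammaN G (ζ N) n φ) (P N) =
        (∫ ω, State.mean (stateN G (ζ N) (A N) n ω) φ ^ 2 ∂(P N)) -
          (∫ x, φ x ∂(gammaMeas M₀ M G n)) ^ 2 := by
      rw [← hF.integral_mean hG hG_pos hk le_rfl hφ]
      exact variance_eq_sub (hm.memLp _ 2)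
    rw [hv]
    exact hF.integral_weighted_varEst hG hG_pos hk hφ
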